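/- Let $k$ be a commutative ring of characteristic $0$; linear maps, tensor products and duals are over $k$. A regular unital hom-associative algebra is a $k$-module $A$ with a bilinear product $\mu(a,b)=a\cdot b$, an invertible linear map $\alpha:A\to A$ and an element $1\in A$ such that $\alpha(a\cdot b)=\alpha(a)\cdot\alpha(b)$, $(a\cdot b)\cdot\alpha(c)=\alpha(a)\cdot(b\cdot c)$, $\alpha(1)=1$ and $a\cdot 1=1\cdot a=\alpha(a)$. An $A$-bimodule $(M,\beta)$, with $\beta$ invertible, is a $k$-module with a linear automorphism $\beta$ and bilinear left and right actions of $A$ such that $\beta(am)=\alpha(a)\beta(m)$, $\beta(ma)=\beta(m)\alpha(a)$, $(a\cdot b)\beta(m)=\alpha(a)(bm)$, $(am)\alpha(b)=\alpha(a)(mb)$, $(ma)\alpha(b)=\beta(m)(a\cdot b)$. Two bimodules are used: $(A,\alpha)$ with both actions $\mu$, and the dual $A^*=\mathrm{Hom}_k(A,k)$ with $\beta=(\alpha^{-1})^*$, $(a\theta)(b)=\theta(\alpha^{-1}(\alpha^{-1}(b)\cdot a))$, $(\theta a)(b)=\theta(\alpha^{-1}(a\cdot\alpha^{-1}(b)))$.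 For $n\ge 0$ let $C^n_\alpha(A,M)=\{f:A^{\otimes n}\to M \text{ linear}\mid \beta\circ f=f\circ\alpha^{\otimes n}\}$, with coboundary $$(\delta_\alpha f)(a_1,\dots,a_{n+1})=\alpha^{n-1}(a_1)f(a_2,\dots,a_{n+1})+\sum_{i=1}^n(-1)^i f(\alpha(a_1),\dots,\alpha(a_{i-1}),a_i\cdot a_{i+1},\alpha(a_{i+2}),\dots,\alpha(a_{n+1}))+(-1)^{n+1}f(a_1,\dots,a_n)\alpha^{n-1}(a_{n+1}).$$ Let $H^n_\alpha(A,M)$ be its cohomology ($0$ for $n<0$), $H^n_\alpha(A)=H^n_\alpha(A,A)$, and let $H^\bullet$ denote the $\mathbb Z$-graded direct sum. For $f\in C^p_\alpha(A)$, $g\in C^q_\alpha(A)$ and $m\in C^n_\alpha(A,A^*)$ put $$(f\circ_i g)(a_1,\dots,a_{p+q-1})=f(\alpha^{q-1}(a_1),\dots,\alpha^{q-1}(a_{i-1}),g(a_i,\dots,a_{i+q-1}),\alpha^{q-1}(a_{i+q}),\dots,\alpha^{q-1}(a_{p+q-1})),$$ $$f\cup g=(\mu\circ_2 f)\circ_1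 g,\qquad [f,g]=\sum_{i=1}^p(-1)^{(q-1)(i-1)}f\circ_i g-(-1)^{(p-1)(q-1)}\sum_{i=1}^q(-1)^{(p-1)(i-1)}g\circ_i f,$$ $$(f\cdot m)(a_1,\dots,a_{p+n})=(-1)^{pn}\,\alpha^{n-1}\big(f(a_1,\dots,a_p)\big)\,\beta^{p-1}\big(m(a_{p+1},\dots,a_{p+n})\big).$$ Identify $m\in C^n_\alpha(A,A^*)$ with the linear form $\widetilde m(a_0\otimes\cdots\otimes a_n)=m(a_1,\dots,a_n)(\alpha^{n-1}(a_0))$ on $A^{\otimes(n+1)}$. For $n\ge1$ define $B^*(m)\in C^{n-1}_\alpha(A,A^*)$ by $\widetilde{B^*(m)}=(-1)^n\,\widetilde m\circ B$, where $B:A^{\otimes n}\to A^{\otimes(n+1)}$ is the Connes operator $$B=\sum_{i=0}^{n-1}(-1)^{i(n-1)}(\mathrm{id}-(-1)^{n}t)\,t\,s\,t^i,\quad t(a_0\otimes\cdots\otimes a_r)=a_r\otimes a_0\otimes\cdots\otimes a_{r-1},\quad s(a_0\otimes\cdots\otimes a_{r})=\alpha^{-1}(a_0)\otimes\cdots\otimes\alpha^{-1}(a_{r})\otimes1,$$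 and $B^*=0$ for $n=0$. A Gerstenhaber algebra is a $\mathbb Z$-graded module $\mathcal A$ with a graded commutative associative product $\cup$ of degree $0$ and a graded Lie bracket of degree $-1$ (a graded Lie bracket for the degree shifted by $1$) such that $[f,g\cup h]=[f,g]\cup h+(-1)^{(p-1)q}g\cup[f,h]$ for $f\in\mathcal A^p$, $g\in\mathcal A^q$. It is a BV algebra with BV-generator $\Delta$ if $\Delta:\mathcal A^\bullet\to\mathcal A^{\bullet-1}$ is linear, $\Delta^2=0$ and $$[f,g]=-(-1)^p\big(\Delta(f\cup g)-\Delta(f)\cup g-(-1)^pf\cup\Delta(g)\big)\qquad(f\in\mathcal A^p,\ g\in\mathcal A).$$ **Proposition.** Let $A$ be a regular unital hom-associative algebra. The operations $\cup$, $[\ ,\ ]$, $f\cdot m$ and $B^*$ are well defined on cohomology, and $(f\cup g)\cdot x=f\cdot(g\cdot x)$ there. Let $d\ge0$ and let $m\in H^d_\alpha(A,A^*)$ satisfy $B^*(m)=0$, and suppose that $f\mapsto f\cdot m$ is an isomorphism of graded $H^\bullet_\alpha(A)$-modules $H^\bullet_\alpha(A)\to H^{\bullet+d}_\alpha(A,A^*)$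 (in all degrees $\bullet\in\mathbb Z$). Then there is exactly one map $\Delta:H^\bullet_\alpha(A)\to H^\bullet_\alpha(A)$ with $(\Delta f)\cdot m=B^*(f\cdot m)$ for all $f$; it is a BV-generator, and $(H^\bullet_\alpha(A),\cup,[\ ,\ ],\Delta)$ is a BV algebra. -/

import Mathlib

open scoped DirectSum

/-- A regular unital (multiplicative) hom-associative algebra structure on a `k`-module `A`:
a bilinear product, an invertible twisting map `α`, and a unit. -/
structure RegUnitalHomAlgebra (k A : Type*) [CommRing k] [AddCommGroup A] [Module k A] where
  mul : A →ₗ[k] A →ₗ[k] A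
  α : A ≃ₗ[k] A
  one : A
  map_mul : ∀ a b, α (mul a b) = mul (α a) (α b)
  hom_assoc : ∀ a b c, mul (mul a b) (α c) = mul (α a) (mul b c)
  map_one : α one = one
  mul_one : ∀ a, mul a one = α a
  one_mul : ∀ a, mul one a = α a

/-- A bimodule `(M, β)` with `β` invertible over a regular unital hom-associative algebra. -/
structure RegHomBimodule {k A : Type*} [CommRing k] [AddCommGroup A] [Module k A]
    (𝔸 : RegUnitalHomAlgebra k A) (M : Type*) [AddCommGroup M] [Module k M] where
  β : M ≃ₗ[k] M
  lact : A →ₗ[k] M →ₗ[k] M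
  ract : M →ₗ[k] A →ₗ[k] M
  β_lact : ∀ a m, β (lact a m) = lact (𝔸.α a) (β m)
  β_ract : ∀ m a, β (ract m a) = ract (β m) (𝔸.α a)
  lact_lact : ∀ a b m, lact (𝔸.mul a b) (β m) = lact (𝔸.α a) (lact b m)
  lact_ract : ∀ a m b, ract (lact a m) (𝔸.α b) = lact (𝔸.α a) (ract m b)
  ract_ract : ∀ m a b, ract (ract m a) (𝔸.α b) = ract (β m) (𝔸.mul a b)

/-- `k`-linear maps `A^{⊗ n} → M`, as multilinear maps. -/
abbrev MultiCochain (k A M : Type*) [CommRing k] [AddCommGroup A] [Module k A]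
    [AddCommGroup M] [Module k M] (n : ℕ) : Type _ :=
  MultilinearMap k (fun _ : Fin n => A) M

namespace RegUnitalHomAlgebra

variable {k A : Type*} [CommRing k] [AddCommGroup A] [Module k A] (𝔸 : RegUnitalHomAlgebra k A)
variable {M : Type*} [AddCommGroup M] [Module k M]

/-- The integer powers of `α`. -/
def αpow (n : ℤ) : A →ₗ[k] A := ((𝔸.α ^ n : A ≃ₗ[k] A) : A →ₗ[k] A)

/-- `A` as a bimodule over itself. -/
def selfBimodule : RegHomBimodule 𝔸 A where
  β := 𝔸.α
  lact := 𝔸.mul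
  ract := 𝔸.mul
  β_lact := 𝔸.map_mul
  β_ract := 𝔸.map_mul
  lact_lact := 𝔸.hom_assoc
  lact_ract := 𝔸.hom_assoc
  ract_ract := 𝔸.hom_assoc


lemma α_mul_symm (a b : A) : 𝔸.α.symm (𝔸.mul a b) = 𝔸.mul (𝔸.α.symm a) (𝔸.α.symm b) := by
  apply 𝔸.α.injective
  simp [𝔸.map_mul]

lemma hom_assoc' (a b c : A) :
    𝔸.mul (𝔸.mul a b) c = 𝔸.mul (𝔸.α a) (𝔸.mul b (𝔸.α.symm c)) := by
  simpa using 𝔸.hom_assoc a b (𝔸.α.symm c)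

/-- The dual module `A^*` with `β = (α⁻¹)^*`, `(a θ)(b) = θ (α⁻¹ (α⁻¹ b · a))` and
`(θ a)(b) = θ (α⁻¹ (a · α⁻¹ b))`. -/
def dualBimodule : RegHomBimodule 𝔸 (Module.Dual k A) where
  β := 𝔸.α.symm.dualMap
  lact := LinearMap.mk₂ k
    (fun a θ => θ ∘ₗ 𝔸.α.symm.toLinearMap ∘ₗ 𝔸.mul.flip a ∘ₗ 𝔸.α.symm.toLinearMap)
    (by intros; ext; simp) (by intros; ext; simp) (by intros; ext; simp) (by intros; ext; simp)
  ract := LinearMap.mk₂ k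
    (fun θ a => θ ∘ₗ 𝔸.α.symm.toLinearMap ∘ₗ 𝔸.mul a ∘ₗ 𝔸.α.symm.toLinearMap)
    (by intros; ext; simp) (by intros; ext; simp) (by intros; ext; simp) (by intros; ext; simp)
  β_lact a θ := by ext c; simp [α_mul_symm]
  β_ract θ a := by ext c; simp [α_mul_symm]
  lact_lact a b θ := by ext c; simp [α_mul_symm, hom_assoc']
  lact_ract a θ b := by ext c; simp [α_mul_symm, hom_assoc']
  ract_ract θ a b := by ext c; simp [α_mul_symm, hom_assoc']

/-- The product as a `2`-cochain. -/
def mulCochain : MultiCochain k A A 2 where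
  toFun a := 𝔸.mul (a 0) (a 1)
  map_update_add' := by
    intro inst a i x y; rw [Subsingleton.elim inst (instDecidableEqFin 2)]
    fin_cases i <;> simp
  map_update_smul' := by
    intro inst a i c x; rw [Subsingleton.elim inst (instDecidableEqFin 2)]
    fin_cases i <;> simp

/-- The tuple `(γ a₀, …, γ a_{i-1}, g (a_i, …, a_{i+q-1}), γ a_{i+q}, …, γ a_{n-1})`. -/
def circArgs {p q n : ℕ} (h : n + 1 = p + q) (γ : A →ₗ[k] A) (g : MultiCochain k A A q)
    (i : Fin p) (a : Fin n → A) : Fin p → A := fun j =>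
  if h₁ : j < i then γ (a ⟨j, by omega⟩)
  else if h₂ : j = i then g (fun l => a ⟨i + l, by omega⟩)
  else γ (a ⟨j + q - 1, by omega⟩)

lemma circArgs_update {p q n : ℕ} (h : n + 1 = p + q) (γ : A →ₗ[k] A) (g : MultiCochain k A A q)
    (i : Fin p) (a : Fin n → A) (l : Fin n) :
    ∃ (j : Fin p) (F : A →ₗ[k] A), ∀ x,
      circArgs h γ g i (Function.update a l x) = Function.update (circArgs h γ g i a) j (F x) := by
  by_cases h₁ : (l : ℕ) < i
  · refine ⟨⟨l, by omega⟩, γ, fun x => ?_⟩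
    ext j
    by_cases hj : j = ⟨l, by omega⟩
    · subst hj
      have : (⟨l, by omega⟩ : Fin p) < i := h₁
      simp [circArgs, this]
    · have hj' : (j : ℕ) ≠ l := fun e => hj (Fin.ext e)
      rw [Function.update_of_ne hj]
      unfold circArgs
      split_ifs with h₂ h₃
      · rw [Function.update_of_ne]; exact fun e => hj' (congrArg Fin.val e)
      · congr 1; ext t
        rw [Function.update_of_ne]; intro e; have := congrArg Fin.val e; simp at this; omega
      · rw [Function.update_of_ne]; intro e; have := congrArg Fin.val e; simp at this
        have : (i : ℕ) ≤ j := by simpa using h₂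
        have : (j : ℕ) ≠ i := fun e => h₃ (Fin.ext e)
        omega
  · by_cases h₂ : (l : ℕ) < i + q
    · refine ⟨i, g.toLinearMap (fun t => a ⟨i + t, by omega⟩) ⟨l - i, by omega⟩, fun x => ?_⟩
      ext j
      by_cases hj : j = i
      · subst hj
        simp only [circArgs, lt_self_iff_false, dite_false, dite_true, Function.update_self,
          MultilinearMap.toLinearMap_apply]
        congr 1; ext t
        by_cases ht : t = ⟨l - j, by omega⟩
        · subst ht
          have : (⟨(j : ℕ) + ((l : ℕ) - j), by omega⟩ : Fin n) = l := by ext; simp; omega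
          simp [this]
        · rw [Function.update_of_ne ht, Function.update_of_ne]
          intro e; apply ht; ext; have := congrArg Fin.val e; simp at this ⊢; omega
      · rw [Function.update_of_ne hj]
        have hj' : (j : ℕ) ≠ i := fun e => hj (Fin.ext e)
        unfold circArgs
        split_ifs with h₃
        · have : (j : ℕ) < i := h₃
          rw [Function.update_of_ne]; intro e; have := congrArg Fin.val e; simp at this; omega
        · have : (i : ℕ) ≤ j := by simpa using h₃
          rw [Function.update_of_ne]; intro e; have := congrArg Fin.val e; simp at this; omega
    · refine ⟨⟨l + 1 - q, by omega⟩, γ, fun x => ?_⟩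
      ext j
      by_cases hj : j = ⟨l + 1 - q, by omega⟩
      · subst hj
        have h₃ : ¬ (⟨l + 1 - q, by omega⟩ : Fin p) < i := by simp [Fin.lt_def]; omega
        have h₄ : ¬ (⟨l + 1 - q, by omega⟩ : Fin p) = i := by simp [Fin.ext_iff]; omega
        have h₅ : (⟨(l : ℕ) + 1 - q + q - 1, by omega⟩ : Fin n) = l := by ext; simp; omega
        simp [circArgs, h₃, h₄, h₅]
      · rw [Function.update_of_ne hj]
        have hj' : (j : ℕ) ≠ l + 1 - q := fun e => hj (Fin.ext e)
        unfold circArgs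
        split_ifs with h₃ h₄
        · have : (j : ℕ) < i := h₃
          rw [Function.update_of_ne]; intro e; have := congrArg Fin.val e; simp at this; omega
        · congr 1; ext t
          rw [Function.update_of_ne]; intro e; have := congrArg Fin.val e; simp at this; omega
        · have : (i : ℕ) ≤ j := by simpa using h₃
          have : (j : ℕ) ≠ i := fun e => h₄ (Fin.ext e)
          rw [Function.update_of_ne]; intro e; have := congrArg Fin.val e; simp at this; omega

lemma circArgs_eq_update {p q n : ℕ} (h : n + 1 = p + q) (γ : A →ₗ[k] A)
    (g g' : MultiCochain k A A q) (i : Fin p) (a : Fin n → A) :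
    circArgs h γ g i a = Function.update (circArgs h γ g' i a) i
      (g (fun l => a ⟨i + l, by omega⟩)) := by
  ext j
  by_cases hj : j = i
  · subst hj; simp [circArgs]
  · simp [circArgs, hj]

/-- Partial composition
`(f ∘_{i+1} g)(a₁, …, aₙ) = f (α^{q-1} a₁, …, g (a_{i+1}, …, a_{i+q}), …, α^{q-1} aₙ)`,
where `n = p + q - 1`; the slot `i` is counted from `0`. -/
def circ {p q n : ℕ} (h : n + 1 = p + q) (i : Fin p) :
    MultiCochain k A M p →ₗ[k] MultiCochain k A A q →ₗ[k] MultiCochain k A M n :=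
  LinearMap.mk₂ k
    (fun f g =>
      { toFun := fun a => f (circArgs h (𝔸.αpow ((q : ℤ) - 1)) g i a)
        map_update_add' := by
          intro inst a l x y
          rw [Subsingleton.elim inst (instDecidableEqFin n)]
          obtain ⟨j, F, hF⟩ := circArgs_update h (𝔸.αpow ((q : ℤ) - 1)) g i a l
          simp [hF]
        map_update_smul' := by
          intro inst a l c x
          rw [Subsingleton.elim inst (instDecidableEqFin n)]
          obtain ⟨j, F, hF⟩ := circArgs_update h (𝔸.αpow ((q : ℤ) - 1)) g i a l
          simp [hF] })
    (by intros; ext; simp) (by intros; ext; simp)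
    (by
      intro f g g'; ext a
      simp only [MultilinearMap.coe_mk, add_apply]
      rw [circArgs_eq_update h _ (g + g') 0, circArgs_eq_update h _ g 0,
        circArgs_eq_update h _ g' 0]
      simp)
    (by
      intro c f g; ext a
      simp only [MultilinearMap.coe_mk, smul_apply]
      rw [circArgs_eq_update h _ (c • g) 0, circArgs_eq_update h _ g 0]
      simp)

lemma circ_apply {p q n : ℕ} (h : n + 1 = p + q) (i : Fin p) (f : MultiCochain k A M p)
    (g : MultiCochain k A A q) (a : Fin n → A) :
    𝔸.circ h i f g a = f (circArgs h (𝔸.αpow ((q : ℤ) - 1)) g i a) := rfl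

/-- The Gerstenhaber bracket of cochains of degrees `p` and `q`, with values in degree
`n = p + q - 1`:
`∑ᵢ (-1)^{(q-1)(i-1)} f ∘ᵢ g - (-1)^{(p-1)(q-1)} ∑ᵢ (-1)^{(p-1)(i-1)} g ∘ᵢ f`.
(The parity of `p - 1` is that of `p + 1`, and slots are counted from `0`.) -/
def bracket {p q n : ℕ} (h : n + 1 = p + q) :
    MultiCochain k A A p →ₗ[k] MultiCochain k A A q →ₗ[k] MultiCochain k A A n :=
  ∑ i : Fin p, (-1 : k) ^ ((q + 1) * (i : ℕ)) • 𝔸.circ h i -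
    (-1 : k) ^ ((p + 1) * (q + 1)) •
      (∑ i : Fin q, (-1 : k) ^ ((p + 1) * (i : ℕ)) • 𝔸.circ (h.trans (p.add_comm q)) i).flip

/-- The cup product `f ∪ g = (μ ∘₂ f) ∘₁ g`. -/
def cup (p q : ℕ) :
    MultiCochain k A A p →ₗ[k] MultiCochain k A A q →ₗ[k] MultiCochain k A A (p + q) :=
  𝔸.circ (p := p + 1) (by omega) 0 ∘ₗ 𝔸.circ (by omega) 1 𝔸.mulCochain

end RegUnitalHomAlgebra

namespace RegHomBimodule

variable {k A : Type*} [CommRing k] [AddCommGroup A] [Module k A] {𝔸 : RegUnitalHomAlgebra k A}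
variable {M : Type*} [AddCommGroup M] [Module k M] (𝓜 : RegHomBimodule 𝔸 M)

/-- The integer powers of `β`. -/
def βpow (n : ℤ) : M →ₗ[k] M := ((𝓜.β ^ n : M ≃ₗ[k] M) : M →ₗ[k] M)

/-- The `n`-cochains `C^n_α(A, M)`: the maps `f` with `β ∘ f = f ∘ α^{⊗ n}`. -/
def cochains (n : ℕ) : Submodule k (MultiCochain k A M n) where
  carrier := {f | ∀ a : Fin n → A, 𝓜.β (f a) = f (fun i => 𝔸.α (a i))}
  add_mem' := by intro f g hf hg a; simp [hf a, hg a]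
  zero_mem' := by intro a; simp
  smul_mem' := by intro c f hf a; simp [hf a]

/-- `(a₁, …, a_{n+1}) ↦ α^{n-1}(a₁) f(a₂, …, a_{n+1})`. -/
def leftTerm (n : ℕ) : MultiCochain k A M n →ₗ[k] MultiCochain k A M (n + 1) where
  toFun f := LinearMap.uncurryLeft
    { toFun := fun x => (𝓜.lact (𝔸.αpow ((n : ℤ) - 1) x)).compMultilinearMap f
      map_add' := by intros; ext; simp
      map_smul' := by intros; ext; simp }
  map_add' := by intros; ext; simp
  map_smul' := by intros; ext; simp

/-- `(a₁, …, a_{n+1}) ↦ f(a₁, …, aₙ) α^{n-1}(a_{n+1})`. -/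
def rightTerm (n : ℕ) : MultiCochain k A M n →ₗ[k] MultiCochain k A M (n + 1) where
  toFun f := MultilinearMap.uncurryRight
    ((𝓜.ract.compl₂ (𝔸.αpow ((n : ℤ) - 1))).compMultilinearMap f)
  map_add' := by intros; ext; simp
  map_smul' := by intros; ext; simp

/-- The coboundary `δ_α`; in degree `0` it is `a ↦ (b ↦ α⁻¹(b) a - a α⁻¹(b))`. -/
def δ (n : ℕ) : MultiCochain k A M n →ₗ[k] MultiCochain k A M (n + 1) :=
  𝓜.leftTerm n +
    ∑ i : Fin n, (-1 : k) ^ ((i : ℕ) + 1) • (𝔸.circ (by omega) i).flip 𝔸.mulCochain +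
    (-1 : k) ^ (n + 1) • 𝓜.rightTerm n

lemma leftTerm_apply (n : ℕ) (f : MultiCochain k A M n) (a : Fin (n + 1) → A) :
    𝓜.leftTerm n f a = 𝓜.lact (𝔸.αpow ((n : ℤ) - 1) (a 0)) (f fun i => a i.succ) := rfl

lemma rightTerm_apply (n : ℕ) (f : MultiCochain k A M n) (a : Fin (n + 1) → A) :
    𝓜.rightTerm n f a =
      𝓜.ract (f fun i => a i.castSucc) (𝔸.αpow ((n : ℤ) - 1) (a (Fin.last n))) := rfl

/-- The product of an `A`-valued `p`-cochain with an `M`-valued `n`-cochain (with Koszul sign):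
`(f · m)(a₁, …, a_{p+n}) = (-1)^{pn} α^{n-1}(f(a₁, …, a_p)) β^{p-1}(m(a_{p+1}, …, a_{p+n}))`. -/
def act (p n : ℕ) :
    MultiCochain k A A p →ₗ[k] MultiCochain k A M n →ₗ[k] MultiCochain k A M (p + n) :=
  LinearMap.mk₂ k
    (fun f m => (-1 : k) ^ (p * n) •
      (TensorProduct.lift
        (𝓜.lact.compl₁₂ (𝔸.αpow ((n : ℤ) - 1)) (𝓜.βpow ((p : ℤ) - 1)))).compMultilinearMap
        ((f.domCoprod m).domDomCongr finSumFinEquiv))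
    (by intros; ext; simp [TensorProduct.add_tmul])
    (by intros; ext; simp; rw [smul_comm])
    (by intros; ext; simp [TensorProduct.tmul_add])
    (by intros; ext; simp; rw [smul_comm])

lemma act_apply (p n : ℕ) (f : MultiCochain k A A p) (m : MultiCochain k A M n)
    (a : Fin (p + n) → A) :
    𝓜.act p n f m a = (-1 : k) ^ (p * n) •
      𝓜.lact (𝔸.αpow ((n : ℤ) - 1) (f fun i => a (Fin.castAdd n i)))
        (𝓜.βpow ((p : ℤ) - 1) (m fun i => a (Fin.natAdd p i))) := rfl

/-- The `n`-cocycles. -/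
def cocycles (n : ℕ) : Submodule k (MultiCochain k A M n) :=
  𝓜.cochains n ⊓ LinearMap.ker (𝓜.δ n)

/-- The `n`-coboundaries. -/
def coboundaries : (n : ℕ) → Submodule k (MultiCochain k A M n)
  | 0 => ⊥
  | n + 1 => (𝓜.cochains n).map (𝓜.δ n)

end RegHomBimodule

section Induced

variable {k X Y W : Type*} [CommRing k] [AddCommGroup X] [Module k X] [AddCommGroup Y] [Module k Y]
  [AddCommGroup W] [Module k W]

/-- The subquotient `Z / (B ∩ Z)` of `X`. -/
abbrev SubQuot (Z B : Submodule k X) : Type _ := Z ⧸ B.comap Z.subtype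

/-- `F` maps `Z` to `Z'` and sends elements of `B` in `Z` to `B'`. -/
def Descends (F : X →ₗ[k] Y) (Z B : Submodule k X) (Z' B' : Submodule k Y) : Prop :=
  (∀ x ∈ Z, F x ∈ Z') ∧ ∀ x ∈ Z, x ∈ B → F x ∈ B'

/-- The bilinear map `F` descends to the subquotients. -/
def Descends₂ (F : X →ₗ[k] Y →ₗ[k] W) (Z B : Submodule k X) (Z' B' : Submodule k Y)
    (Z'' B'' : Submodule k W) : Prop :=
  (∀ x ∈ Z, ∀ y ∈ Z', F x y ∈ Z'') ∧ (∀ x ∈ Z, ∀ y ∈ Z', x ∈ B → F x y ∈ B'') ∧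
    ∀ x ∈ Z, ∀ y ∈ Z', y ∈ B' → F x y ∈ B''

open Classical in
/-- The map of subquotients induced by a linear map that descends (zero for a map that does not
descend). -/
noncomputable def inducedMap (F : X →ₗ[k] Y) (Z B : Submodule k X) (Z' B' : Submodule k Y) :
    SubQuot Z B →ₗ[k] SubQuot Z' B' :=
  if h : Descends F Z B Z' B' then
    Submodule.mapQ _ _ (F.restrict h.1) (fun x hx => h.2 x x.2 hx)
  else 0

open Classical in
/-- The bilinear map of subquotients induced by a bilinear map that descends (zero for a map that
does not descend). -/
noncomputable def inducedMap₂ (F : X →ₗ[k] Y →ₗ[k] W) (Z B : Submodule k X) (Z' B' : Submodule k Y)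
    (Z'' B'' : Submodule k W) :
    SubQuot Z B →ₗ[k] SubQuot Z' B' →ₗ[k] SubQuot Z'' B'' :=
  if h : Descends₂ F Z B Z' B' Z'' B'' then
    Submodule.liftQ _
      { toFun := fun x => Submodule.mapQ _ _ ((F x).restrict (h.1 x x.2))
          (fun y hy => h.2.2 x x.2 y y.2 hy)
        map_add' := by
          intro x x'
          refine LinearMap.ext fun y => Submodule.Quotient.induction_on _ y fun y => ?_
          exact congrArg (Submodule.mkQ (B''.comap Z''.subtype))
            (Subtype.ext (by simp) : (⟨F (x + x') y, h.1 _ (x + x').2 y y.2⟩ : Z'') =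
              ⟨F x y, h.1 x x.2 y y.2⟩ + ⟨F x' y, h.1 x' x'.2 y y.2⟩)
        map_smul' := by
          intro c x
          refine LinearMap.ext fun y => Submodule.Quotient.induction_on _ y fun y => ?_
          exact congrArg (Submodule.mkQ (B''.comap Z''.subtype))
            (Subtype.ext (by simp) : (⟨F (c • x) y, h.1 _ (c • x).2 y y.2⟩ : Z'') =
              c • ⟨F x y, h.1 x x.2 y y.2⟩) }
      (by
        intro x hx
        rw [LinearMap.mem_ker]
        refine LinearMap.ext fun y => Submodule.Quotient.induction_on _ y fun y => ?_
        exact (Submodule.Quotient.mk_eq_zero _).2 (h.2.1 x x.2 y y.2 hx))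
  else 0

lemma inducedMap_mk (F : X →ₗ[k] Y) {Z B : Submodule k X} {Z' B' : Submodule k Y}
    (h : Descends F Z B Z' B') (x : Z) :
    inducedMap F Z B Z' B' (Submodule.Quotient.mk x) =
      Submodule.Quotient.mk ⟨F x, h.1 x x.2⟩ := by
  rw [inducedMap, dif_pos h]; rfl

lemma inducedMap₂_mk (F : X →ₗ[k] Y →ₗ[k] W) {Z B : Submodule k X} {Z' B' : Submodule k Y}
    {Z'' B'' : Submodule k W} (h : Descends₂ F Z B Z' B' Z'' B'') (x : Z) (y : Z') :
    inducedMap₂ F Z B Z' B' Z'' B'' (Submodule.Quotient.mk x) (Submodule.Quotient.mk y) =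
      Submodule.Quotient.mk ⟨F x y, h.1 x x.2 y y.2⟩ := by
  rw [inducedMap₂, dif_pos h]; rfl

end Induced

section Graded

variable {k : Type*} [CommRing k]

/-- The `ℤ`-grading on `⨁ n : ℕ, X n`, zero in negative degrees. -/
def intGrading (k : Type*) [CommRing k] (X : ℕ → Type*) [∀ n, AddCommGroup (X n)]
    [∀ n, Module k (X n)] : ℤ → Submodule k (⨁ n, X n)
  | Int.ofNat n => LinearMap.range (DirectSum.lof k ℕ X n)
  | Int.negSucc _ => ⊥

/-- The bilinear map on direct sums with homogeneous components `F p q`. -/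
def totalBilin {X Y W : ℕ → Type*} [∀ n, AddCommGroup (X n)] [∀ n, Module k (X n)]
    [∀ n, AddCommGroup (Y n)] [∀ n, Module k (Y n)] [∀ n, AddCommGroup (W n)] [∀ n, Module k (W n)]
    (deg : ℕ → ℕ → ℕ) (F : ∀ p q, X p →ₗ[k] Y q →ₗ[k] W (deg p q)) :
    (⨁ n, X n) →ₗ[k] (⨁ n, Y n) →ₗ[k] (⨁ n, W n) :=
  DirectSum.toModule k ℕ _ fun p => LinearMap.flip <|
    DirectSum.toModule k ℕ _ fun q => ((F p q).compr₂ (DirectSum.lof k ℕ W (deg p q))).flip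

lemma totalBilin_lof {X Y W : ℕ → Type*} [∀ n, AddCommGroup (X n)] [∀ n, Module k (X n)]
    [∀ n, AddCommGroup (Y n)] [∀ n, Module k (Y n)] [∀ n, AddCommGroup (W n)] [∀ n, Module k (W n)]
    (deg : ℕ → ℕ → ℕ) (F : ∀ p q, X p →ₗ[k] Y q →ₗ[k] W (deg p q)) (p q : ℕ) (x : X p) (y : Y q) :
    totalBilin deg F (DirectSum.lof k ℕ X p x) (DirectSum.lof k ℕ Y q y) =
      DirectSum.lof k ℕ W (deg p q) (F p q x y) := by
  simp [totalBilin]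

variable {V : Type*} [AddCommGroup V] [Module k V]

/-- A Gerstenhaber algebra: a `ℤ`-graded module `V = ⨁ 𝒜 i` with a graded commutative associative
product of degree `0` and a graded Lie bracket of degree `-1` satisfying the Leibniz rule. -/
structure IsGerstenhaberAlgebra (𝒜 : ℤ → Submodule k V) (cup br : V →ₗ[k] V →ₗ[k] V) : Prop where
  isInternal : DirectSum.IsInternal 𝒜
  cup_mem : ∀ p q : ℤ, ∀ x ∈ 𝒜 p, ∀ y ∈ 𝒜 q, cup x y ∈ 𝒜 (p + q)
  cup_assoc : ∀ x y z, cup (cup x y) z = cup x (cup y z)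
  cup_comm : ∀ p q : ℤ, ∀ x ∈ 𝒜 p, ∀ y ∈ 𝒜 q, cup x y = (p * q).negOnePow • cup y x
  br_mem : ∀ p q : ℤ, ∀ x ∈ 𝒜 p, ∀ y ∈ 𝒜 q, br x y ∈ 𝒜 (p + q - 1)
  br_skew : ∀ p q : ℤ, ∀ x ∈ 𝒜 p, ∀ y ∈ 𝒜 q,
    br x y = -(((p - 1) * (q - 1)).negOnePow • br y x)
  br_jacobi : ∀ p q : ℤ, ∀ x ∈ 𝒜 p, ∀ y ∈ 𝒜 q, ∀ z,
    br x (br y z) = br (br x y) z + ((p - 1) * (q - 1)).negOnePow • br y (br x z)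
  leibniz : ∀ p q : ℤ, ∀ x ∈ 𝒜 p, ∀ y ∈ 𝒜 q, ∀ z,
    br x (cup y z) = cup (br x y) z + ((p - 1) * q).negOnePow • cup y (br x z)

/-- A Batalin-Vilkovisky algebra: a Gerstenhaber algebra with a BV-generator `Δ`. -/
structure IsBVAlgebra (𝒜 : ℤ → Submodule k V) (cup br : V →ₗ[k] V →ₗ[k] V) (Δ : V →ₗ[k] V) :
    Prop extends IsGerstenhaberAlgebra 𝒜 cup br where
  Δ_mem : ∀ p : ℤ, ∀ x ∈ 𝒜 p, Δ x ∈ 𝒜 (p - 1)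
  Δ_sq : ∀ x, Δ (Δ x) = 0
  br_eq : ∀ p : ℤ, ∀ x ∈ 𝒜 p, ∀ y,
    br x y = -(p.negOnePow • (Δ (cup x y) - cup (Δ x) y - p.negOnePow • cup x (Δ y)))

end Graded

namespace RegHomBimodule

variable {k A : Type*} [CommRing k] [AddCommGroup A] [Module k A] {𝔸 : RegUnitalHomAlgebra k A}
variable {M : Type*} [AddCommGroup M] [Module k M] (𝓜 : RegHomBimodule 𝔸 M)

/-- The cohomology `H^n_α(A, M)`. -/
abbrev H (n : ℕ) : Type _ := SubQuot (𝓜.cocycles n) (𝓜.coboundaries n)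

/-- The total cohomology `H^•_α(A, M)`. -/
abbrev HTot : Type _ := ⨁ n, 𝓜.H n

/-- The product `H^p_α(A) × H^n_α(A, M) → H^{p+n}_α(A, M)`. -/
noncomputable def actH (p n : ℕ) : 𝔸.selfBimodule.H p →ₗ[k] 𝓜.H n →ₗ[k] 𝓜.H (p + n) :=
  inducedMap₂ (𝓜.act p n) _ _ _ _ _ _

/-- The product `H^•_α(A) × H^•_α(A, M) → H^•_α(A, M)`. -/
noncomputable def actTot : 𝔸.selfBimodule.HTot →ₗ[k] 𝓜.HTot →ₗ[k] 𝓜.HTot :=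
  totalBilin (X := 𝔸.selfBimodule.H) (Y := 𝓜.H) (W := 𝓜.H) (· + ·) 𝓜.actH

end RegHomBimodule

namespace RegUnitalHomAlgebra

variable {k A : Type*} [CommRing k] [AddCommGroup A] [Module k A] (𝔸 : RegUnitalHomAlgebra k A)

/-- The cup product on cohomology. -/
noncomputable def cupH (p q : ℕ) :
    𝔸.selfBimodule.H p →ₗ[k] 𝔸.selfBimodule.H q →ₗ[k] 𝔸.selfBimodule.H (p + q) :=
  inducedMap₂ (𝔸.cup p q) _ _ _ _ _ _

/-- The Gerstenhaber bracket on cohomology. It vanishes for `p = q = 0`, where it would take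
values in degree `-1`. -/
noncomputable def bracketH (p q : ℕ) :
    𝔸.selfBimodule.H p →ₗ[k] 𝔸.selfBimodule.H q →ₗ[k] 𝔸.selfBimodule.H (p + q - 1) :=
  if h : p + q = 0 then 0
  else inducedMap₂ (𝔸.bracket (n := p + q - 1) (by omega)) _ _ _ _ _ _

/-- The cup product on `H^•_α(A)`. -/
noncomputable def cupTot :
    𝔸.selfBimodule.HTot →ₗ[k] 𝔸.selfBimodule.HTot →ₗ[k] 𝔸.selfBimodule.HTot :=
  totalBilin (X := 𝔸.selfBimodule.H) (Y := 𝔸.selfBimodule.H) (W := 𝔸.selfBimodule.H)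
    (· + ·) 𝔸.cupH

/-- The bracket on `H^•_α(A)`. -/
noncomputable def bracketTot :
    𝔸.selfBimodule.HTot →ₗ[k] 𝔸.selfBimodule.HTot →ₗ[k] 𝔸.selfBimodule.HTot :=
  totalBilin (X := 𝔸.selfBimodule.H) (Y := 𝔸.selfBimodule.H) (W := 𝔸.selfBimodule.H)
    (fun p q => p + q - 1) 𝔸.bracketH

/-- The linear form `a₀ ⊗ a₁ ⊗ ⋯ ⊗ aₙ ↦ m(a₁, …, aₙ)(α^{n-1} a₀)` on the Hochschild chains
`A ⊗ A^{⊗ n}` corresponding to the cochain `m` with values in `A^*`. -/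
def toForm (n : ℕ) :
    MultiCochain k A (Module.Dual k A) n →ₗ[k] MultilinearMap k (fun _ : Fin (n + 1) => A) k where
  toFun m := LinearMap.uncurryLeft
    { toFun := fun x => (LinearMap.applyₗ (𝔸.αpow ((n : ℤ) - 1) x)).compMultilinearMap m
      map_add' := by intros; ext; simp
      map_smul' := by intros; ext; simp }
  map_add' := by intros; ext; simp
  map_smul' := by intros; ext; simp

/-- The inverse of `toForm`. -/
def ofForm (n : ℕ) :
    MultilinearMap k (fun _ : Fin (n + 1) => A) k →ₗ[k] MultiCochain k A (Module.Dual k A) n where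
  toFun φ :=
    { toFun := fun a =>
        { toFun := fun b => φ (Fin.cons (𝔸.αpow (1 - (n : ℤ)) b) a)
          map_add' := by
            intro b b'
            rw [map_add]
            exact φ.cons_add a _ _
          map_smul' := by
            intro c b
            rw [map_smul]
            exact φ.cons_smul a _ _ }
      map_update_add' := by
        intro inst a i x y
        rw [Subsingleton.elim inst (instDecidableEqFin n)]
        ext b; simp [Fin.cons_update]
      map_update_smul' := by
        intro inst a i c x
        rw [Subsingleton.elim inst (instDecidableEqFin n)]
        ext b; simp [Fin.cons_update] }
  map_add' := by intros; ext; simp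
  map_smul' := by intros; ext; simp

lemma toForm_apply (n : ℕ) (m : MultiCochain k A (Module.Dual k A) n) (a : Fin (n + 1) → A) :
    𝔸.toForm n m a = m (fun i => a i.succ) (𝔸.αpow ((n : ℤ) - 1) (a 0)) := rfl

lemma ofForm_apply (n : ℕ) (φ : MultilinearMap k (fun _ : Fin (n + 1) => A) k) (a : Fin n → A)
    (b : A) : 𝔸.ofForm n φ a b = φ (Fin.cons (𝔸.αpow (1 - (n : ℤ)) b) a) := rfl

lemma αpow_αpow (m n : ℤ) (h : m + n = 0) (a : A) : 𝔸.αpow m (𝔸.αpow n a) = a := by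
  have : 𝔸.α ^ m * 𝔸.α ^ n = 1 := by rw [← zpow_add, h, zpow_zero]
  exact congrArg (fun e : A ≃ₗ[k] A => e a) this

lemma ofForm_toForm (n : ℕ) (m : MultiCochain k A (Module.Dual k A) n) :
    𝔸.ofForm n (𝔸.toForm n m) = m := by
  ext a b
  simp [ofForm_apply, toForm_apply, αpow_αpow]

lemma toForm_ofForm (n : ℕ) (φ : MultilinearMap k (fun _ : Fin (n + 1) => A) k) :
    𝔸.toForm n (𝔸.ofForm n φ) = φ := by
  ext a
  rw [toForm_apply, ofForm_apply, αpow_αpow _ _ _ (by ring)]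
  exact congrArg φ (Fin.cons_self_tail a)

/-- Precomposition with `t(a₀ ⊗ ⋯ ⊗ aₙ) = aₙ ⊗ a₀ ⊗ ⋯ ⊗ a_{n-1}`. -/
def cyclicDual (k A : Type*) [CommRing k] [AddCommGroup A] [Module k A] (n : ℕ) :
    MultilinearMap k (fun _ : Fin (n + 1) => A) k →ₗ[k]
      MultilinearMap k (fun _ : Fin (n + 1) => A) k :=
  (MultilinearMap.domDomCongrLinearEquiv k k A k (finRotate (n + 1)).symm).toLinearMap

/-- Precomposition with
`a₀ ⊗ ⋯ ⊗ aₙ ↦ 1 •_{n+1} (a₀ ⊗ ⋯ ⊗ aₙ) = α⁻¹ a₀ ⊗ ⋯ ⊗ α⁻¹ aₙ ⊗ 1`. -/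
def insertUnitDual (n : ℕ) :
    MultilinearMap k (fun _ : Fin (n + 2) => A) k →ₗ[k]
      MultilinearMap k (fun _ : Fin (n + 1) => A) k where
  toFun φ := ((LinearMap.applyₗ 𝔸.one).compMultilinearMap φ.curryRight).compLinearMap
    fun _ => 𝔸.αpow (-1)
  map_add' := by intros; ext; simp
  map_smul' := by intros; ext; simp

lemma cyclicDual_apply (n : ℕ) (φ : MultilinearMap k (fun _ : Fin (n + 1) => A) k)
    (a : Fin (n + 1) → A) :
    cyclicDual k A n φ a = φ (Fin.cons (a (Fin.last n)) fun i => a i.castSucc) := by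
  change φ (fun i => a ((finRotate (n + 1)).symm i)) = _
  congr 1; ext i
  refine Fin.cases ?_ (fun j => ?_) i
  · simp only [Fin.cons_zero]; congr 1
  · simp only [Fin.cons_succ]; congr 1
    rw [Equiv.symm_apply_eq]; simp

lemma insertUnitDual_apply (n : ℕ) (φ : MultilinearMap k (fun _ : Fin (n + 2) => A) k)
    (a : Fin (n + 1) → A) :
    𝔸.insertUnitDual n φ a = φ (Fin.snoc (fun i => 𝔸.αpow (-1) (a i)) 𝔸.one) := rfl

/-- Precomposition with the Connes boundary
`B = ∑_{i=0}^{n} (-1)^{in} (id - (-1)^{n+1} t) t (1 •_{n+1} tⁱ)` from `A^{⊗ (n+1)}` to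
`A^{⊗ (n+2)}`. -/
def connesDual (n : ℕ) :
    MultilinearMap k (fun _ : Fin (n + 2) => A) k →ₗ[k]
      MultilinearMap k (fun _ : Fin (n + 1) => A) k :=
  ∑ i ∈ Finset.range (n + 1), (-1 : k) ^ (i * n) •
    ((cyclicDual k A n ^ i) ∘ₗ 𝔸.insertUnitDual n ∘ₗ cyclicDual k A (n + 1) ∘ₗ
      (LinearMap.id - (-1 : k) ^ (n + 1) • cyclicDual k A (n + 1)))

/-- The dual Connes operator `B^* m = (-1)^{|m|} m ∘ B` on cochains of degree `|m| = n + 1` with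
values in `A^*`. -/
def connesStar (n : ℕ) :
    MultiCochain k A (Module.Dual k A) (n + 1) →ₗ[k] MultiCochain k A (Module.Dual k A) n :=
  (-1 : k) ^ (n + 1) • (𝔸.ofForm n ∘ₗ 𝔸.connesDual n ∘ₗ 𝔸.toForm (n + 1))

/-- `B^* : H^n_α(A, A^*) → H^{n-1}_α(A, A^*)` as a map into the total cohomology; it is zero on
`H^0_α(A, A^*)`. -/
noncomputable def connesStarH : (n : ℕ) → 𝔸.dualBimodule.H n →ₗ[k] 𝔸.dualBimodule.HTot
  | 0 => 0
  | n + 1 => DirectSum.lof k ℕ 𝔸.dualBimodule.H n ∘ₗ inducedMap (𝔸.connesStar n) _ _ _ _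

/-- `B^*` on `H^•_α(A, A^*)`. -/
noncomputable def connesStarTot : 𝔸.dualBimodule.HTot →ₗ[k] 𝔸.dualBimodule.HTot :=
  DirectSum.toModule k ℕ _ 𝔸.connesStarH

/-- The coboundary maps square to zero on cochains, and the cup product, the bracket, the product
with `A^*`-valued cochains and `B^*` are well defined on cohomology. -/
structure OperationsWellDefined : Prop where
  self_le : ∀ n, 𝔸.selfBimodule.coboundaries n ≤ 𝔸.selfBimodule.cocycles n
  dual_le : ∀ n, 𝔸.dualBimodule.coboundaries n ≤ 𝔸.dualBimodule.cocycles n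
  cup : ∀ p q, Descends₂ (𝔸.cup p q)
    (𝔸.selfBimodule.cocycles p) (𝔸.selfBimodule.coboundaries p)
    (𝔸.selfBimodule.cocycles q) (𝔸.selfBimodule.coboundaries q)
    (𝔸.selfBimodule.cocycles (p + q)) (𝔸.selfBimodule.coboundaries (p + q))
  bracket : ∀ p q n, ∀ h : n + 1 = p + q, Descends₂ (𝔸.bracket h)
    (𝔸.selfBimodule.cocycles p) (𝔸.selfBimodule.coboundaries p)
    (𝔸.selfBimodule.cocycles q) (𝔸.selfBimodule.coboundaries q)
    (𝔸.selfBimodule.cocycles n) (𝔸.selfBimodule.coboundaries n)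
  act : ∀ p n, Descends₂ (𝔸.dualBimodule.act p n)
    (𝔸.selfBimodule.cocycles p) (𝔸.selfBimodule.coboundaries p)
    (𝔸.dualBimodule.cocycles n) (𝔸.dualBimodule.coboundaries n)
    (𝔸.dualBimodule.cocycles (p + n)) (𝔸.dualBimodule.coboundaries (p + n))
  connesStar : ∀ n, Descends (𝔸.connesStar n)
    (𝔸.dualBimodule.cocycles (n + 1)) (𝔸.dualBimodule.coboundaries (n + 1))
    (𝔸.dualBimodule.cocycles n) (𝔸.dualBimodule.coboundaries n)

end RegUnitalHomAlgebra

set_option linter.unusedSectionVars false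
set_option linter.unusedVariables false

/-! Untwisting. The product `a ∘ b = α⁻¹(a · b)` is associative with unit `1`, and `α` is an
automorphism of it; dividing both actions by `β` turns every hom-bimodule into an ordinary
equivariant bimodule (`isEquivBimod`, `isDualBimod`). Under `f ↦ β^{1-n} f`, implemented by `words`,
cochains become equivariant Hochschild cochains, and the coboundary, circle products, cup product,
`f · m` and `B^*` become the untwisted operations up to explicit signs (`words_δ`, `words_circ`,
`words_cup`, `words_act`, `words_connesStar`). What remains is ordinary Hochschild theory in which
every homotopy must be equivariant. Cochains are functions of lists supported in one length, so sums
over positions become sums over the cuts of a list.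

Cartan calculus. Write `i_g` for the contraction by `g` (here `conv la g`), `L_f` for the Lie
derivative and `B` for the transposed Connes operator. Two homotopies hold on cochains with values
in the dual: `L_f = [B, i_f]` (`Fk_B₀`, `lie_homologous`) and `i_{[f,g]} = [L_f, i_g]` up to sign
(`Fk_Lc_cartan`, `conv_lie_homologous`). The second is proved on words with a marked letter, where
the coderivation of `f` splits into parts to the left of, around and to the right of the mark, and
then transported to cyclic words by `nu`. As the complex is not normalised, `B = (1 - t) s N` is
first replaced by the homotopic `s N` (`Bc_eq`). Together they give `i_{[f,g]} = ± [[B, i_f], i_g]`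
in cohomology (`bracket_homologous`, `actTot_bracketTot`).

Duality. Since `f ↦ f · m` is bijective, `H^•_α(A)` acts faithfully on `H^•_α(A, A^*)`, so
identities can be checked between operators there. Graded commutation of the `i_f`, `B² = 0` and the
double commutator formula imply skew symmetry, the Jacobi identity and the Leibniz rule of the
bracket (`BVData`). The operator `Δ` is `B^*` transported along the bijection, and evaluating the
double commutator on `m`, where `B^*(m) = 0`, gives the BV identity. -/

namespace HochschildWords

/-! ### Signs and parities of words -/

/-- The sign `(-1)^e`. -/
def sg (e : ZMod 2) : ℤ := if e = 0 then 1 else -1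

@[simp] lemma sg_zero : sg 0 = 1 := rfl
@[simp] lemma sg_one : sg 1 = -1 := rfl
lemma sg_add (a b : ZMod 2) : sg (a + b) = sg a * sg b := by revert a b; decide
lemma sg_mul_self (a : ZMod 2) : sg a * sg a = 1 := by revert a; decide
lemma sg_sq_smul {X : Type*} [AddCommGroup X] (a : ZMod 2) (x : X) : sg a • sg a • x = x := by
  rw [smul_smul, sg_mul_self, one_smul]
lemma sg_smul_congr {X : Type*} [AddCommGroup X] {a b : ZMod 2} {x y : X} (h : a = b)
    (h' : x = y) : sg a • x = sg b • y := by rw [h, h']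
lemma zmod_two_mul_self (a : ZMod 2) : a * a = a := by revert a; decide

/-- The length of a word modulo `2`. -/
def par {A : Type*} (w : List A) : ZMod 2 := (w.length : ZMod 2)

section par
variable {A : Type*}
@[simp] lemma par_nil : par ([] : List A) = 0 := by simp [par]
@[simp] lemma par_cons (a : A) (w : List A) : par (a :: w) = par w + 1 := by simp [par]
@[simp] lemma par_append (u v : List A) : par (u ++ v) = par u + par v := by simp [par]
@[simp] lemma par_map {B : Type*} (f : A → B) (u : List A) : par (u.map f) = par u := by
  simp [par]
end par

/-! ### Sums over the cuts of a word -/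

section spl

variable {A X Y : Type*} [AddCommGroup X] [AddCommGroup Y]

/-- The sum of `F u v` over all decompositions `w = u ++ v`. -/
def spl (F : List A → List A → X) : List A → X
  | [] => F [] []
  | a :: w => F [] (a :: w) + spl (fun u v => F (a :: u) v) w

lemma spl_nil (F : List A → List A → X) : spl F [] = F [] [] := rfl
lemma spl_cons (F : List A → List A → X) (a : A) (w : List A) :
    spl F (a :: w) = F [] (a :: w) + spl (fun u v => F (a :: u) v) w := rfl

lemma spl_congr {F G : List A → List A → X} {w : List A} (h : ∀ u v, u ++ v = w → F u v = G u v) :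
    spl F w = spl G w := by
  induction w generalizing F G with
  | nil => exact h [] [] rfl
  | cons a w ih =>
    rw [spl_cons, spl_cons, h [] (a :: w) rfl, ih fun u v e => h (a :: u) v (by simp [e])]

lemma spl_add (F G : List A → List A → X) (w : List A) :
    spl (fun u v => F u v + G u v) w = spl F w + spl G w := by
  induction w generalizing F G with
  | nil => rfl
  | cons a w ih => simp only [spl_cons, ih]; abel

lemma spl_zero (w : List A) : spl (fun _ _ => (0 : X)) w = 0 := by
  induction w with
  | nil => rfl
  | cons a w ih => simp only [spl_cons, ih, add_zero]

lemma spl_eq_zero {F : List A → List A → X} {w : List A} (h : ∀ u v, u ++ v = w → F u v = 0) :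
    spl F w = 0 := by
  rw [spl_congr h, spl_zero]

lemma map_spl {T : Type*} [FunLike T X Y] [AddMonoidHomClass T X Y] (t : T)
    (F : List A → List A → X) (w : List A) : t (spl F w) = spl (fun u v => t (F u v)) w := by
  induction w generalizing F with
  | nil => rfl
  | cons a w ih => simp only [spl_cons, map_add, ih]

lemma smul_spl {R : Type*} [DistribSMul R X] (c : R) (F : List A → List A → X) (w : List A) :
    c • spl F w = spl (fun u v => c • F u v) w :=
  map_spl (DistribSMul.toAddMonoidHom X c) F w

lemma spl_sub (F G : List A → List A → X) (w : List A) :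
    spl (fun u v => F u v - G u v) w = spl F w - spl G w := by
  induction w generalizing F G with
  | nil => rfl
  | cons a w ih => simp only [spl_cons, ih]; abel

/-- Both sides run over the cuts of `w` into three pieces `a`, `b`, `c`, grouped from the left or
from the right: coassociativity of deconcatenation. Most reindexings below go through it. -/
lemma spl_assoc (F : List A → List A → List A → List A → X) (w : List A) :
    spl (fun y c => spl (fun a b => F y a b c) y) w =
      spl (fun a y => spl (fun b c => F (a ++ b) a b c) y) w := by
  induction w generalizing F with
  | nil => rfl
  | cons a w ih =>
    simp only [spl_cons, spl_nil, ih, spl_add, List.nil_append, List.cons_append]; abel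

lemma spl_comm (F : List A → List A → List A → List A → X) (w x : List A) :
    spl (fun a b => spl (fun c d => F a b c d) x) w =
      spl (fun c d => spl (fun a b => F a b c d) w) x := by
  induction w generalizing F with
  | nil => rfl
  | cons a w ih => simp only [spl_cons, ih, spl_add]

/-- The distinguished letter `c` falls either into the right piece or into the left piece of a cut.
-/
lemma spl_append_cons (F : List A → List A → X) (u : List A) (c : A) (x : List A) :
    spl F (u ++ c :: x) = spl (fun u₁ u₂ => F u₁ (u₂ ++ c :: x)) u +
      spl (fun x₁ x₂ => F (u ++ c :: x₁) x₂) x := by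
  induction u generalizing F with
  | nil => simp [spl_cons, spl_nil]
  | cons a u ih => simp [spl_cons, ih, add_assoc]

lemma spl_map {B : Type*} (f : A → B) (F : List B → List B → X) (w : List A) :
    spl F (w.map f) = spl (fun u v => F (u.map f) (v.map f)) w := by
  induction w generalizing F with
  | nil => rfl
  | cons a w ih => simp [spl_cons, ih]

lemma spl_left_nil {F : List A → List A → X} {w : List A}
    (h : ∀ u v, u ++ v = w → u ≠ [] → F u v = 0) : spl F w = F [] w := by
  cases w with
  | nil => rfl
  | cons a w =>
    rw [spl_cons, spl_eq_zero (fun u v e => h _ _ (by simp [e]) (by simp)), add_zero]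

end spl

/-! ### Linearity in each letter -/

section multilinear

variable {k A X Y : Type*} [CommRing k] [AddCommGroup A] [Module k A] [AddCommGroup X] [Module k X]
  [AddCommGroup Y] [Module k Y]

variable (k) in
/-- A function of words that is linear in each letter. -/
def IsML (φ : List A → X) : Prop := ∀ u v, ∃ T : A →ₗ[k] X, ∀ x, φ (u ++ x :: v) = T x

variable {φ ψ : List A → X}

lemma IsML.map_zero (h : IsML k φ) (u v : List A) : φ (u ++ 0 :: v) = 0 := by
  obtain ⟨T, hT⟩ := h u v; rw [hT, _root_.map_zero]

lemma IsML.map_zero' (h : IsML k φ) (v : List A) : φ (0 :: v) = 0 := h.map_zero [] v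

lemma IsML.append_left (h : IsML k φ) (w : List A) : IsML k fun x => φ (w ++ x) := fun u v => by
  simpa using h (w ++ u) v

lemma IsML.append_right (h : IsML k φ) (w : List A) : IsML k fun x => φ (x ++ w) := fun u v => by
  simpa using h u (v ++ w)

lemma IsML.cons (h : IsML k φ) (a : A) : IsML k fun x => φ (a :: x) := h.append_left [a]

lemma IsML.add (h : IsML k φ) (h' : IsML k ψ) : IsML k fun w => φ w + ψ w := fun u v => by
  obtain ⟨T, hT⟩ := h u v
  obtain ⟨S, hS⟩ := h' u v
  exact ⟨T + S, fun x => by simp [hT, hS]⟩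

lemma IsML.zero : IsML k fun _ : List A => (0 : X) := fun _ _ => ⟨0, fun _ => rfl⟩

lemma IsML.comp (h : IsML k φ) (L : X →ₗ[k] Y) : IsML k fun w => L (φ w) := fun u v => by
  obtain ⟨T, hT⟩ := h u v
  exact ⟨L ∘ₗ T, fun x => by simp [hT]⟩

lemma IsML.zsmul (h : IsML k φ) (c : ℤ) : IsML k fun w => c • φ w := fun u v => by
  obtain ⟨T, hT⟩ := h u v
  exact ⟨c • T, fun x => by simp [hT]⟩

lemma IsML.par_smul (h : IsML k φ) (c : ZMod 2 → ℤ) : IsML k fun w => c (par w) • φ w :=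
  fun u v => by
    obtain ⟨T, hT⟩ := h u v
    exact ⟨c (par u + (par v + 1)) • T, fun x => by simp [hT]⟩

lemma IsML.sub (h : IsML k φ) (h' : IsML k ψ) : IsML k fun w => φ w - ψ w := by
  simpa [sub_eq_add_neg] using h.add (h'.zsmul (-1))

/-- A given letter lies in exactly one of the two pieces of each cut, so linearity in the two
arguments separately suffices. -/
lemma IsML.spl {F : List A → List A → X} (h₁ : ∀ v, IsML k fun u => F u v)
    (h₂ : ∀ u, IsML k (F u)) : IsML k (spl F) := fun u v => by
  have key : ∀ w₁ w₂ : List A, ∀ G : A → List A → List A → X,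
      (∀ a b, ∃ T : A →ₗ[k] X, ∀ x, G x a b = T x) →
      ∃ T : A →ₗ[k] X, ∀ x, HochschildWords.spl (G x) w₁ = T x := by
    intro w₁ _
    induction w₁ with
    | nil => intro G hG; exact hG [] []
    | cons a w ih =>
      intro G hG
      obtain ⟨T, hT⟩ := hG [] (a :: w)
      obtain ⟨S, hS⟩ := ih (fun x u v => G x (a :: u) v) (fun c d => hG (a :: c) d)
      exact ⟨T + S, fun x => by rw [spl_cons, hT, hS]; rfl⟩
  obtain ⟨T, hT⟩ := key u u (fun x u₁ u₂ => F u₁ (u₂ ++ x :: v)) (fun a b => h₂ a b v)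
  obtain ⟨S, hS⟩ := key v v (fun x x₁ x₂ => F (u ++ x :: x₁) x₂) (fun a b => h₁ b u a)
  exact ⟨T + S, fun x => by rw [spl_append_cons, hT, hS]; rfl⟩

lemma IsML.spl_param {F : List A → List A → List A → X} (h : ∀ a b, IsML k fun u => F u a b)
    (w : List A) : IsML k fun u => HochschildWords.spl (F u) w := by
  induction w generalizing F with
  | nil => exact h [] []
  | cons a w ih => exact (h [] (a :: w)).add (ih fun b c => h (a :: b) c)

end multilinear

/-! ### Coderivations of the tensor coalgebra -/

section coderivation

variable {k A X Y : Type*} [CommRing k] [AddCommGroup A] [Module k A] [AddCommGroup X] [Module k X]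
  [AddCommGroup Y] [Module k Y]

/-- `f` vanishes on words whose length does not have the parity of `p + 1`. -/
def HasPar (f : List A → X) (p : ZMod 2) : Prop := ∀ w, f w ≠ 0 → par w + 1 = p

/-- Precomposition with the coderivation of parity `q` of the tensor coalgebra extending `g`:
`∑ ± φ (u ++ g v :: x)` over all decompositions `w = u ++ v ++ x`. -/
def D (g : List A → A) (q : ZMod 2) (φ : List A → X) (w : List A) : X :=
  spl (fun u y => sg (q * par u) • spl (fun v x => φ (u ++ g v :: x)) y) w

variable {f g : List A → A} {p q : ZMod 2} {φ ψ : List A → X}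

lemma D_add (w : List A) :
    D g q (fun w => φ w + ψ w) w = D g q φ w + D g q ψ w := by
  simp only [D, spl_add, smul_add]

lemma map_D {T : Type*} [FunLike T X Y] [AddMonoidHomClass T X Y] (t : T) (w : List A) :
    t (D g q φ w) = D g q (fun w => t (φ w)) w := by
  simp only [D, map_spl, map_zsmul]

lemma D_smul {R : Type*} [DistribSMul R X] (c : R) (w : List A) :
    D g q (fun w => c • φ w) w = c • D g q φ w :=
  (map_D (DistribSMul.toAddMonoidHom X c) w).symm

lemma D_sub (w : List A) :
    D g q (fun w => φ w - ψ w) w = D g q φ w - D g q ψ w := by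
  simp only [D, spl_sub, smul_sub]

lemma D_spl_apply (F : List A → List A → List A → X) (x w : List A) :
    D g q (fun u => spl (fun a b => F u a b) x) w = spl (fun a b => D g q (fun u => F u a b) w) x := by
  simp only [D, smul_spl]
  rw [spl_comm]
  simp_rw [spl_comm (x := x)]

/-- The coderivation property. -/
lemma D_spl (F : List A → List A → X) (w : List A) :
    D g q (spl F) w = spl (fun u v => D g q (fun u' => F u' v) u) w +
      spl (fun u v => sg (q * par u) • D g q (F u) v) w := by
  simp only [D, spl_append_cons, spl_add, smul_add, smul_spl]
  rw [add_comm]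
  congr 1
  · rw [spl_assoc]
    refine spl_congr fun u y _ => ?_
    rw [spl_assoc]
  · rw [spl_congr fun u y _ => spl_comm _ y u, spl_assoc]
    simp only [par_append, mul_add, sg_add, mul_smul]

lemma D_congr {w : List A} (h : ∀ u v x, u ++ v ++ x = w → φ (u ++ g v :: x) = ψ (u ++ g v :: x)) :
    D g q φ w = D g q ψ w := by
  unfold D
  refine spl_congr fun u y e => ?_
  rw [spl_congr fun v x e' => h u v x (by rw [List.append_assoc, e', e])]

/-- Replacing `v` by the single letter `g v` changes the length by `|v| - 1`, which has parity `q`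
whenever `g v ≠ 0`. A factor depending on the length parity therefore comes out with its argument
shifted by `q`. -/
lemma D_par_smul (hφ : IsML k φ) (hg : HasPar g q) (r : ZMod 2 → ℤ) (w : List A) :
    D g q (fun w => r (par w) • φ w) w = r (par w + q) • D g q φ w := by
  rw [← D_smul]
  refine D_congr fun u v x e => ?_
  by_cases h : g v = 0
  · simp [h, hφ.map_zero]
  · subst e
    have := hg v h
    simp only [par_append, par_cons, ← this]
    congr 2; grind

lemma IsML.D (hg : IsML k g) (hφ : IsML k φ) : IsML k (D g q φ) := by
  unfold HochschildWords.D
  refine IsML.spl (fun y => ?_) fun u => ?_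
  · exact (IsML.spl_param (fun v x => hφ.append_right (g v :: x)) y).par_smul fun e => sg (q * e)
  · refine IsML.zsmul (IsML.spl (fun x v₁ v₂ => ?_) fun v => ?_) _
    · obtain ⟨T, hT⟩ := hg v₁ v₂
      obtain ⟨S, hS⟩ := hφ u x
      exact ⟨S ∘ₗ T, fun y => by simp [hT, hS]⟩
    · simpa using hφ.append_left (u ++ [g v])

/-- The composition terms of two coderivations with the insertion of `f` to the left of `g`. -/
def Q (f : List A → A) (p : ZMod 2) (g : List A → A) (q : ZMod 2) (φ : List A → X) (w : List A) :
    X :=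
  spl (fun u y => sg (p * par u) • spl (fun v x =>
    sg (q * (par u + par v)) • D g q (fun x' => φ (u ++ f v :: x')) x) y) w

/-- The two insertions are either nested, giving the first term, or disjoint, giving the two `Q`
terms according to which of them stands on the left. -/
lemma D_D (hφ : IsML k φ) (hg : HasPar g q) (w : List A) :
    D g q (D f p φ) w = D (D g q f) (p + q) φ w + Q f p g q φ w + sg (p * q) • Q g q f p φ w := by
  have h1 : D g q (D f p φ) w = D g q (spl fun u y => sg (p * par u) • spl (fun v x =>
    φ (u ++ f v :: x)) y) w := rfl
  rw [h1, D_spl]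
  -- Here `g` lands inside the argument of `f` or to the right of it; the case of `g` to the left of
  -- `f` is `h3`.
  have h2 : ∀ u y : List A, D g q (fun v' => sg (p * par u) • spl (fun v x => φ (u ++ f v :: x)) v') y
      = spl (fun v x => sg (p * par u) • φ (u ++ D g q f v :: x)) y +
        spl (fun v x => sg (p * par u) • sg (q * par v) • D g q (fun x' => φ (u ++ f v :: x')) x) y := by
    intro u y
    rw [D_smul]
    rw [D_spl, smul_add, smul_spl, smul_spl]
    congr 1
    refine spl_congr fun v x _ => ?_
    obtain ⟨T, hT⟩ := hφ u x
    simp only [hT, map_D]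
  simp only [h2, smul_add, spl_add]
  rw [add_comm, add_assoc, add_assoc]
  congr 1
  · unfold D
    refine spl_congr fun u v e => ?_
    simp only [smul_spl]
    refine spl_congr fun u v e => ?_
    rw [smul_smul, ← sg_add, add_mul, add_comm]
  · congr 1
    · unfold Q
      refine spl_congr fun u v e => ?_
      simp only [smul_spl]
      refine spl_congr fun u v e => ?_
      simp only [smul_smul, ← sg_add]
      congr 2; ring
    · unfold Q
      have h3 : ∀ u v, D g q (fun u' => sg (p * par u') • spl (fun v x => φ (u' ++ f v :: x)) v) u =
          sg (p * (par u + q)) • spl (fun v x => D g q (fun u' => φ (u' ++ f v :: x)) u) v := by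
        intro u v
        rw [D_par_smul (k := k) (IsML.spl_param (fun v x => hφ.append_right (f v :: x)) v) hg
          (fun e => sg (p * e)), D_spl_apply]
      simp only [h3]
      unfold D
      simp only [smul_spl]
      rw [spl_congr fun u y _ => spl_comm _ y u, spl_assoc]
      refine spl_congr fun u y _ => ?_
      rw [spl_congr fun u y _ => spl_comm _ y u, spl_assoc]
      refine spl_congr fun v y' _ => spl_congr fun z y'' _ => spl_congr fun x x' _ => ?_
      simp only [smul_smul, ← sg_add, par_append, List.append_assoc, List.cons_append]
      by_cases h : g v = 0
      · simp [h, hφ.map_zero]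
      · have := hg v h
        exact sg_smul_congr (by grind) rfl

end coderivation

/-! ### The bracket as a graded commutator of coderivations -/

section bracket

variable {k A X Y : Type*} [CommRing k] [AddCommGroup A] [Module k A] [AddCommGroup X] [Module k X]

variable {f g : List A → A} {p q : ZMod 2} {φ ψ : List A → X}

lemma D_sub_left (hφ : IsML k φ) (w : List A) :
    D (fun w => f w - g w) q φ w = D f q φ w - D g q φ w := by
  unfold D
  rw [← spl_sub]
  refine spl_congr fun u y _ => ?_
  rw [← smul_sub, ← spl_sub]
  congr 1
  refine spl_congr fun v x _ => ?_
  obtain ⟨T, hT⟩ := hφ u x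
  simp [hT]

lemma D_zsmul_left (hφ : IsML k φ) (c : ℤ) (w : List A) :
    D (fun w => c • f w) q φ w = c • D f q φ w := by
  simp only [D, smul_spl]
  refine spl_congr fun u y _ => ?_
  refine spl_congr fun v x _ => ?_
  rw [smul_comm]
  congr 1
  obtain ⟨T, hT⟩ := hφ u x
  simp [hT]

lemma HasPar.D (hf : HasPar φ p) (hg : HasPar g q) (hφ : IsML k φ) :
    HasPar (D g q φ) (p + q) := by
  intro w hw
  by_contra h
  refine hw (spl_eq_zero fun u y e => ?_)
  rw [spl_eq_zero, smul_zero]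
  intro v x e'
  by_cases hv : g v = 0
  · rw [hv, hφ.map_zero]
  · by_contra h'
    have h1 := hf _ h'
    have h2 := hg _ hv
    subst e'; subst e
    simp only [par_append, par_cons] at h h1 h2
    apply h; rw [← h1, ← h2]; grind

/-- The graded commutator of `f` and `g` with respect to the composition of cochains. -/
def br (f : List A → A) (p : ZMod 2) (g : List A → A) (q : ZMod 2) (w : List A) : A :=
  D g q f w - sg (p * q) • D f p g w

lemma IsML.br (hf : IsML k f) (hg : IsML k g) : IsML k (br f p g q) :=
  (hg.D hf).sub ((hf.D hg).zsmul _)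

lemma HasPar.br (hf : HasPar f p) (hg : HasPar g q) (hf' : IsML k f) (hg' : IsML k g) :
    HasPar (br f p g q) (p + q) := by
  intro w hw
  by_contra h
  have h1 := hf.D hg hf' w
  have h2 := hg.D hf hg' w
  rw [add_comm q p] at h2
  apply hw
  rw [HochschildWords.br, not_imp_comm.1 h1 h, not_imp_comm.1 h2 h]; simp

/-- The disjoint insertions `Q` of `D_D` occur in both products and cancel, so only the nested ones,
which form `br`, survive. -/
lemma D_br (hφ : IsML k φ) (hf : HasPar f p) (hg : HasPar g q) (w : List A) :
    D (br f p g q) (p + q) φ w =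
      D g q (D f p φ) w - sg (p * q) • D f p (D g q φ) w := by
  unfold br
  rw [D_sub_left hφ, D_zsmul_left hφ, D_D hφ hg, D_D hφ hf, add_comm q p, mul_comm q p]
  simp only [smul_add, sg_sq_smul]
  abel

lemma D_D_comm (hφ : IsML k φ) (hf : HasPar f p) (hg : HasPar g q) (w : List A) :
    D g q (D f p φ) w = D (br f p g q) (p + q) φ w + sg (p * q) • D f p (D g q φ) w := by
  rw [D_br hφ hf hg]; abel

end bracket

/-! ### Coderivations on words with a marked letter -/

section marked

variable {k A X Y : Type*} [CommRing k] [AddCommGroup A] [Module k A] [AddCommGroup X] [Module k X]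

/-- A function of words with a marked letter that is linear in each letter. -/
structure IsML₃ (k : Type*) {A X : Type*} [CommRing k] [AddCommGroup A] [Module k A]
    [AddCommGroup X] [Module k X] (ψ : List A → A → List A → X) : Prop where
  left : ∀ a u, IsML k fun x => ψ x a u
  mid : ∀ x u, ∃ T : A →ₗ[k] X, ∀ a, ψ x a u = T a
  right : ∀ x a, IsML k (ψ x a)

/-- `h` vanishes on marked words whose number of unmarked letters does not have the parity `p`. -/
def HasPar₃ (h : List A → A → List A → X) (p : ZMod 2) : Prop :=
  ∀ x a u, h x a u ≠ 0 → par x + par u = p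

/-- The part of the coderivation on marked words that acts to the right of the marked letter. -/
def Dr (g : List A → A) (q : ZMod 2) (ψ : List A → A → List A → X) (x : List A) (a : A)
    (u : List A) : X :=
  sg (q * (par x + 1)) • D g q (ψ x a) u

/-- The part of the coderivation on marked words that acts to the left of the marked letter. -/
def Dl (g : List A → A) (q : ZMod 2) (ψ : List A → A → List A → X) (x : List A) (a : A)
    (u : List A) : X :=
  D g q (fun x' => ψ x' a u) x

/-- Precomposition with the insertion of `h` around the marked letter. -/
def Mk (h : List A → A → List A → A) (p : ZMod 2) (ψ : List A → A → List A → X) (x : List A) (a : A)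
    (u : List A) : X :=
  spl (fun x₁ x₂ => sg (p * par x₁) • spl (fun u₁ u₂ => ψ x₁ (h x₂ a u₁) u₂) u) x

/-- A function of words as a function of marked words. -/
def cat (φ : List A → X) (x : List A) (a : A) (u : List A) : X := φ (x ++ a :: u)

/-- Precomposition with the coderivation on marked words. -/
def DW (g : List A → A) (q : ZMod 2) (ψ : List A → A → List A → X) (x : List A) (a : A)
    (u : List A) : X :=
  Dl g q ψ x a u + Mk (cat g) q ψ x a u + Dr g q ψ x a u

variable {f g : List A → A} {h h' : List A → A → List A → A} {p q : ZMod 2} {φ : List A → X}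
  {ψ ψ' : List A → A → List A → X}

lemma IsML.cat (hφ : IsML k φ) : IsML₃ k (cat φ) where
  left a u := hφ.append_right _
  mid x u := hφ x u
  right x a := (hφ.append_left x).cons a

lemma HasPar.cat (hf : HasPar φ p) : HasPar₃ (cat φ) p := fun x a u hw => by
  rw [← hf _ hw]; simp only [par_append, par_cons]; grind

lemma IsML₃.add (hψ : IsML₃ k ψ) (hψ' : IsML₃ k ψ') : IsML₃ k fun x a u => ψ x a u + ψ' x a u where
  left a u := (hψ.left a u).add (hψ'.left a u)
  mid x u := by
    obtain ⟨T, hT⟩ := hψ.mid x u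
    obtain ⟨S, hS⟩ := hψ'.mid x u
    exact ⟨T + S, fun a => by simp [hT, hS]⟩
  right x a := (hψ.right x a).add (hψ'.right x a)

lemma IsML₃.map_zero (hψ : IsML₃ k ψ) (x u : List A) : ψ x 0 u = 0 := by
  obtain ⟨T, hT⟩ := hψ.mid x u
  rw [hT, _root_.map_zero]

lemma exists_linear_spl {F : A → List A → List A → X}
    (hF : ∀ u v, ∃ T : A →ₗ[k] X, ∀ a, F a u v = T a) (w : List A) :
    ∃ T : A →ₗ[k] X, ∀ a, spl (F a) w = T a := by
  induction w generalizing F with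
  | nil => exact hF [] []
  | cons c w ih =>
    obtain ⟨T, hT⟩ := hF [] (c :: w)
    obtain ⟨S, hS⟩ := ih (F := fun a u v => F a (c :: u) v) (fun u v => hF (c :: u) v)
    exact ⟨T + S, fun a => by rw [spl_cons, hT, hS]; rfl⟩

lemma exists_linear_zsmul {F : A → X} (hF : ∃ T : A →ₗ[k] X, ∀ a, F a = T a) (c : ℤ) :
    ∃ T : A →ₗ[k] X, ∀ a, c • F a = T a := by
  obtain ⟨T, hT⟩ := hF
  exact ⟨c • T, fun a => by simp [hT]⟩

lemma exists_linear_D {F : A → List A → X}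
    (hF : ∀ u, ∃ T : A →ₗ[k] X, ∀ a, F a u = T a) (w : List A) :
    ∃ T : A →ₗ[k] X, ∀ a, D g q (F a) w = T a :=
  exists_linear_spl (fun _ _ => exists_linear_zsmul (exists_linear_spl (fun _ _ => hF _) _) _) w

lemma IsML.D_param {F : List A → List A → X} (hF : ∀ u, IsML k fun x => F x u) (w : List A) :
    IsML k fun x => HochschildWords.D g q (F x) w :=
  IsML.spl_param (fun _ _ => (IsML.spl_param (fun _ _ => hF _) _).zsmul _) w

lemma IsML₃.Dr (hg : IsML k g) (hψ : IsML₃ k ψ) : IsML₃ k (Dr g q ψ) where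
  left a u := (IsML.D_param (fun u => hψ.left a u) u).par_smul fun e => sg (q * (e + 1))
  mid x u := exists_linear_zsmul (exists_linear_D (fun u => hψ.mid x u) u) _
  right x a := (hg.D (hψ.right x a)).zsmul _

lemma IsML₃.Dl (hg : IsML k g) (hψ : IsML₃ k ψ) : IsML₃ k (Dl g q ψ) where
  left a u := hg.D (hψ.left a u)
  mid x u := exists_linear_D (F := fun a x => ψ x a u) (fun x => hψ.mid x u) _
  right x a := IsML.D_param (F := fun u x => ψ x a u) (fun x => hψ.right x a) x

lemma IsML₃.Mk (hh : IsML₃ k h) (hψ : IsML₃ k ψ) : IsML₃ k (Mk h p ψ) where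
  left a u := by
    refine IsML.spl (fun x₂ => ?_) fun x₁ => ?_
    · exact (IsML.spl_param (fun u₁ u₂ => hψ.left _ _) u).par_smul fun e => sg (p * e)
    · refine (IsML.spl_param (fun u₁ u₂ => ?_) u).zsmul _
      obtain ⟨T, hT⟩ := hψ.mid x₁ u₂
      simp only [hT]
      exact (hh.left a u₁).comp T
  mid x u := by
    refine exists_linear_spl (fun x₁ x₂ => exists_linear_zsmul (exists_linear_spl ?_ _) _) _
    intro u₁ u₂
    obtain ⟨T, hT⟩ := hψ.mid x₁ u₂
    obtain ⟨S, hS⟩ := hh.mid x₂ u₁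
    exact ⟨T ∘ₗ S, fun a => by simp [hT, hS]⟩
  right x a := by
    refine IsML.spl_param (fun x₁ x₂ => IsML.zsmul (IsML.spl (fun u₂ => ?_) fun u₁ => ?_) _) x
    · obtain ⟨T, hT⟩ := hψ.mid x₁ u₂
      simp only [hT]
      exact (hh.right x₂ a).comp T
    · exact hψ.right _ _

lemma IsML₃.DW (hg : IsML k g) (hψ : IsML₃ k ψ) : IsML₃ k (DW g q ψ) :=
  ((hψ.Dl hg).add (hg.cat.Mk hψ)).add (hψ.Dr hg)

lemma Dr_Dr (hψ : IsML₃ k ψ) (hf : HasPar f p) (hg : HasPar g q) (x : List A) (a : A) (u : List A) :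
    Dr g q (Dr f p ψ) x a u =
      Dr (br f p g q) (p + q) ψ x a u + sg (p * q) • Dr f p (Dr g q ψ) x a u := by
  unfold Dr
  rw [D_smul, D_smul, D_D_comm (hψ.right x a) hf hg]
  simp only [smul_add, smul_smul, ← sg_add]
  exact congrArg₂ (· + ·) (sg_smul_congr (by grind) rfl) (sg_smul_congr (by grind) rfl)

lemma Dl_Dl (hψ : IsML₃ k ψ) (hf : HasPar f p) (hg : HasPar g q) (x : List A) (a : A) (u : List A) :
    Dl g q (Dl f p ψ) x a u =
      Dl (br f p g q) (p + q) ψ x a u + sg (p * q) • Dl f p (Dl g q ψ) x a u :=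
  D_D_comm (hψ.left a u) hf hg x

lemma D_D_param (F : List A → List A → X) (x u : List A) :
    D g q (fun u => D f p (fun x => F x u) x) u = D f p (fun x => D g q (F x) u) x := by
  change D g q (fun u => spl (fun a b => sg (p * par a) •
    spl (fun v z => F (a ++ f v :: z) u) b) x) u = _
  rw [D_spl_apply]
  refine spl_congr fun a b _ => ?_
  rw [D_smul, D_spl_apply]

/-- The two operators act on opposite sides of the mark and so commute up to the Koszul sign. Since
`Dr` counts the letters on the left, its sign notices the parity change caused by `f`. -/
lemma Dr_Dl (hψ : IsML₃ k ψ) (hf : HasPar f p) (x : List A) (a : A) (u : List A) :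
    Dr g q (Dl f p ψ) x a u = sg (p * q) • Dl f p (Dr g q ψ) x a u := by
  unfold Dr Dl
  rw [D_par_smul (IsML.D_param (fun u => hψ.left a u) u) hf (fun e => sg (q * (e + 1))), D_D_param,
    smul_smul, ← sg_add]
  exact sg_smul_congr (by grind) rfl

/-- To the right of the mark, `g` acts either on letters consumed by `h` or on the letters that `h`
leaves over. -/
lemma Dr_Mk (hψ : IsML₃ k ψ) (hh : HasPar₃ h p) (x : List A) (a : A) (u : List A) :
    Dr g q (Mk h p ψ) x a u =
      Mk (Dr g q h) (p + q) ψ x a u + sg (p * q) • Mk h p (Dr g q ψ) x a u := by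
  have e : ∀ x₁ x₂ u₁ u₂, D g q (fun u' => ψ x₁ (h x₂ a u') u₂) u₁ =
      ψ x₁ (D g q (h x₂ a) u₁) u₂ := fun x₁ x₂ u₁ u₂ => by
    obtain ⟨T, hT⟩ := hψ.mid x₁ u₂
    simp only [hT, map_D]
  unfold Dr Mk
  rw [D_spl_apply, smul_spl, smul_spl, ← spl_add]
  refine spl_congr fun x₁ x₂ ex => ?_
  rw [D_smul]
  rw [D_spl]
  simp only [e, smul_add, smul_spl]
  congr 1
  · refine spl_congr fun u₁ u₂ _ => ?_
    obtain ⟨T, hT⟩ := hψ.mid x₁ u₂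
    simp only [hT, map_zsmul, smul_smul, ← sg_add]
    subst ex
    exact sg_smul_congr (by simp only [par_append]; grind) rfl
  · refine spl_congr fun u₁ u₂ _ => ?_
    by_cases h0 : h x₂ a u₁ = 0
    · obtain ⟨T, hT⟩ := hψ.mid x₁ u₂
      have : ψ x₁ 0 = fun _ => 0 := funext fun v => hψ.map_zero x₁ v
      simp only [h0, this, D, smul_zero, spl_zero]
    · simp only [smul_smul, ← sg_add]
      subst ex
      have := hh _ _ _ h0
      exact sg_smul_congr (by simp only [par_append]; grind) rfl

lemma Dl_Mk (hψ : IsML₃ k ψ) (hg : HasPar g q) (x : List A) (a : A) (u : List A) :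
    Dl g q (Mk h p ψ) x a u =
      Mk (Dl g q h) (p + q) ψ x a u + sg (p * q) • Mk h p (Dl g q ψ) x a u := by
  have e : ∀ x₁ x₂ u₁ u₂, D g q (fun x' => ψ x₁ (h x' a u₁) u₂) x₂ =
      ψ x₁ (D g q (fun x' => h x' a u₁) x₂) u₂ := fun x₁ x₂ u₁ u₂ => by
    obtain ⟨T, hT⟩ := hψ.mid x₁ u₂
    simp only [hT, map_D]
  unfold Dl Mk
  change D g q (spl fun x₁ x₂ => sg (p * par x₁) • spl (fun u₁ u₂ => ψ x₁ (h x₂ a u₁) u₂) u) x = _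
  rw [D_spl, smul_spl, ← spl_add, ← spl_add]
  refine spl_congr fun x₁ x₂ ex => ?_
  rw [D_par_smul (IsML.spl_param (fun u₁ u₂ => hψ.left _ _) u) hg (fun e => sg (p * e)), D_smul,
    D_spl_apply, D_spl_apply, add_comm]
  simp only [e, smul_smul, ← sg_add]
  exact congrArg₂ (· + ·) (sg_smul_congr (by grind) rfl) (sg_smul_congr (by grind) rfl)

lemma Mk_Mk (hψ : IsML₃ k ψ) (x : List A) (a : A) (u : List A) :
    Mk h' q (Mk h p ψ) x a u = Mk (Mk h' q h) (p + q) ψ x a u := by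
  have e : ∀ x₁ x₂ u₁ u₂, ψ x₁ (Mk h' q h x₂ a u₁) u₂ =
      spl (fun y₁ y₂ => sg (q * par y₁) • spl (fun v₁ v₂ => ψ x₁ (h y₁ (h' y₂ a v₁) v₂) u₂) u₁) x₂ := by
    intro x₁ x₂ u₁ u₂
    obtain ⟨T, hT⟩ := hψ.mid x₁ u₂
    simp only [hT, Mk, map_spl, map_zsmul]
  change spl (fun x₁ x₂ => sg (q * par x₁) • spl (fun u₁ u₂ => Mk h p ψ x₁ (h' x₂ a u₁) u₂) u) x =
    spl (fun x₁ x₂ => sg ((p + q) * par x₁) • spl (fun u₁ u₂ => ψ x₁ (Mk h' q h x₂ a u₁) u₂) u) x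
  simp only [e]
  unfold Mk
  simp only [smul_spl]
  rw [spl_congr fun x₁ x₂ _ => spl_comm _ u x₁, spl_assoc]
  refine spl_congr fun y₁ y _ => ?_
  rw [spl_comm _ u y]
  refine spl_congr fun y₂ x₂ _ => ?_
  rw [spl_assoc]
  refine spl_congr fun u₁ u₂ _ => spl_congr fun v₁ v₂ _ => ?_
  simp only [smul_smul, ← sg_add, par_append]
  exact sg_smul_congr (by grind) rfl

/-- The argument of `g` lies to the left of the letter `a`, contains it, or lies to the right of it.
-/
lemma D_cat (x : List A) (a : A) (u : List A) :
    D g q φ (x ++ a :: u) = DW g q (cat φ) x a u := by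
  unfold DW Dl Mk Dr cat D
  rw [spl_append_cons]
  simp only [spl_append_cons, smul_add, spl_add, List.append_assoc, List.cons_append, par_append,
    par_cons, smul_spl, smul_smul, ← sg_add]
  refine congrArg₂ (· + ·) rfl (spl_congr fun x₁ x₂ _ => spl_congr fun _ _ _ => ?_)
  exact sg_smul_congr (by grind) rfl

lemma Mk_add_left (hψ : IsML₃ k ψ) (x : List A) (a : A) (u : List A) :
    Mk (fun x a u => h x a u + h' x a u) p ψ x a u = Mk h p ψ x a u + Mk h' p ψ x a u := by
  unfold Mk
  rw [← spl_add]
  refine spl_congr fun x₁ x₂ _ => ?_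
  rw [← smul_add, ← spl_add]
  refine congrArg _ (spl_congr fun u₁ u₂ _ => ?_)
  obtain ⟨T, hT⟩ := hψ.mid x₁ u₂
  simp [hT]

lemma Mk_zsmul_left (hψ : IsML₃ k ψ) (c : ℤ) (x : List A) (a : A) (u : List A) :
    Mk (fun x a u => c • h x a u) p ψ x a u = c • Mk h p ψ x a u := by
  simp only [Mk, smul_spl]
  refine spl_congr fun x₁ x₂ _ => spl_congr fun u₁ u₂ _ => ?_
  obtain ⟨T, hT⟩ := hψ.mid x₁ u₂
  rw [smul_comm]
  simp [hT]

lemma Mk_add : Mk h p (ψ + ψ') = Mk h p ψ + Mk h p ψ' := by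
  funext x a u
  simp only [Mk, Pi.add_apply, spl_add, smul_add]

lemma Mk_zsmul (c : ℤ) : Mk h p (c • ψ) = c • Mk h p ψ := by
  funext x a u
  simp only [Mk, Pi.smul_apply, smul_spl, smul_comm c]

lemma Dr_add : Dr g q (ψ + ψ') = Dr g q ψ + Dr g q ψ' := by
  funext x a u
  simp only [Dr, Pi.add_apply, ← smul_add, ← D_add]; rfl

lemma Dr_zsmul (c : ℤ) : Dr g q (c • ψ) = c • Dr g q ψ := by
  funext x a u
  simp only [Dr, Pi.smul_apply]
  exact (congrArg _ (D_smul c u)).trans (smul_comm _ _ _)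

lemma Dl_add : Dl g q (ψ + ψ') = Dl g q ψ + Dl g q ψ' := by
  funext x a u
  simp only [Dl, Pi.add_apply, ← D_add]

lemma Dl_zsmul (c : ℤ) : Dl g q (c • ψ) = c • Dl g q ψ := by
  funext x a u
  simp only [Dl, Pi.smul_apply, ← D_smul]

lemma DW_eq : DW g q ψ = Dl g q ψ + Mk (cat g) q ψ + Dr g q ψ := rfl

lemma DW_add : DW g q (ψ + ψ') = DW g q ψ + DW g q ψ' := by
  simp only [DW_eq, Dl_add, Dr_add, Mk_add]; abel

lemma DW_zsmul (c : ℤ) : DW g q (c • ψ) = c • DW g q ψ := by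
  simp only [DW_eq, Dl_zsmul, Dr_zsmul, Mk_zsmul, smul_add]

lemma cat_br : cat (br f p g q) =
    fun x a u => DW g q (cat f) x a u + (-sg (p * q)) • DW f p (cat g) x a u := by
  funext x a u
  simp only [cat, br]
  rw [D_cat, D_cat, neg_smul, sub_eq_add_neg]

lemma DW_Mk (hψ : IsML₃ k ψ) (hh : HasPar₃ h p) (hg : HasPar g q) :
    DW g q (Mk h p ψ) = Mk (DW g q h) (p + q) ψ +
      sg (p * q) • (Mk h p (Dl g q ψ) + Mk h p (Dr g q ψ)) := by
  funext x a u
  have e : DW g q h = fun x a u => Dl g q h x a u + Mk (cat g) q h x a u + Dr g q h x a u := rfl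
  simp only [DW, Dr_Mk hψ hh, Dl_Mk hψ hg, Mk_Mk hψ, e, Pi.add_apply, Pi.smul_apply, smul_add]
  rw [Mk_add_left hψ, Mk_add_left hψ]
  abel

lemma zmod_two_cases (p : ZMod 2) : p = 0 ∨ p = 1 := by revert p; decide

/-- The mixed terms of `Dl` and `Dr` cancel by graded commutativity, while the `Mk` terms assemble,
through `cat_br`, into the part of the bracket that acts around the mark. -/
lemma DW_DW (hψ : IsML₃ k ψ) (hf : HasPar f p) (hg : HasPar g q) (hf' : IsML k f)
    (hg' : IsML k g) :
    DW g q (DW f p ψ) = DW (br f p g q) (p + q) ψ + sg (p * q) • DW f p (DW g q ψ) := by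
  have h1 : ∀ {f g : List A → A} {p q : ZMod 2}, IsML k f → IsML k g → HasPar f p → HasPar g q →
      DW g q (DW f p ψ) = Dl g q (Dl f p ψ) + Dr g q (Dl f p ψ) +
      (Dl g q (Dr f p ψ) + Dr g q (Dr f p ψ)) + Mk (cat g) q (Dl f p ψ) + Mk (cat g) q (Dr f p ψ) +
      (Mk (DW g q (cat f)) (p + q) ψ +
      sg (p * q) • (Mk (cat f) p (Dl g q ψ) + Mk (cat f) p (Dr g q ψ))) := by
    intro f g p q hf' hg' hf hg
    rw [DW_eq (ψ := ψ), DW_add, DW_add, DW_Mk hψ hf.cat hg, DW_eq (ψ := Dl f p ψ),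
      DW_eq (ψ := Dr f p ψ)]
    abel
  have h2 : Dl g q (Dl f p ψ) =
      Dl (br f p g q) (p + q) ψ + sg (p * q) • Dl f p (Dl g q ψ) := by
    funext x a u; exact Dl_Dl hψ hf hg x a u
  have h3 : Dr g q (Dr f p ψ) =
      Dr (br f p g q) (p + q) ψ + sg (p * q) • Dr f p (Dr g q ψ) := by
    funext x a u; exact Dr_Dr hψ hf hg x a u
  have h4 : Dr g q (Dl f p ψ) = sg (p * q) • Dl f p (Dr g q ψ) := by
    funext x a u; exact Dr_Dl hψ hf x a u
  have h5 : Dr f p (Dl g q ψ) = sg (p * q) • Dl g q (Dr f p ψ) := by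
    funext x a u; rw [mul_comm]; exact Dr_Dl hψ hg x a u
  have h6 : Mk (cat (br f p g q)) (p + q) ψ =
      Mk (DW g q (cat f)) (p + q) ψ - sg (p * q) • Mk (DW f p (cat g)) (p + q) ψ := by
    funext x a u
    rw [cat_br, Mk_add_left hψ, Mk_zsmul_left hψ, neg_smul, ← sub_eq_add_neg]; rfl
  rw [h1 hf' hg' hf hg, h1 hg' hf' hg hf, DW_eq (g := br f p g q), h2, h3, h4, h5, h6, add_comm q p, mul_comm q p]
  simp only [smul_add, sg_sq_smul]
  abel

/-- On its own `Dr g` does not satisfy the commutator rule. The defect is the insertion of `f`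
around the mark with `g` applied inside it, to the right of the mark: for `f = μ` this will be the
contraction by `g`, and for general `f` it is the Cartan homotopy. -/
lemma Dr_DW (hψ : IsML₃ k ψ) (hf : HasPar f p) (hg : HasPar g q) (hf' : IsML k f)
    (hg' : IsML k g) :
    Dr g q (DW f p ψ) = Dr (br f p g q) (p + q) ψ + Mk (Dr g q (cat f)) (p + q) ψ +
      sg (p * q) • DW f p (Dr g q ψ) := by
  have h3 : Dr g q (Dr f p ψ) =
      Dr (br f p g q) (p + q) ψ + sg (p * q) • Dr f p (Dr g q ψ) := by
    funext x a u; exact Dr_Dr hψ hf hg x a u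
  have h4 : Dr g q (Dl f p ψ) = sg (p * q) • Dl f p (Dr g q ψ) := by
    funext x a u; exact Dr_Dl hψ hf x a u
  have h5 : Dr g q (Mk (cat f) p ψ) =
      Mk (Dr g q (cat f)) (p + q) ψ + sg (p * q) • Mk (cat f) p (Dr g q ψ) := by
    funext x a u; exact Dr_Mk hψ hf.cat x a u
  rw [DW_eq (ψ := ψ), Dr_add, Dr_add, h3, h4, h5, DW_eq]
  simp only [smul_add]
  abel

lemma D_eq_zero_of_left (hφ : IsML k φ) (hg : ∀ w, g w = 0) (w : List A) : D g q φ w = 0 := by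
  refine spl_eq_zero fun u y _ => ?_
  rw [spl_eq_zero, smul_zero]
  intro v x _
  rw [hg, hφ.map_zero]

lemma Dr_eq_zero_of_left (hψ : IsML₃ k ψ) (hg : ∀ w, g w = 0) : Dr g q ψ = 0 := by
  funext x a u
  rw [Dr, D_eq_zero_of_left (hψ.right x a) hg, smul_zero]; rfl

lemma DW_eq_zero_of_left (hψ : IsML₃ k ψ) (hg : ∀ w, g w = 0) : DW g q ψ = 0 := by
  rw [DW_eq, Dr_eq_zero_of_left hψ hg]
  funext x a u
  have h1 : Dl g q ψ x a u = 0 := D_eq_zero_of_left (hψ.left a u) hg x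
  have h2 : Mk (cat g) q ψ x a u = 0 := spl_eq_zero fun x₁ x₂ _ => by
    rw [spl_eq_zero, smul_zero]
    intro u₁ u₂ _
    rw [cat, hg, hψ.map_zero]
  simp [h1, h2]

end marked

/-! ### The Cartan homotopy formula on marked words -/

section cartan

variable {k A X : Type*} [CommRing k] [AddCommGroup A] [Module k A] [AddCommGroup X] [Module k X]
variable {μ f g : List A → A} {p q : ZMod 2} {ψ : List A → A → List A → X}

lemma br_symm (w : List A) : br g q f p w = -sg (p * q) • br f p g q w := by
  simp only [br, smul_sub, neg_smul, sg_sq_smul, mul_comm q p]; abel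

/-- For a cocycle `g` the bracket term vanishes, and contraction by `g` becomes the graded
commutator of `Dr g` with the differential `DW μ`. -/
lemma Dr_DW_cocycle (hψ : IsML₃ k ψ) (hμ : HasPar μ 1) (hμ' : IsML k μ) (hg : HasPar g q)
    (hg' : IsML k g) (hc : ∀ w, br μ 1 g q w = 0) :
    Dr g q (DW μ 1 ψ) = Mk (Dr g q (cat μ)) (1 + q) ψ + sg q • DW μ 1 (Dr g q ψ) := by
  rw [Dr_DW hψ hμ hg hμ' hg', Dr_eq_zero_of_left hψ hc, zero_add, one_mul]

/-- The marked-word form of the Cartan homotopy formula. -/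
lemma Mk_DW_cartan (hψ : IsML₃ k ψ) (hμ : HasPar μ 1) (hμ' : IsML k μ)
    (hf : HasPar f p) (hf' : IsML k f) (hg : HasPar g q) (hg' : IsML k g)
    (hcf : ∀ w, br μ 1 f p w = 0) (hcg : ∀ w, br μ 1 g q w = 0)
    (hcb : ∀ w, br μ 1 (br f p g q) (p + q) w = 0) :
    Mk (Dr g q (cat μ)) (1 + q) (DW f p ψ) =
      sg p • Mk (Dr (br f p g q) (p + q) (cat μ)) (1 + (p + q)) ψ +
      sg p • Mk (Dr g q (cat f)) (p + q) (DW μ 1 ψ) -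
      sg q • DW μ 1 (Mk (Dr g q (cat f)) (p + q) ψ) +
      sg (p * (q + 1)) • DW f p (Mk (Dr g q (cat μ)) (1 + q) ψ) := by
  have hb : HasPar (br f p g q) (p + q) := hf.br hg hf' hg'
  have hb' : IsML k (br f p g q) := hf'.br hg'
  have hcf' : ∀ w, br f p μ 1 w = 0 := fun w => by rw [br_symm, hcf, smul_zero]
  -- `Dr g (DW μ (DW f ψ))` is expanded in two ways: directly in `e1`, and, after exchanging `DW μ`
  -- and `DW f` by `e2`, through `Dr g (DW f (DW μ ψ))` in `e4`, `e5` and `e6`. The terms with `Dr`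
  -- applied to `ψ` itself cancel and the claim is what remains.
  have e1 := Dr_DW_cocycle (hψ.DW hf' (q := p)) hμ hμ' hg hg' hcg
  have e2 : ∀ {ψ : List A → A → List A → X}, IsML₃ k ψ →
      DW μ 1 (DW f p ψ) = sg p • DW f p (DW μ 1 ψ) := fun hψ => by
    rw [DW_DW hψ hf hμ hf' hμ', DW_eq_zero_of_left hψ hcf', zero_add, mul_one]
  have e3 := Dr_DW hψ hf hg hf' hg'
  have e4 := Dr_DW (hψ.DW hμ' (q := 1)) hf hg hf' hg'
  have e5 := Dr_DW_cocycle hψ hμ hμ' hg hg' hcg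
  have e6 := Dr_DW_cocycle hψ hμ hμ' hb hb' hcb
  rw [e2 hψ, Dr_zsmul, e3, e4, e5, e6] at e1
  simp only [DW_add, DW_zsmul, e2 (hψ.Dr hg')] at e1
  rw [← sub_eq_iff_eq_add] at e1
  rw [← e1]
  rcases zmod_two_cases p with rfl | rfl <;> rcases zmod_two_cases q with rfl | rfl <;>
    simp [show (1 : ZMod 2) + 1 = 0 from rfl] <;> abel

end cartan

/-! ### Cyclic words -/

section cyclic

variable {k A X Y : Type*} [CommRing k] [AddCommGroup A] [Module k A] [AddCommGroup X] [Module k X]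

/-- A function of a letter and a word that is linear in each letter. -/
structure IsML₂ (k : Type*) {A X : Type*} [CommRing k] [AddCommGroup A] [Module k A]
    [AddCommGroup X] [Module k X] (φ : A → List A → X) : Prop where
  left : ∀ u, ∃ T : A →ₗ[k] X, ∀ a, φ a u = T a
  right : ∀ a, IsML k (φ a)

/-- The transpose of `a₀ ⊗ w ↦ ∑ ± v ⊗ a₀ ⊗ u`, the sum being over the decompositions
`w = u ++ v`. -/
def nu (ψ : List A → A → List A → X) (a : A) (w : List A) : X :=
  spl (fun u v => sg (par v * (par u + 1)) • ψ v a u) w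

/-- Precomposition with the insertion of `h` around the marked letter of a cyclic word. -/
def Fk (h : List A → A → List A → A) (φ : A → List A → X) (a : A) (w : List A) : X :=
  spl (fun u z => spl (fun y x => sg (par x * (par u + 1 + par y)) • φ (h x a u) y) z) w

/-- The extension by zero of a function of cyclic words to words with a marked letter. -/
def eps (φ : A → List A → X) : List A → A → List A → X
  | [], a, u => φ a u
  | _ :: _, _, _ => 0

/-- Precomposition with the Lie derivative along `g` on cyclic words. -/
def Lc (g : List A → A) (q : ZMod 2) (φ : A → List A → X) (a : A) (w : List A) : X :=
  sg q • D g q (φ a) w + Fk (cat g) φ a w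

variable {f g : List A → A} {h : List A → A → List A → A} {p q : ZMod 2} {χ χ' : List A → X}
  {φ φ' : A → List A → X} {ψ ψ' : List A → A → List A → X}

lemma IsML₂.map_zero (hφ : IsML₂ k φ) (w : List A) : φ 0 w = 0 := by
  obtain ⟨T, hT⟩ := hφ.left w
  rw [hT, _root_.map_zero]

lemma IsML₂.nu (hψ : IsML₃ k ψ) : IsML₂ k (nu ψ) where
  left u := exists_linear_spl (fun _ _ => exists_linear_zsmul (hψ.mid _ _) _) u
  right a := IsML.spl (fun v => (hψ.right v a).par_smul fun e => sg (par v * (e + 1)))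
    fun u => (hψ.left a u).par_smul fun e => sg (e * (par u + 1))

lemma IsML₂.Fk (hh : IsML₃ k h) (hφ : IsML₂ k φ) : IsML₂ k (Fk h φ) where
  left w := exists_linear_spl (fun u z => exists_linear_spl (fun y x => exists_linear_zsmul (by
    obtain ⟨T, hT⟩ := hφ.left y
    obtain ⟨S, hS⟩ := hh.mid x u
    exact ⟨T ∘ₗ S, fun a => by simp [hT, hS]⟩) _) _) w
  right a := by
    refine IsML.spl (fun z => IsML.spl_param (fun y x => ?_) z) fun u => IsML.spl (fun x => ?_)
      fun y => ?_
    · obtain ⟨T, hT⟩ := hφ.left y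
      simp only [hT]
      exact ((hh.right x a).comp T).par_smul fun e => sg (par x * (e + 1 + par y))
    · exact (hφ.right _).par_smul fun e => sg (par x * (par u + 1 + e))
    · obtain ⟨T, hT⟩ := hφ.left y
      simp only [hT]
      exact ((hh.left a u).comp T).par_smul fun e => sg (e * (par u + 1 + par y))

lemma IsML₃.eps (hφ : IsML₂ k φ) : IsML₃ k (eps φ) where
  left a u := fun x y => ⟨0, fun b => by cases x <;> rfl⟩
  mid x u := by
    cases x with
    | nil => exact hφ.left u
    | cons b x => exact ⟨0, fun _ => rfl⟩
  right x a := by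
    cases x with
    | nil => exact hφ.right a
    | cons b x => exact IsML.zero

lemma IsML₂.zsmul (hφ : IsML₂ k φ) (c : ℤ) : IsML₂ k (c • φ) where
  left u := exists_linear_zsmul (hφ.left u) c
  right a := (hφ.right a).zsmul c

lemma IsML₂.Lc (hg : IsML k g) (hφ : IsML₂ k φ) : IsML₂ k (Lc g q φ) where
  left u := by
    obtain ⟨T, hT⟩ := exists_linear_zsmul (exists_linear_D (g := g) (q := q) hφ.left u) (sg q)
    obtain ⟨S, hS⟩ := (hφ.Fk hg.cat).left u
    exact ⟨T + S, fun a => by rw [HochschildWords.Lc, hT, hS]; rfl⟩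
  right a := ((hg.D (hφ.right a)).zsmul _).add ((hφ.Fk hg.cat).right a)

lemma spl_right_nil {F : List A → List A → X} {w : List A}
    (h : ∀ u v, u ++ v = w → v ≠ [] → F u v = 0) : spl F w = F w [] := by
  induction w generalizing F with
  | nil => rfl
  | cons a w ih =>
    rw [spl_cons, h [] (a :: w) rfl (by simp), zero_add]
    exact ih fun u v e hv => h _ _ (by simp [e]) hv

/-- Every function of cyclic words is the `nu` of its extension by zero; this is how identities on
marked words descend to cyclic words. -/
lemma nu_eps : nu (eps φ) = φ := by
  funext a w
  rw [nu, spl_right_nil]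
  · simp [eps]
  · intro u v _ hv
    obtain ⟨c, v, rfl⟩ := List.exists_cons_of_ne_nil hv
    simp [eps]

lemma nu_add : nu (ψ + ψ') = nu ψ + nu ψ' := by
  funext a w
  simp only [nu, Pi.add_apply, smul_add, spl_add]

lemma nu_zsmul (c : ℤ) : nu (c • ψ) = c • nu ψ := by
  funext a w
  simp only [nu, Pi.smul_apply, smul_spl, smul_comm c]

/-- After `nu`, the letters to the left of the mark sit at the end of the word, so an insertion
around the mark becomes one that wraps around cyclically. -/
lemma nu_Mk (hψ : IsML₃ k ψ) (hh : HasPar₃ h p) : nu (Mk h p ψ) = Fk h (nu ψ) := by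
  funext a w
  simp only [nu, Mk, Fk, smul_spl]
  rw [spl_congr fun u v _ => spl_comm _ v u, spl_assoc]
  refine spl_congr fun u₁ z _ => ?_
  rw [spl_assoc]
  refine spl_congr fun u₂ v _ => spl_congr fun x₁ x₂ e => ?_
  subst e
  by_cases h0 : h x₂ a u₁ = 0
  · rw [h0, hψ.map_zero]; simp
  · have := hh _ _ _ h0
    simp only [smul_smul, ← sg_add, par_append]
    exact sg_smul_congr (by grind [zmod_two_mul_self (par x₁)]) rfl

/-- By `D_spl`, the coderivation applied to the word before it is cut acts on one of the two pieces;
as these become the right and left sides of the mark, only the sum `Dl + Dr` passes to cyclic words.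
-/
lemma nu_Dl_add_Dr (hψ : IsML₃ k ψ) (hg : HasPar g q) (a : A) (w : List A) :
    nu (Dl g q ψ + Dr g q ψ) a w = sg q • D g q (nu ψ a) w := by
  have e : nu ψ a = spl fun u v => sg (par v * (par u + 1)) • ψ v a u := rfl
  rw [e, D_spl, smul_add, add_comm, nu_add, Pi.add_apply, Pi.add_apply, smul_spl, smul_spl]
  congr 1
  · refine spl_congr fun u v _ => ?_
    rw [D_par_smul (hψ.right v a) hg fun e => sg (par v * (e + 1)), Dr]
    simp only [smul_smul, ← sg_add]
    exact sg_smul_congr (by grind) rfl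
  · refine spl_congr fun u v _ => ?_
    rw [D_par_smul (hψ.left a u) hg fun e => sg (e * (par u + 1)), Dl]
    simp only [smul_smul, ← sg_add]
    exact sg_smul_congr (by grind) rfl

lemma nu_DW (hψ : IsML₃ k ψ) (hg : HasPar g q) : nu (DW g q ψ) = Lc g q (nu ψ) := by
  have e : DW g q ψ = Dl g q ψ + Dr g q ψ + Mk (cat g) q ψ := by rw [DW_eq]; abel
  rw [e, nu_add, nu_Mk hψ hg.cat]
  funext a w
  rw [Pi.add_apply, Pi.add_apply, nu_Dl_add_Dr hψ hg]; rfl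

lemma HasPar₃.Dr (hh : HasPar₃ h p) (hg : HasPar g q) (hh' : IsML₃ k h) :
    HasPar₃ (Dr g q h) (p + q) := by
  intro x a u hw
  by_contra hc
  apply hw
  rw [HochschildWords.Dr, smul_eq_zero_of_right]
  have h1 : HasPar (h x a) (p + par x + 1) := fun w hw => by rw [← hh _ _ _ hw]; grind
  have h2 := (h1.D hg (hh'.right x a)) u
  by_contra hc'
  have := h2 hc'
  apply hc
  grind

variable {μ : List A → A}

/-- The Cartan homotopy formula on cyclic words. -/
lemma Fk_Lc_cartan (hφ : IsML₂ k φ) (hμ : HasPar μ 1) (hμ' : IsML k μ)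
    (hf : HasPar f p) (hf' : IsML k f) (hg : HasPar g q) (hg' : IsML k g)
    (hcf : ∀ w, br μ 1 f p w = 0) (hcg : ∀ w, br μ 1 g q w = 0)
    (hcb : ∀ w, br μ 1 (br f p g q) (p + q) w = 0) :
    Fk (Dr g q (cat μ)) (Lc f p φ) =
      sg p • Fk (Dr (br f p g q) (p + q) (cat μ)) φ +
      sg p • Fk (Dr g q (cat f)) (Lc μ 1 φ) -
      sg q • Lc μ 1 (Fk (Dr g q (cat f)) φ) +
      sg (p * (q + 1)) • Lc f p (Fk (Dr g q (cat μ)) φ) := by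
  have hb : HasPar (br f p g q) (p + q) := hf.br hg hf' hg'
  have hb' : IsML k (br f p g q) := hf'.br hg'
  -- The marked-word formula is applied to `eps φ`; `nu` then turns each `Mk` into `Fk`, each `DW`
  -- into `Lc`, and `eps φ` back into `φ`.
  have hE := IsML₃.eps hφ
  have hE' := hE.DW hf' (q := p)
  have hE'' := hE.DW hμ' (q := 1)
  have h1 := hμ.cat.Dr hg hμ'.cat
  have h2 := hμ.cat.Dr hb hμ'.cat
  have h3 := hf.cat.Dr hg hf'.cat
  have h4 : IsML₃ k (Dr g q (cat μ)) := hμ'.cat.Dr hg'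
  have h6 : IsML₃ k (Dr g q (cat f)) := hf'.cat.Dr hg'
  have key := congrArg nu (Mk_DW_cartan hE hμ hμ' hf hf' hg hg' hcf hcg hcb)
  simp only [sub_eq_add_neg, nu_add, nu_zsmul, ← neg_smul] at key
  rw [nu_Mk hE' h1, nu_Mk hE h2, nu_Mk hE'' h3, nu_DW (h6.Mk hE) hμ, nu_DW (h4.Mk hE) hf, nu_Mk hE h3,
    nu_Mk hE h1, nu_DW hE hf, nu_DW hE hμ, nu_eps] at key
  rw [key, neg_smul, sub_eq_add_neg]

/-- The transpose of the norm operator. -/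
def Nn (χ : List A → X) : A → List A → X := nu (cat χ)

/-- The transpose of the rotations with an insertion of `f` after the zeroth letter. -/
def Pk (f : List A → A) (p : ZMod 2) (χ : List A → X) : A → List A → X := nu (Dr f p (cat χ))

lemma cat_D : cat (D g q χ) = DW g q (cat χ) := by
  funext x a u; exact D_cat x a u

lemma Nn_D (hχ : IsML k χ) (hg : HasPar g q) : Nn (D g q χ) = Lc g q (Nn χ) := by
  rw [Nn, cat_D, nu_DW hχ.cat hg, Nn]

/-- `Dr_DW_cocycle` pushed through `nu`. It makes `Pk f` a homotopy for the contraction of `Nn χ` by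
`f`, which is how `i_f B` enters `Fk_B₀`. -/
lemma Pk_D (hχ : IsML k χ) (hμ : HasPar μ 1) (hμ' : IsML k μ)
    (hf : HasPar f p) (hf' : IsML k f) (hcf : ∀ w, br μ 1 f p w = 0) :
    Pk f p (D μ 1 χ) = Fk (Dr f p (cat μ)) (Nn χ) + sg p • Lc μ 1 (Pk f p χ) := by
  rw [Pk, cat_D, Dr_DW_cocycle hχ.cat hμ hμ' hf hf' hcf, nu_add, nu_zsmul,
    nu_Mk hχ.cat (hμ.cat.Dr hf hμ'.cat), nu_DW (hχ.cat.Dr hf') hμ]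
  rfl

/-- The sum of `G u l v` over all decompositions `w = u ++ l :: v`. -/
def mid (G : List A → A → List A → X) : List A → X
  | [] => 0
  | a :: w => G [] a w + mid (fun u => G (a :: u)) w

lemma mid_congr {F G : List A → A → List A → X} {w : List A}
    (h : ∀ u l v, u ++ l :: v = w → F u l v = G u l v) : mid F w = mid G w := by
  induction w generalizing F G with
  | nil => rfl
  | cons a w ih =>
    rw [mid, mid, h [] a w rfl, ih fun u l v e => h (a :: u) l v (by simp [e])]

lemma mid_add (F G : List A → A → List A → X) (w : List A) :
    mid (fun u l v => F u l v + G u l v) w = mid F w + mid G w := by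
  induction w generalizing F G with
  | nil => simp [mid]
  | cons a w ih => simp only [mid, ih]; abel

lemma spl_eq_mid_right (F : List A → List A → X) (w : List A) :
    spl F w = F w [] + mid (fun u l v => F u (l :: v)) w := by
  induction w generalizing F with
  | nil => simp [mid, spl_nil]
  | cons a w ih => simp only [mid, ih, spl_cons]; abel

lemma spl_eq_mid_left (F : List A → List A → X) (w : List A) :
    spl F w = F [] w + mid (fun u l v => F (u ++ [l]) v) w := by
  induction w generalizing F with
  | nil => simp [mid, spl_nil]
  | cons a w ih => simp only [mid, ih, spl_cons, List.nil_append, List.cons_append]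

/-- A function of cyclic words as a function of words. -/
def toT (φ : A → List A → X) : List A → X
  | [] => 0
  | a :: w => φ a w

/-- A function of cyclic words precomposed with the signed rotation of the last letter. -/
def tau (φ : A → List A → X) (w : List A) : X :=
  match w.reverse with
  | [] => 0
  | l :: y => sg (par y) • φ l y.reverse

@[simp] lemma tau_nil : tau φ [] = 0 := rfl

lemma tau_append_singleton (y : List A) (l : A) : tau φ (y ++ [l]) = sg (par y) • φ l y := by
  simp [tau, par]

lemma tau_append_cons_append_singleton (y z : List A) (a l : A) :
    tau φ (y ++ a :: (z ++ [l])) = sg (par y + par z + 1) • φ l (y ++ a :: z) := by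
  have := tau_append_singleton (φ := φ) (y ++ a :: z) l
  rw [List.append_assoc] at this
  rw [← List.cons_append, this]
  simp [add_assoc]

lemma IsML.tau (hφ : IsML₂ k φ) : IsML k (tau φ) := fun u v => by
  rcases List.eq_nil_or_concat v with rfl | ⟨v, l, rfl⟩
  · simp only [tau_append_singleton]
    exact exists_linear_zsmul (hφ.left u) _
  · simp only [List.concat_eq_append, tau_append_cons_append_singleton]
    exact exists_linear_zsmul (hφ.right l u v) _

/-- The terms of a coderivation in which `f` acts on the last letters of the word. -/
def DLast (f : List A → A) (p : ZMod 2) (χ : List A → X) (w : List A) : X :=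
  spl (fun u y => sg (p * par u) • χ (u ++ [f y])) w

lemma D_nil (χ : List A → X) : D f p χ [] = DLast f p χ [] := by
  simp [D, DLast, spl_nil]

lemma D_append_singleton (χ : List A → X) (z : List A) (l : A) :
    D f p χ (z ++ [l]) = D f p (fun w => χ (w ++ [l])) z + DLast f p χ (z ++ [l]) := by
  unfold D DLast
  rw [spl_append_cons, spl_append_cons]
  simp only [spl_append_cons, spl_nil, smul_add, spl_add, List.append_assoc, List.cons_append]
  abel

/-- Precomposition with the application of `f` to an initial part of the word. -/
def front (f : List A → A) (φ : A → List A → X) (w : List A) : X :=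
  spl (fun u v => φ (f u) v) w

/-- Telescoping over rotations. The terms of `toT φ` that are really rotated cancel the terms of
`tau φ` in which `f` stays away from the end of the word. What survives is the unrotated part of
`toT`, which is the `D` part of `Lc`, and the terms of `tau` in which `f` consumes the last letters.
`Nn (front f φ)` cancels the latter and adds the insertions whose argument contains `a`, the `Fk`
part of `Lc`. -/
lemma Pk_toT_sub_tau (hφ : IsML₂ k φ) (hf : HasPar f p) (a : A) (w : List A) :
    Pk f p (fun w => toT φ w - tau φ w) a w + Nn (front f φ) a w = Lc f p φ a w := by
  have e1 : ∀ χ : List A → X, Pk f p χ a w = spl (fun z v => sg (par v * (par z + 1)) •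
      sg (p * (par v + 1)) • D f p (fun u => χ (v ++ a :: u)) z) w := fun _ => rfl
  have e2 : Pk f p (toT φ) a w = sg p • D f p (φ a) w + mid (fun z l v =>
      sg ((par v + 1) * (par z + 1)) • sg (p * par v) •
        D f p (fun u => φ l (v ++ a :: u)) z) w := by
    rw [e1, spl_eq_mid_right]
    refine congrArg₂ (· + ·) (by simp [toT]) (mid_congr fun z l v _ => ?_)
    rw [par_cons]
    refine congrArg₂ (· • ·) rfl (congrArg₂ (· • ·) (congrArg _ (by grind)) rfl)
  -- The letter `l` now ends the right piece, and `tau` carries it to the front, where `e2` found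
  -- it; hence the same sum over `mid`.
  have e3 : Pk f p (tau φ) a w = spl (fun z v => sg (par v * (par z + 1)) •
      sg (p * (par v + 1)) • DLast f p (fun u => tau φ (v ++ a :: u)) z) w + mid (fun z l v =>
      sg ((par v + 1) * (par z + 1)) • sg (p * par v) •
        D f p (fun u => φ l (v ++ a :: u)) z) w := by
    rw [e1, spl_eq_mid_left, spl_eq_mid_left, add_assoc, ← mid_add]
    refine congrArg₂ (· + ·) (by rw [D_nil]) (mid_congr fun z l v _ => ?_)
    rw [D_append_singleton, smul_add, smul_add, add_comm]
    congr 1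
    simp only [tau_append_cons_append_singleton]
    rw [D_par_smul (((hφ.right l).append_left v).cons a) hf (fun e => sg (par v + e + 1))]
    simp only [smul_smul, ← sg_add, par_append, par_cons, par_nil]
    refine sg_smul_congr (by grind) rfl
  have e4 : Nn (front f φ) a w = spl (fun z v => sg (par v * (par z + 1)) •
      sg (p * (par v + 1)) • DLast f p (fun u => tau φ (v ++ a :: u)) z) w + Fk (cat f) φ a w := by
    unfold Nn nu cat front
    simp only [spl_append_cons, smul_add, spl_add]
    congr 1
    · unfold DLast
      simp only [smul_spl]
      rw [spl_assoc]
      refine spl_congr fun u t _ => spl_congr fun y v ht => ?_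
      subst ht
      rw [tau_append_cons_append_singleton]
      by_cases h0 : f y = 0
      · simp [h0, hφ.map_zero]
      · have := hf y h0
        simp only [smul_smul, ← sg_add, par_append]
        exact sg_smul_congr (by grind [zmod_two_mul_self (par v), zmod_two_mul_self (par y)]) rfl
    · unfold Fk
      simp only [smul_spl]
      rw [spl_assoc]
      refine spl_congr fun u₁ z _ => spl_congr fun y x _ => ?_
      rw [par_append]
      exact sg_smul_congr (by grind) rfl
  have e5 : Pk f p (fun w => toT φ w - tau φ w) a w = Pk f p (toT φ) a w - Pk f p (tau φ) a w := by
    simp only [e1, D_sub, smul_sub, spl_sub]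
  rw [e5, e2, e3, e4, Lc]
  abel

end cyclic

/-! ### Associative products as coderivations of square zero -/

section algebra

variable {k A X : Type*} [CommRing k] [AddCommGroup A] [Module k A] [AddCommGroup X] [Module k X]

/-- `f` vanishes on words whose length is not `n`. -/
def HasLen (f : List A → X) (n : ℕ) : Prop := ∀ w, f w ≠ 0 → w.length = n

variable {f g : List A → A} {p q : ZMod 2} {χ : List A → X} {φ : A → List A → X} {n r : ℕ}

lemma HasLen.hasPar (hf : HasLen χ n) : HasPar χ (n + 1) := fun w hw => by
  rw [par, hf w hw]

lemma HasLen.D (hχ : HasLen χ n) (hg : HasLen g r) (hχ' : IsML k χ) {w : List A}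
    (hw : D g q χ w ≠ 0) : w.length + 1 = n + r := by
  by_contra hc
  refine hw (spl_eq_zero fun u y e => ?_)
  rw [spl_eq_zero, smul_zero]
  intro v x e'
  by_cases hv : g v = 0
  · rw [hv, hχ'.map_zero]
  · by_contra h'
    have h1 := hχ _ h'
    have h2 := hg _ hv
    subst e'; subst e
    simp at h1 hc
    omega

/-- The identity of `A` as a function of words. -/
def theta : List A → A
  | [a] => a
  | _ => 0

/-- A product as a function of words. -/
def mu (m : A →ₗ[k] A →ₗ[k] A) : List A → A
  | [a, b] => m a b
  | _ => 0

@[simp] lemma theta_nil : theta ([] : List A) = 0 := rfl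
@[simp] lemma theta_singleton (a : A) : theta [a] = a := rfl
@[simp] lemma theta_cons_cons (a b : A) (w : List A) : theta (a :: b :: w) = 0 := rfl

lemma hasLen_theta : HasLen (theta : List A → A) 1 := fun w hw => by
  match w with
  | [] => exact absurd rfl hw
  | [a] => rfl
  | _ :: _ :: _ => exact absurd rfl hw

lemma theta_eq_zero {w : List A} (h : w.length ≠ 1) : theta w = 0 := by
  by_contra hc; exact h (hasLen_theta w hc)

lemma isML_theta : IsML k (theta : List A → A) := fun u v => by
  match u, v with
  | [], [] => exact ⟨LinearMap.id, fun _ => rfl⟩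
  | [], _ :: _ => exact ⟨0, fun _ => rfl⟩
  | [_], _ => exact ⟨0, fun _ => rfl⟩
  | _ :: _ :: _, _ => exact ⟨0, fun _ => rfl⟩

lemma sg_smul_theta (u : List A) (c : ZMod 2 → ZMod 2) :
    sg (c (par u)) • theta u = sg (c 1) • theta u := by
  by_cases h : u.length = 1
  · simp [par, h]
  · simp [theta_eq_zero h]

lemma spl_theta_left (hφ : IsML₂ k φ) (w : List A) :
    spl (fun u v => φ (theta u) v) w = toT φ w := by
  match w with
  | [] => simp [spl_nil, toT, hφ.map_zero]
  | a :: w =>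
    rw [spl_cons, spl_left_nil]
    · simp [toT, hφ.map_zero]
    · intro u v _ hu
      rw [theta_eq_zero (by simpa using hu), hφ.map_zero]

lemma spl_theta_right (hφ : IsML₂ k φ) (w : List A) :
    spl (fun y x => sg (par y) • φ (theta x) y) w = tau φ w := by
  rcases List.eq_nil_or_concat w with rfl | ⟨w, l, rfl⟩
  · simp [spl_nil, hφ.map_zero]
  · rw [List.concat_eq_append, spl_append_cons, spl_right_nil, spl_nil, tau_append_singleton]
    · simp [hφ.map_zero]
    · intro u v _ hv
      rw [theta_eq_zero (by simpa using hv), hφ.map_zero, smul_zero]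

/-- `theta` sees only words of length one, so only the insertion that consumes the whole word
survives: a coderivation is determined by its corestriction. -/
lemma D_theta (g : List A → A) (q : ZMod 2) (w : List A) : D g q theta w = g w := by
  rw [D, spl_left_nil, spl_right_nil]
  · simp
  · intro u v _ hv
    rw [theta_eq_zero (by simpa using hv)]
  · intro u v _ hu
    rw [spl_eq_zero, smul_zero]
    intro y x _
    rw [theta_eq_zero]
    have := List.length_pos_iff.2 hu
    simp; omega

variable (m : A →ₗ[k] A →ₗ[k] A)

lemma hasLen_mu : HasLen (mu m) 2 := fun w hw => by
  match w with
  | [] => exact absurd rfl hw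
  | [a] => exact absurd rfl hw
  | [a, b] => rfl
  | _ :: _ :: _ :: _ => exact absurd rfl hw

lemma hasPar_mu : HasPar (mu m) 1 := by
  have := (hasLen_mu m).hasPar
  rwa [show ((2 : ℕ) : ZMod 2) + 1 = 1 from rfl] at this

lemma mu_eq_zero {w : List A} (h : w.length ≠ 2) : mu m w = 0 := by
  by_contra hc; exact h (hasLen_mu m w hc)

/-- As a convolution of `theta` with itself, the product is accessible to `D_conv` and `D_theta`. -/
lemma mu_eq_spl (w : List A) : mu m w = spl (fun u v => m (theta u) (theta v)) w := by
  match w with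
  | [] => simp [mu, spl]
  | [a] => simp [mu, spl]
  | [a, b] => simp [mu, spl]
  | a :: b :: c :: w =>
    rw [mu_eq_zero m (by simp), spl_eq_zero]
    intro u v h
    by_cases hu : u.length = 1
    · have := congrArg List.length h
      rw [theta_eq_zero (w := v), map_zero]
      simp at this; omega
    · rw [theta_eq_zero hu]; simp

lemma isML_mu : IsML k (mu m) := by
  rw [funext (mu_eq_spl m)]
  exact IsML.spl (fun v => isML_theta.comp (m.flip (theta v))) fun u => isML_theta.comp (m (theta u))

section conv

variable {Y Z : Type*} [AddCommGroup Y] [Module k Y] [AddCommGroup Z] [Module k Z]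

/-- The convolution of two functions of words with respect to a bilinear map. -/
def conv (B : X →ₗ[k] Y →ₗ[k] Z) (φ : List A → X) (ψ : List A → Y) (w : List A) : Z :=
  spl (fun u v => B (φ u) (ψ v)) w

variable (B : X →ₗ[k] Y →ₗ[k] Z) {φ : List A → X} {ψ : List A → Y}

lemma IsML.conv (hφ : IsML k φ) (hψ : IsML k ψ) : IsML k (conv B φ ψ) :=
  IsML.spl (fun v => hφ.comp (B.flip (ψ v))) fun u => hψ.comp (B (φ u))

lemma HasLen.conv (hφ : HasLen φ n) (hψ : HasLen ψ r) : HasLen (conv B φ ψ) (n + r) := by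
  intro w hw
  by_contra hc
  refine hw (spl_eq_zero fun u v e => ?_)
  by_cases hu : φ u = 0
  · simp [hu]
  by_cases hv : ψ v = 0
  · simp [hv]
  rw [← hφ u hu, ← hψ v hv, ← e] at hc
  simp at hc

lemma D_conv (w : List A) : D g q (conv B φ ψ) w = conv B (D g q φ) ψ w +
    spl (fun u v => sg (q * par u) • B (φ u) (D g q ψ v)) w := by
  refine (D_spl _ w).trans (congrArg₂ (· + ·) (spl_congr fun u v _ => ?_)
    (spl_congr fun u v _ => ?_))
  · exact (map_D (B.flip (ψ v)) u).symm
  · rw [map_D (B (φ u)) v]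

end conv

lemma D_mu (hf : HasPar f p) (w : List A) : D f p (mu m) w =
    conv m f theta w + sg p • conv m theta f w := by
  have e : mu m = conv m theta theta := funext (mu_eq_spl m)
  rw [e, D_conv]
  unfold conv
  rw [smul_spl]
  refine congrArg₂ (· + ·) (spl_congr fun u v _ => by rw [D_theta]) (spl_congr fun u v _ => ?_)
  rw [D_theta, ← LinearMap.smul_apply, ← map_zsmul, sg_smul_theta u fun e => p * e, mul_one, map_zsmul,
    LinearMap.smul_apply]

variable {m}

lemma D_mu_mu (hm : ∀ a b c, m (m a b) c = m a (m b c)) (w : List A) : D (mu m) 1 (mu m) w = 0 := by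
  by_contra hc
  have := (hasLen_mu m).D (hasLen_mu m) (isML_mu m) hc
  match w, this with
  | [a, b, c], _ => exact hc (by simp [D, spl, mu, hm])

/-- The nested term vanishes by associativity, and the two `Q` terms coincide with opposite signs
because `mu` has odd parity. -/
lemma D_mu_D_mu (hm : ∀ a b c, m (m a b) c = m a (m b c)) (hχ : IsML k χ) (w : List A) :
    D (mu m) 1 (D (mu m) 1 χ) w = 0 := by
  rw [D_D hχ (hasPar_mu m), D_eq_zero_of_left hχ (D_mu_mu hm)]
  simp

end algebra

/-! ### The Hochschild coboundary -/

section bimodule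

variable {k A M : Type*} [CommRing k] [AddCommGroup A] [Module k A] [AddCommGroup M] [Module k M]

/-- An associative algebra and a bimodule over it. -/
structure IsBimod (m : A →ₗ[k] A →ₗ[k] A) (la : A →ₗ[k] M →ₗ[k] M) (ra : M →ₗ[k] A →ₗ[k] M) :
    Prop where
  assoc : ∀ a b c, m (m a b) c = m a (m b c)
  la_la : ∀ a b x, la (m a b) x = la a (la b x)
  la_ra : ∀ a x b, ra (la a x) b = la a (ra x b)
  ra_ra : ∀ x a b, ra (ra x a) b = ra x (m a b)

/-- The Hochschild coboundary on functions of words. -/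
def dl (m : A →ₗ[k] A →ₗ[k] A) (la : A →ₗ[k] M →ₗ[k] M) (ra : M →ₗ[k] A →ₗ[k] M) (φ : List A → M)
    (w : List A) : M :=
  conv la theta φ w - D (mu m) 1 φ w - conv ra (fun u => sg (par u) • φ u) theta w

variable {m : A →ₗ[k] A →ₗ[k] A} {la : A →ₗ[k] M →ₗ[k] M} {ra : M →ₗ[k] A →ₗ[k] M}
  {φ ψ : List A → M} {f g : List A → A} {p q : ZMod 2}

lemma dl_dl (h : IsBimod m la ra) (hφ : IsML k φ) (w : List A) :
    dl m la ra (dl m la ra φ) w = 0 := by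
  -- `T1`, `T3`, `T5` carry two actions (left-left, left-right, right-right), while `T2`, `T4` carry
  -- one outer action and one inner product. The three parts of the outer coboundary are all
  -- combinations of these five sums.
  set T1 := spl (fun u v => spl (fun v₁ v₂ => la (theta u) (la (theta v₁) (φ v₂))) v) w
  set T2 := spl (fun u v => la (theta u) (D (mu m) 1 φ v)) w
  set T3 := spl (fun u v => spl (fun v₁ v₂ => sg (par v₁) • la (theta u) (ra (φ v₁) (theta v₂))) v) w
  set T4 := spl (fun u v => sg (par u) • ra (D (mu m) 1 φ u) (theta v)) w
  set T5 := spl (fun u v => spl (fun v₁ v₂ => ra (ra (φ u) (theta v₁)) (theta v₂)) v) w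
  have e1 : conv la theta (dl m la ra φ) w = T1 - T2 - T3 := by
    simp only [conv, dl, map_sub, map_spl, spl_sub, map_zsmul, LinearMap.smul_apply]
    rfl
  have e2 : D (mu m) 1 (conv la theta φ) w = T1 - T2 := by
    rw [D_conv, sub_eq_add_neg]
    refine congrArg₂ (· + ·) ?_ ?_
    · rw [funext (D_theta (mu m) 1)]
      refine (spl_congr fun u v _ => ?_).trans (spl_assoc (fun _ u₁ u₂ v =>
        la (theta u₁) (la (theta u₂) (φ v))) w)
      rw [mu_eq_spl, ← LinearMap.flip_apply, map_spl]
      simp only [LinearMap.flip_apply, h.la_la]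
    · rw [← neg_one_smul ℤ, smul_spl]
      refine spl_congr fun u v _ => ?_
      rw [← LinearMap.smul_apply, ← map_zsmul, sg_smul_theta u fun e => 1 * e, map_zsmul,
        LinearMap.smul_apply]
      rfl
  have e3 : D (mu m) 1 (conv ra (fun u => sg (par u) • φ u) theta) w = -T4 + T5 := by
    rw [D_conv]
    refine congrArg₂ (· + ·) ?_ ?_
    · rw [← neg_one_smul ℤ, smul_spl]
      refine spl_congr fun u v _ => ?_
      rw [D_par_smul hφ (hasPar_mu m) sg, map_zsmul, LinearMap.smul_apply, sg_add, mul_comm, mul_smul]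
      rfl
    · refine spl_congr fun u v _ => ?_
      rw [D_theta, mu_eq_spl, map_spl, smul_spl]
      refine spl_congr fun v₁ v₂ _ => ?_
      rw [map_zsmul, LinearMap.smul_apply, one_mul, sg_sq_smul, h.ra_ra]
  have e4 : conv ra (fun u => sg (par u) • dl m la ra φ u) theta w = -T3 - T4 + T5 := by
    have : ∀ u v, ra (sg (par u) • dl m la ra φ u) (theta v) =
        sg (par u) • ra (conv la theta φ u) (theta v) - sg (par u) • ra (D (mu m) 1 φ u) (theta v)
        - sg (par u) • ra (conv ra (fun u => sg (par u) • φ u) theta u) (theta v) := by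
      intro u v
      simp only [dl, map_zsmul, map_sub, smul_sub, LinearMap.sub_apply, LinearMap.smul_apply]
    rw [conv, spl_congr fun u v _ => this u v, spl_sub, spl_sub, sub_eq_add_neg (_ - _)]
    refine congrArg₂ (· + ·) (congrArg₂ (· - ·) ?_ rfl) ?_
    · rw [← neg_one_smul ℤ, smul_spl]
      refine (spl_congr fun u v _ => ?_).trans ((spl_assoc (fun y a b c => sg (par y) •
        la (theta a) (ra (φ b) (theta c))) w).trans (spl_congr fun u v _ => ?_))
      · rw [conv, ← LinearMap.flip_apply, map_spl, smul_spl]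
        simp only [LinearMap.flip_apply, h.la_ra]
      · rw [smul_spl]
        refine spl_congr fun v₁ v₂ _ => ?_
        rw [par_append, ← LinearMap.smul_apply, ← map_zsmul, add_comm, sg_add, mul_smul,
          sg_smul_theta u fun e => e, map_zsmul, map_zsmul, LinearMap.smul_apply,
          LinearMap.smul_apply, smul_comm]
        rfl
    · rw [← neg_one_smul ℤ, smul_spl]
      refine (spl_congr fun u v _ => ?_).trans ((spl_assoc (fun y a b c => (-1 : ℤ) • sg (par y) •
        sg (par a) • ra (ra (φ a) (theta b)) (theta c)) w).trans (spl_congr fun u v _ => ?_))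
      · rw [conv, ← LinearMap.flip_apply, map_spl, smul_spl, smul_spl]
        simp only [LinearMap.flip_apply, map_zsmul, LinearMap.smul_apply]
      · refine spl_congr fun v₁ v₂ _ => ?_
        have e : sg (par v₁) • ra (ra (φ u) (theta v₁)) (theta v₂) =
            ra (ra (φ u) (sg (par v₁) • theta v₁)) (theta v₂) := by
          simp only [map_zsmul, LinearMap.smul_apply]
        rw [par_append, add_comm, sg_add, mul_smul, sg_sq_smul, e, sg_smul_theta v₁ fun e => e]
        simp
  have e5 : D (mu m) 1 (dl m la ra φ) w = T1 - T2 - 0 - (-T4 + T5) := by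
    rw [← e2, ← e3, ← D_mu_D_mu h.assoc hφ w, ← D_sub, ← D_sub]; rfl
  rw [dl, e1, e4, e5]
  abel

/-- The coboundary is a derivation with respect to the convolution product. -/
lemma dl_conv (h : IsBimod m la ra) (w : List A) :
    dl m la ra (conv la f φ) w = conv la (dl m m m f) φ w +
      conv la (fun u => sg (par u) • f u) (dl m la ra φ) w := by
  set T1 := spl (fun u v => spl (fun v₁ v₂ => la (theta u) (la (f v₁) (φ v₂))) v) w
  set T2 := spl (fun u v => la (D (mu m) 1 f u) (φ v)) w
  set T3 := spl (fun u v => sg (par u) • la (f u) (D (mu m) 1 φ v)) w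
  set T4 := spl (fun u v => spl (fun v₁ v₂ =>
    sg (par u + par v₁) • la (f u) (ra (φ v₁) (theta v₂))) v) w
  set T5 := spl (fun u v => spl (fun v₁ v₂ =>
    sg (par u) • la (f u) (la (theta v₁) (φ v₂))) v) w
  have e1 : conv la theta (conv la f φ) w = T1 := by
    simp only [conv, map_spl]
    rfl
  have e2 : D (mu m) 1 (conv la f φ) w = T2 + T3 := by
    rw [D_conv]
    simp only [one_mul]
    rfl
  have e3 : conv ra (fun u => sg (par u) • conv la f φ u) theta w = T4 := by
    refine (spl_congr fun u v _ => ?_).trans ((spl_assoc (fun y a b c => sg (par y) •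
        la (f a) (ra (φ b) (theta c))) w).trans (spl_congr fun u v _ => ?_))
    · change ra (sg (par u) • spl (fun a b => la (f a) (φ b)) u) (theta v) = _
      rw [← LinearMap.flip_apply, map_zsmul, map_spl, smul_spl]
      simp only [LinearMap.flip_apply, h.la_ra]
    · simp only [par_append]
  have e4 : conv la (dl m m m f) φ w = T1 - T2 - T5 := by
    simp only [conv, dl, map_sub, LinearMap.sub_apply, spl_sub]
    refine congrArg₂ (· - ·) (congrArg₂ (· - ·) ?_ rfl) ?_
    · refine (spl_congr fun u v _ => ?_).trans (spl_assoc (fun y a b c =>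
        la (theta a) (la (f b) (φ c))) w)
      rw [← LinearMap.flip_apply, map_spl]
      simp only [LinearMap.flip_apply, h.la_la]
    · refine (spl_congr fun u v _ => ?_).trans (spl_assoc (fun y a b c => sg (par a) •
        la (f a) (la (theta b) (φ c))) w)
      rw [← LinearMap.flip_apply, map_spl]
      simp only [LinearMap.flip_apply, h.la_la, map_zsmul, LinearMap.smul_apply]
  have e5 : conv la (fun u => sg (par u) • f u) (dl m la ra φ) w = T5 - T3 - T4 := by
    simp only [conv, dl, map_sub, spl_sub, map_spl, map_zsmul, LinearMap.smul_apply,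
      smul_smul, sg_add, T3, T4, T5, mul_comm]
  rw [dl, e1, e2, e3, e4, e5]
  abel

/-- The coboundary is, up to sign, the bracket with the product: `D f μ` supplies the two outer
products and `D μ f` the inner ones. Cocycle conditions can therefore be fed into the coderivation
calculus. -/
lemma br_mu (hf : HasPar f p) (w : List A) : br (mu m) 1 f p w = sg p • dl m m m f w := by
  have : conv m (fun u => sg (par u) • f u) theta w = -sg p • conv m f theta w := by
    unfold conv
    rw [smul_spl]
    refine spl_congr fun u v _ => ?_
    by_cases h : f u = 0
    · simp [h]
    · rw [← hf u h, sg_add]; simp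
  rw [br, D_mu m hf, dl, this, one_mul]
  simp only [smul_sub, neg_smul, smul_neg, sg_sq_smul]
  abel

lemma br_mu_eq_zero (hf : HasPar f p) (hcf : ∀ w, dl m m m f w = 0) (w : List A) :
    br (mu m) 1 f p w = 0 := by
  rw [br_mu hf, hcf, smul_zero]

lemma D_D_mu (hg : HasPar g q) (hf' : IsML k f) (hg' : IsML k g) (hcg : ∀ w, dl m m m g w = 0)
    (w : List A) : D (mu m) 1 (D g q f) w = sg q • D g q (D (mu m) 1 f) w := by
  rw [D_D_comm hf' hg (hasPar_mu m), D_eq_zero_of_left hf', zero_add, mul_one]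
  intro w
  rw [br_symm, br_mu_eq_zero hg hcg, smul_zero]

/-- The composition of two cocycles is the homotopy behind graded commutativity of the cup product.
`D g` commutes up to sign with `D μ`, and by closedness of `f` the latter can be traded for outer
products, on which `D g` acts by the coderivation rule; the excess is the two mixed products. -/
lemma dl_D (hg : HasPar g q) (hf : HasPar f p) (hf' : IsML k f) (hg' : IsML k g)
    (hcf : ∀ w, dl m m m f w = 0) (hcg : ∀ w, dl m m m g w = 0) (w : List A) :
    dl m m m (D g q f) w =
      sg (q + (q + 1) * (p + 1)) • conv m f g w - sg q • conv m g f w := by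
  have e : D (mu m) 1 f = fun w => conv m theta f w - conv m (fun u => sg (par u) • f u) theta w := by
    funext w
    have := hcf w
    rw [dl, sub_right_comm, sub_eq_zero] at this
    exact this.symm
  rw [dl, D_D_mu hg hf' hg' hcg, e, D_sub, D_conv, D_conv, funext (D_theta g q)]
  have e1 : spl (fun u v => sg (q * par u) • m (theta u) (D g q f v)) w =
      sg q • conv m theta (D g q f) w := by
    unfold conv
    rw [smul_spl]
    refine spl_congr fun u v _ => ?_
    rw [← LinearMap.smul_apply, ← map_zsmul, sg_smul_theta u fun e => q * e, mul_one, map_zsmul,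
      LinearMap.smul_apply]
  have e2 : conv m (D g q fun u => sg (par u) • f u) theta w =
      sg q • conv m (fun u => sg (par u) • D g q f u) theta w := by
    unfold conv
    rw [smul_spl]
    refine spl_congr fun u v _ => ?_
    rw [D_par_smul hf' hg sg, add_comm, sg_add, mul_smul, map_zsmul, LinearMap.smul_apply]
  have e3 : spl (fun u v => sg (q * par u) • m (sg (par u) • f u) (g v)) w =
      sg ((q + 1) * (p + 1)) • conv m f g w := by
    unfold conv
    rw [smul_spl]
    refine spl_congr fun u v _ => ?_
    by_cases h : f u = 0
    · simp [h]
    · rw [map_zsmul, LinearMap.smul_apply, smul_smul, ← sg_add]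
      exact sg_smul_congr (by rw [← hf u h]; grind) rfl
  rw [e1, e2, e3, sg_add]
  simp only [smul_sub, smul_add, sg_sq_smul, mul_smul]
  abel

/-- By `br_mu` this is the Jacobi identity for `mu`, `f`, `g`, with the term containing the bracket
of `mu` and `g` equal to zero. -/
lemma dl_br (hf : HasPar f p) (hg : HasPar g q) (hf' : IsML k f) (hg' : IsML k g)
    (hcg : ∀ w, dl m m m g w = 0) (w : List A) :
    dl m m m (br f p g q) w = sg q • br (dl m m m f) (p + 1) g q w := by
  have hμ := hasPar_mu m
  have hμ' := isML_mu m
  have e1 : D f p (mu m) = fun w => sg p • dl m m m f w + sg p • D (mu m) 1 f w := by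
    funext w
    rw [← br_mu hf, br, one_mul]; abel
  have e2 : D g q (mu m) = fun w => sg q • D (mu m) 1 g w := by
    funext w
    have := br_mu_eq_zero hg hcg w
    rwa [br, one_mul, sub_eq_zero] at this
  have e3 : D (mu m) 1 (D f p g) w = -D (dl m m m f) (p + 1) g w +
      sg p • D f p (D (mu m) 1 g) w := by
    have : br f p (mu m) 1 = fun w => (-1 : ℤ) • dl m m m f w := by
      funext w
      rw [br_symm, br_mu hf, smul_smul, one_mul, neg_mul, sg_mul_self]
    rw [D_D_comm hg' hf hμ, this, D_zsmul_left hg', mul_one, neg_one_smul]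
  have key := br_mu (m := m) (hf.br hg hf' hg') w
  rw [br, D_br hμ' hf hg, e1, e2, D_add, D_smul, D_smul, D_smul, one_mul] at key
  have e4 : D (mu m) 1 (br f p g q) w = sg q • D g q (D (mu m) 1 f) w - sg (p * q) •
      (-D (dl m m m f) (p + 1) g w + sg p • D f p (D (mu m) 1 g) w) := by
    rw [← e3, ← D_D_mu hg hf' hg' hcg, ← D_smul, ← D_sub]; rfl
  rw [e4] at key
  have key' := congrArg (fun x => sg (p + q) • x) key
  simp only [sg_sq_smul] at key'
  rw [← key', br]
  rcases zmod_two_cases p with rfl | rfl <;> rcases zmod_two_cases q with rfl | rfl <;>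
    simp [show (1 : ZMod 2) + 1 = 0 from rfl] <;> abel

end bimodule

/-! ### The Connes operator and the Hochschild differential on cyclic words -/

section cyclicMul

variable {k A X : Type*} [CommRing k] [AddCommGroup A] [Module k A] [AddCommGroup X] [Module k X]

variable {m : A →ₗ[k] A →ₗ[k] A} {e : A} {f g : List A → A} {p q : ZMod 2} {χ : List A → X}
  {φ φ' : A → List A → X}

lemma IsML₂.comp_left (hφ : IsML₂ k φ) (T : A →ₗ[k] A) : IsML₂ k fun a w => φ (T a) w where
  left u := by
    obtain ⟨S, hS⟩ := hφ.left u
    exact ⟨S ∘ₗ T, fun a => by simp [hS]⟩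
  right a := hφ.right (T a)

lemma IsML₂.cons_right (hφ : IsML₂ k φ) (e : A) : IsML₂ k fun a w => φ a (e :: w) where
  left u := hφ.left (e :: u)
  right a := (hφ.right a).cons e

/-- A product involving the zeroth letter takes as its other factor the next letter or, going round
the cycle, the last one. -/
lemma Fk_mu (hφ : IsML₂ k φ) (a : A) (w : List A) :
    Fk (cat (mu m)) φ a w = toT (fun b => φ (m a b)) w - tau (fun b => φ (m b a)) w := by
  have e1 : ∀ x u : List A, mu m (x ++ a :: u) = (if x = [] then m a (theta u) else 0) +
      (if u = [] then m (theta x) a else 0) := by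
    intro x u
    match x, u with
    | [], [] => simp [mu]
    | [], [b] => simp [mu]
    | [], _ :: _ :: _ => simp [mu]
    | [b], [] => simp [mu]
    | [b], _ :: _ => simp [mu]
    | b :: c :: x, u => simp only [List.cons_append, theta_cons_cons]; rw [mu_eq_zero]; simp; simp
  have e2 : ∀ u y x, sg (par x * (par u + 1 + par y)) • φ (cat (mu m) x a u) y =
      sg (par x * (par u + 1 + par y)) • (if x = [] then φ (m a (theta u)) y else 0) +
      sg (par x * (par u + 1 + par y)) • (if u = [] then φ (m (theta x) a) y else 0) := by
    intro u y x
    obtain ⟨T, hT⟩ := hφ.left y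
    rw [cat, e1, ← smul_add]
    congr 1
    split_ifs <;> simp [hT]
  unfold Fk
  simp only [e2, spl_add]
  rw [sub_eq_add_neg]
  refine congrArg₂ (· + ·) ?_ ?_
  · rw [← spl_theta_left (hφ.comp_left (m a))]
    refine spl_congr fun u z _ => ?_
    rw [spl_right_nil]
    · simp
    · intro _ _ _ h; simp [h]
  · have e3 := spl_theta_right (hφ.comp_left (m.flip a)) w
    simp only [LinearMap.flip_apply] at e3
    rw [← e3, spl_left_nil, ← neg_one_smul ℤ, smul_spl]
    · refine spl_congr fun y x _ => ?_
      by_cases h : x.length = 1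
      · have : par x = 1 := by simp [par, h]
        rw [smul_smul]
        change _ = (sg 1 * _) • _
        rw [← sg_add]
        simp [this]
      · simp [theta_eq_zero h, hφ.map_zero]
    · intro u z _ hu
      simp [hu, spl_zero]

lemma D_nil_eq_zero (hχ : IsML k χ) : D (mu m) 1 χ [] = 0 := by
  simp [D, spl_nil, mu, hχ.map_zero']

lemma D_cons (χ : List A → X) (a : A) (w : List A) : D g q χ (a :: w) =
    spl (fun v x => χ (g v :: x)) (a :: w) + sg q • D g q (fun w => χ (a :: w)) w := by
  unfold D
  rw [spl_cons, smul_spl]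
  simp only [par_nil, mul_zero, sg_zero, one_smul, List.nil_append, par_cons, mul_add, mul_one,
    List.cons_append]
  refine congrArg (spl _ (a :: w) + ·) ?_
  rw [smul_spl]
  refine spl_congr fun u y _ => ?_
  rw [smul_smul, ← sg_add, add_comm]

lemma D_mu_singleton (hχ : IsML k χ) (a : A) : D (mu m) 1 χ [a] = 0 := by
  rw [D_cons, D_nil_eq_zero (hχ.cons a)]
  simp [spl_cons, spl_nil, mu, hχ.map_zero']

lemma D_mu_cons_cons (hχ : IsML k χ) (a b : A) (w : List A) : D (mu m) 1 χ (a :: b :: w) =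
    χ (m a b :: w) - D (mu m) 1 (fun w => χ (a :: w)) (b :: w) := by
  rw [D_cons, spl_cons, spl_cons, spl_left_nil]
  · simp [mu, hχ.map_zero', sub_eq_add_neg]
  · intro u v _ hu
    rw [mu_eq_zero, hχ.map_zero']
    have := List.length_pos_iff.2 hu
    simp; omega

/-- The transpose of the operator `s N`. -/
def B₀ (e : A) (φ : A → List A → X) : A → List A → X := Nn (φ e)

/-- The transpose of the Connes operator `(1 - t) s N`. -/
def Bc (e : A) (φ : A → List A → X) : A → List A → X := Nn fun w => φ e w - tau φ (e :: w)

/-- The transpose of a homotopy between `(1 - t) s N` and `s N`. -/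
def Hc (e : A) (φ : A → List A → X) : A → List A → X := Nn (tau fun a w => φ a (e :: e :: w))

lemma DLast_mu (hχ : IsML k χ) (z : List A) (c l : A) :
    DLast (mu m) 1 χ (z ++ [c, l]) = sg (par z) • χ (z ++ [m c l]) := by
  unfold DLast
  induction z generalizing χ with
  | nil =>
    have := hχ.map_zero [c] []
    have h := hχ.map_zero [c, l] []
    simp only [List.cons_append, List.nil_append] at this h
    simp [spl_cons, spl_nil, mu, this, h]
  | cons b z ih =>
    have h0 : mu m (b :: (z ++ [c, l])) = 0 := by rw [mu_eq_zero]; simp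
    rw [List.cons_append, spl_cons]
    simp only [List.nil_append, List.cons_append, h0, hχ.map_zero', smul_zero, zero_add, one_mul,
      par_cons, sg_add, mul_smul] at ih ⊢
    rw [smul_comm, ← ih (hχ.cons b), smul_spl]
    exact spl_congr fun u v _ => smul_comm _ _ _

/-- In a word beginning with `e, e` the product of the two units and the product of the second unit
with its right neighbour give the same word with opposite signs, so the inner differential passes to
the rest of the word. The product of the rotated letter with the first unit leaves the term with a
single unit. -/
lemma tau_Lc_unit (hl : ∀ a, m e a = a) (hr : ∀ a, m a e = a) (hφ : IsML₂ k φ) (w : List A) :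
    tau (fun a w => Lc (mu m) 1 φ a (e :: e :: w)) w = tau (fun a w => φ a (e :: w)) w +
      D (mu m) 1 (tau fun a w => φ a (e :: e :: w)) w := by
  have h2 := (hφ.cons_right e).cons_right e
  rcases List.eq_nil_or_concat w with rfl | ⟨y, l, rfl⟩
  · rw [D_nil_eq_zero (IsML.tau h2)]; simp
  rw [List.concat_eq_append, tau_append_singleton, tau_append_singleton, D_append_singleton]
  simp only [tau_append_singleton]
  rw [D_par_smul (h2.right l) (hasPar_mu m) sg, Lc, Fk_mu hφ]
  simp only [toT, hr]
  rcases List.eq_nil_or_concat y with rfl | ⟨z, c, rfl⟩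
  · have : tau (fun b => φ (m b l)) [e, e] = sg 1 • φ (m e l) [e] :=
      tau_append_singleton (φ := fun b => φ (m b l)) [e] e
    rw [this, D_mu_cons_cons (hφ.right l), D_mu_singleton ((hφ.right l).cons e), D_nil_eq_zero
      (h2.right l), DLast]
    have h := (IsML.tau h2).map_zero [l] []
    simp only [List.cons_append, List.nil_append] at h
    simp [spl_cons, spl_nil, mu, hl, (IsML.tau h2).map_zero', h]
  · rw [List.concat_eq_append, List.append_assoc, List.singleton_append, DLast_mu (IsML.tau h2),
      tau_append_singleton]
    have e1 : tau (fun b => φ (m b l)) (e :: e :: (z ++ [c])) =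
        sg (par z) • φ (m c l) (e :: e :: z) := by
      have := tau_append_singleton (φ := fun b => φ (m b l)) (e :: e :: z) c
      simpa [add_assoc, (by decide : (1 + 1 : ZMod 2) = 0)] using this
    have e2 : ∀ x w, D (mu m) 1 (φ l) (e :: e :: x :: w) =
        D (mu m) 1 (fun w => φ l (e :: e :: w)) (x :: w) := by
      intro x w
      rw [D_mu_cons_cons (hφ.right l), D_mu_cons_cons ((hφ.right l).cons e), hl, hl]
      abel
    obtain ⟨x, y, hy⟩ := List.exists_cons_of_ne_nil (l := z ++ [c]) (by simp)
    rw [e1, hy, e2, ← hy, smul_smul]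
    simp only [sg_one, par_append, par_cons, par_nil, zero_add, sg_add]
    rcases zmod_two_cases (par z) with h | h <;> simp [h] <;> abel

lemma Nn_add {χ χ' : List A → X} : Nn (fun w => χ w + χ' w) = Nn χ + Nn χ' := nu_add

lemma Nn_zsmul (c : ℤ) : Nn (fun w => c • χ w) = c • Nn χ := nu_zsmul c

/-- On the unnormalised complex `(1 - t) s N` and `s N` differ by the transpose of `t s N`, which
`tau_Lc_unit` exhibits as the commutator of the differential with `Hc`. -/
lemma Bc_eq (hl : ∀ a, m e a = a) (hr : ∀ a, m a e = a) (hφ : IsML₂ k φ) :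
    Bc e φ = B₀ e φ + Hc e (Lc (mu m) 1 φ) - Lc (mu m) 1 (Hc e φ) := by
  have h2 := (hφ.cons_right e).cons_right e
  have e1 : Bc e φ = Nn (fun w => φ e w + tau (fun a w => φ a (e :: w)) w) := by
    funext a w
    refine spl_congr fun u v _ => congrArg _ ?_
    simp only [cat]
    have : ∀ w, w ≠ [] → tau φ (e :: w) = -tau (fun a w => φ a (e :: w)) w := by
      intro w hw
      obtain ⟨y, l, rfl⟩ := List.eq_nil_or_concat w |>.resolve_left hw
      rw [List.concat_eq_append, tau_append_singleton, ← List.cons_append, tau_append_singleton,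
        par_cons, sg_add, sg_one, mul_neg_one, neg_smul]
    rw [this _ (by simp), sub_neg_eq_add]
  rw [e1, Nn_add, Hc, funext (tau_Lc_unit hl hr hφ), Nn_add, Hc,
    Nn_D (IsML.tau h2) (hasPar_mu m)]
  simp only [B₀]
  abel

/-- The transpose of `b s = (1 - t) - s b'`, where `D μ` is the transpose of `b'`. -/
lemma Lc_unit (hl : ∀ a, m e a = a) (hr : ∀ a, m a e = a) (hφ : IsML₂ k φ) (w : List A) :
    Lc (mu m) 1 φ e w = toT φ w - tau φ w - D (mu m) 1 (φ e) w := by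
  rw [Lc, Fk_mu hφ]
  simp only [hl, hr, sg_one, neg_one_smul]
  abel

/-- The transpose of `(1 - t) N = 0`. -/
lemma Nn_toT : Nn (toT φ) = Nn (tau φ) := by
  funext a w
  unfold Nn nu cat
  rw [spl_eq_mid_right, spl_eq_mid_left]
  refine congrArg₂ (· + ·) ?_ (mid_congr fun u l v _ => ?_)
  · simp [toT, tau_append_singleton, sg_sq_smul]
  · rw [tau_append_cons_append_singleton, smul_smul, ← sg_add]
    simp only [toT, par_append, par_cons, par_nil, List.cons_append]
    exact sg_smul_congr (by grind) rfl

/-- Apply `Nn` to `Lc_unit`: the part `1 - t` is killed by `Nn_toT`, and `Nn` intertwines `D μ` with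
`Lc μ`. -/
lemma B₀_Lc (hl : ∀ a, m e a = a) (hr : ∀ a, m a e = a) (hφ : IsML₂ k φ) :
    B₀ e (Lc (mu m) 1 φ) = -Lc (mu m) 1 (B₀ e φ) := by
  have h := funext (Lc_unit hl hr hφ)
  have h1 : Nn (toT φ) = Nn (fun w => toT φ w - tau φ w - D (mu m) 1 (φ e) w) +
      Nn (fun w => tau φ w + D (mu m) 1 (φ e) w) := by
    rw [← Nn_add]
    congr 1
    funext w
    abel
  rw [Nn_add, ← Nn_toT, Nn_D (hφ.right e) (hasPar_mu m)] at h1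
  rw [B₀, h, B₀, eq_neg_iff_add_eq_zero]
  rw [← add_assoc, add_right_comm] at h1
  exact add_eq_right.1 h1.symm

/-- One slot of the product is taken by the marked letter and the other by the value of `g`, so no
letter to the left of the mark can take part. The operation is the contraction by `g`. -/
lemma Fk_Dr_mu (hφ : IsML₂ k φ) (a : A) (w : List A) :
    Fk (Dr g q (cat (mu m))) φ a w = sg q • spl (fun u y => φ (m a (g u)) y) w := by
  have e1 : ∀ x u, Dr g q (cat (mu m)) x a u = if x = [] then sg q • m a (g u) else 0 := by
    intro x u
    unfold Dr
    split_ifs with hx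
    · have : ∀ u, cat (mu m) x a u = m a (theta u) := by
        rintro (_ | ⟨b, _ | ⟨c, u⟩⟩) <;> simp [cat, mu, hx]
      rw [funext this, ← map_D (m a), D_theta, hx, par_nil, zero_add, mul_one]
    · unfold D
      rw [spl_eq_zero, smul_zero]
      intro u w _
      rw [spl_eq_zero, smul_zero]
      intro v y _
      have := List.length_pos_iff.2 hx
      rw [cat, mu_eq_zero]
      simp
      omega
  unfold Fk
  rw [smul_spl]
  refine spl_congr fun u z _ => ?_
  rw [spl_right_nil]
  · obtain ⟨T, hT⟩ := hφ.left z
    simp [e1, hT]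
  · intro y x _ hx
    simp [e1, hx, hφ.map_zero]

/-- The homotopy between the commutator of `s N` with the contraction by `f` and the Lie
derivative. -/
lemma Fk_B₀ (hl : ∀ a, m e a = a) (hr : ∀ a, m a e = a) (hφ : IsML₂ k φ)
    (hf : HasPar f p) (hf' : IsML k f) (hcf : ∀ w, br (mu m) 1 f p w = 0) :
    Fk (Dr f p (cat (mu m))) (B₀ e φ) + sg p • B₀ e (Fk (Dr f p (cat (mu m))) φ) =
      Lc f p φ - Pk f p (Lc (mu m) 1 φ e) - sg p • Lc (mu m) 1 (Pk f p (φ e)) := by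
  -- With the unit as zeroth letter, the contraction `m e (f u)` is just `f u`; this is where
  -- `front` comes from.
  have h1 : B₀ e (Fk (Dr f p (cat (mu m))) φ) = sg p • Nn (front f φ) := by
    rw [B₀, ← Nn_zsmul]
    congr 1
    funext w
    rw [Fk_Dr_mu hφ]
    simp only [hl]
    rfl
  have h2 := Pk_D (hφ.right e) (hasPar_mu m) (isML_mu m) hf hf' hcf
  have h3 : Pk f p (fun w => toT φ w - tau φ w) + Nn (front f φ) = Lc f p φ := by
    funext a w; exact Pk_toT_sub_tau hφ hf a w
  have h4 : Pk f p (Lc (mu m) 1 φ e) = Pk f p (fun w => toT φ w - tau φ w) -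
      Pk f p (D (mu m) 1 (φ e)) := by
    rw [funext (Lc_unit hl hr hφ)]
    funext a w
    have e : ∀ χ : List A → X, Pk f p χ a w = spl (fun z v => sg (par v * (par z + 1)) •
      sg (p * (par v + 1)) • D f p (fun u => χ (v ++ a :: u)) z) w := fun _ => rfl
    simp only [e, D_sub, smul_sub, spl_sub, Pi.sub_apply]
  rw [h1, sg_sq_smul, ← h3, h4, h2, B₀]
  abel

/-- A cochain with values in the dual, as a function of cyclic words. -/
def cy (φ : List A → Module.Dual k A) (a : A) (w : List A) : k := φ w a

lemma IsML₂.cy {φ : List A → Module.Dual k A} (hφ : IsML k φ) : IsML₂ k (cy φ) where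
  left u := ⟨φ u, fun _ => rfl⟩
  right a := hφ.comp (LinearMap.applyₗ a)

variable {la : A →ₗ[k] Module.Dual k A →ₗ[k] Module.Dual k A}
  {ra : Module.Dual k A →ₗ[k] A →ₗ[k] Module.Dual k A}

lemma spl_apply (F : List A → List A → Module.Dual k A) (w : List A) (a : A) :
    spl F w a = spl (fun u v => F u v a) w :=
  map_spl (LinearMap.applyₗ a : Module.Dual k A →ₗ[k] k) F w

/-- The actions on the dual are products in the argument of the functional, so the two outer terms
of the coboundary become the two cyclic products of `Fk_mu`. -/
lemma cy_dl (hla : ∀ a θ b, la a θ b = θ (m b a)) (hra : ∀ θ a b, ra θ a b = θ (m a b))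
    {φ : List A → Module.Dual k A} (hφ : IsML k φ) : cy (dl m la ra φ) = Lc (mu m) 1 (cy φ) := by
  funext a w
  have h := IsML₂.cy hφ
  have e1 := spl_theta_left (h.comp_left (m a)) w
  rw [Lc, Fk_mu h, ← e1, ← spl_theta_right (φ := fun b => cy φ (m b a)) (h.comp_left (m.flip a))]
  have e3 : D (mu m) 1 (cy φ a) w = D (mu m) 1 φ w a :=
    (map_D (LinearMap.applyₗ a : Module.Dual k A →ₗ[k] k) w).symm
  rw [e3]
  simp only [cy, dl, conv, LinearMap.sub_apply, spl_apply, hla, hra, sg_one, neg_one_smul,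
    map_zsmul, LinearMap.smul_apply]
  abel

lemma Fk_Dr_mu_cy (hla : ∀ a θ b, la a θ b = θ (m b a))
    {φ : List A → Module.Dual k A} (hφ : IsML k φ) :
    Fk (Dr g q (cat (mu m))) (cy φ) = sg q • cy (conv la g φ) := by
  funext a w
  rw [Fk_Dr_mu (IsML₂.cy hφ)]
  simp only [Pi.smul_apply, cy, conv, spl_apply, hla]

end cyclicMul

/-! ### Equivariance -/

section equivariant

variable {k A M N P : Type*} [CommRing k] [AddCommGroup A] [Module k A]
  [AddCommGroup M] [Module k M] [AddCommGroup N] [Module k N] [AddCommGroup P] [Module k P]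

/-- Functions of words that are linear in each letter and equivariant. -/
structure Nice (α : A →ₗ[k] A) (β : M →ₗ[k] M) (φ : List A → M) : Prop where
  ml : IsML k φ
  eqv : ∀ w, φ (w.map α) = β (φ w)

/-- Functions of a letter and a word that are linear in each letter and invariant. -/
structure Nice₂ (α : A →ₗ[k] A) (φ : A → List A → M) : Prop where
  ml : IsML₂ k φ
  inv : ∀ a w, φ (α a) (w.map α) = φ a w

variable {α : A →ₗ[k] A} {β : M →ₗ[k] M} {γ : N →ₗ[k] N} {ε : P →ₗ[k] P} {φ ψ : List A → M}
  {f g : List A → A} {p q : ZMod 2}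

lemma Nice.zero : Nice α β (0 : List A → M) := ⟨IsML.zero, fun w => by simp⟩

lemma Nice.add (hφ : Nice α β φ) (hψ : Nice α β ψ) : Nice α β (φ + ψ) :=
  ⟨hφ.ml.add hψ.ml, fun w => by simp [hφ.eqv, hψ.eqv]⟩

lemma Nice.zsmul (hφ : Nice α β φ) (c : ℤ) : Nice α β (c • φ) :=
  ⟨hφ.ml.zsmul c, fun w => by simp [hφ.eqv]⟩

lemma Nice.neg (hφ : Nice α β φ) : Nice α β (-φ) := by
  simpa using hφ.zsmul (-1)

lemma Nice.sub (hφ : Nice α β φ) (hψ : Nice α β ψ) : Nice α β (φ - ψ) := by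
  rw [sub_eq_add_neg]; exact hφ.add hψ.neg

lemma Nice.par_smul (hφ : Nice α β φ) (c : ZMod 2 → ℤ) : Nice α β fun w => c (par w) • φ w :=
  ⟨hφ.ml.par_smul c, fun w => by simp [hφ.eqv]⟩

lemma Nice.conv {B : M →ₗ[k] N →ₗ[k] P} (hB : ∀ x y, B (β x) (γ y) = ε (B x y)) {ψ : List A → N}
    (hφ : Nice α β φ) (hψ : Nice α γ ψ) : Nice α ε (conv B φ ψ) where
  ml := hφ.ml.conv B hψ.ml
  eqv w := by
    unfold HochschildWords.conv
    rw [spl_map, map_spl]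
    simp only [hφ.eqv, hψ.eqv, hB]

lemma D_map (hg : ∀ w, g (w.map α) = α (g w)) (φ : List A → M) (w : List A) :
    D g q φ (w.map α) = D g q (fun w => φ (w.map α)) w := by
  unfold D
  simp only [spl_map, hg, List.map_append, List.map_cons, par_map]

lemma Nice.D (hg : Nice α α g) (hφ : Nice α β φ) : Nice α β (D g q φ) where
  ml := hg.ml.D hφ.ml
  eqv w := by rw [D_map hg.eqv, funext hφ.eqv, map_D]

lemma Nice.br (hf : Nice α α f) (hg : Nice α α g) : Nice α α (br f p g q) :=
  (hg.D hf).sub ((hf.D hg).zsmul _)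

lemma Nice.theta : Nice α α (theta : List A → A) where
  ml := isML_theta
  eqv w := by match w with
    | [] => simp
    | [a] => simp
    | a :: b :: w => simp

variable {m : A →ₗ[k] A →ₗ[k] A} {la : A →ₗ[k] M →ₗ[k] M} {ra : M →ₗ[k] A →ₗ[k] M}

lemma Nice.mu (hm : ∀ a b, m (α a) (α b) = α (m a b)) : Nice α α (mu m) := by
  rw [funext (mu_eq_spl m)]
  exact Nice.conv hm .theta .theta

lemma Nice.dl (hm : ∀ a b, m (α a) (α b) = α (m a b)) (hla : ∀ a x, la (α a) (β x) = β (la a x))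
    (hra : ∀ x a, ra (β x) (α a) = β (ra x a)) (hφ : Nice α β φ) : Nice α β (dl m la ra φ) :=
  ((Nice.conv hla .theta hφ).sub ((Nice.mu hm).D hφ)).sub
    (Nice.conv hra (hφ.par_smul sg) .theta)

lemma conv_add_right (B : M →ₗ[k] N →ₗ[k] P) (φ : List A → M) (ψ ψ' : List A → N) :
    conv B φ (ψ + ψ') = conv B φ ψ + conv B φ ψ' := by
  funext w
  simp only [conv, Pi.add_apply, map_add, spl_add]

lemma conv_zsmul_right (B : M →ₗ[k] N →ₗ[k] P) (c : ℤ) (φ : List A → M) (ψ : List A → N) :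
    conv B φ (c • ψ) = c • conv B φ ψ := by
  funext w
  simp only [conv, Pi.smul_apply, map_zsmul, smul_spl]

lemma conv_add_left (B : M →ₗ[k] N →ₗ[k] P) (φ φ' : List A → M) (ψ : List A → N) :
    conv B (φ + φ') ψ = conv B φ ψ + conv B φ' ψ := by
  funext w
  simp only [conv, Pi.add_apply, map_add, LinearMap.add_apply, spl_add]

lemma conv_zsmul_left (B : M →ₗ[k] N →ₗ[k] P) (c : ℤ) (φ : List A → M) (ψ : List A → N) :
    conv B (c • φ) ψ = c • conv B φ ψ := by
  funext w
  simp only [conv, Pi.smul_apply, map_zsmul, LinearMap.smul_apply, smul_spl]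

lemma conv_zero_right (B : M →ₗ[k] N →ₗ[k] P) (φ : List A → M) :
    conv B φ (0 : List A → N) = 0 := by
  simpa using conv_zsmul_right B 0 φ 0

lemma conv_zero_left (B : M →ₗ[k] N →ₗ[k] P) (ψ : List A → N) :
    conv B (0 : List A → M) ψ = 0 := by
  simpa using conv_zsmul_left B 0 0 ψ

lemma dl_add (φ ψ : List A → M) : dl m la ra (φ + ψ) = dl m la ra φ + dl m la ra ψ := by
  have e : (fun u => sg (par u) • (φ + ψ) u) =
      (fun u => sg (par u) • φ u) + fun u => sg (par u) • ψ u := by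
    funext u; simp
  have e' : D (HochschildWords.mu m) 1 (φ + ψ) = D (HochschildWords.mu m) 1 φ + D (HochschildWords.mu m) 1 ψ := by
    funext w; exact D_add w
  funext w
  rw [HochschildWords.dl, e, e', conv_add_right, conv_add_left]
  simp only [HochschildWords.dl, Pi.add_apply]
  abel

lemma dl_zsmul (c : ℤ) (φ : List A → M) : dl m la ra (c • φ) = c • dl m la ra φ := by
  have e : (fun u => sg (par u) • (c • φ) u) = c • fun u => sg (par u) • φ u := by
    funext u; simp [smul_comm c]
  have e' : D (HochschildWords.mu m) 1 (c • φ) = c • D (HochschildWords.mu m) 1 φ := by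
    funext w; exact D_smul c w
  funext w
  rw [HochschildWords.dl, e, e', conv_zsmul_right, conv_zsmul_left]
  simp only [HochschildWords.dl, Pi.smul_apply, smul_sub]

section cyclic

variable {φ φ' : A → List A → M} {χ : List A → M} {ψ : List A → A → List A → M}
  {h : List A → A → List A → A}

lemma spl_map_eq {F : List A → List A → M} {G : List A → List A → M} (w : List A)
    (h : ∀ u v, F (u.map α) (v.map α) = G u v) : spl F (w.map α) = spl G w := by
  rw [spl_map]; simp only [h]

lemma nu_map (a : A) (w : List A) : nu ψ (α a) (w.map α) =
    nu (fun x a u => ψ (x.map α) (α a) (u.map α)) a w :=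
  spl_map_eq w fun u v => by simp only [par_map]

lemma Fk_map (hh : ∀ x a u, h (x.map α) (α a) (u.map α) = α (h x a u)) (a : A) (w : List A) :
    Fk h φ (α a) (w.map α) = Fk h (fun a w => φ (α a) (w.map α)) a w :=
  spl_map_eq w fun u v => spl_map_eq v fun y x => by simp only [par_map, hh]

lemma Dr_map (hg : ∀ w, g (w.map α) = α (g w)) (x : List A) (a : A) (u : List A) :
    Dr g q ψ (x.map α) (α a) (u.map α) = Dr g q (fun x a u => ψ (x.map α) (α a) (u.map α)) x a u := by
  unfold Dr
  rw [D_map hg, par_map]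

lemma Nice₂.zsmul (hφ : Nice₂ α φ) (c : ℤ) : Nice₂ α (c • φ) :=
  ⟨hφ.ml.zsmul c, fun a w => by simp [hφ.inv]⟩

/-- The contraction (`f = μ`) and the Cartan homotopy both have this shape, so both stay inside the
equivariant complex. -/
lemma Nice₂.Fk_Dr_cat (hf : Nice α α f) (hg : Nice α α g) (hφ : Nice₂ α φ) :
    Nice₂ α (Fk (Dr g q (cat f)) φ) where
  ml := hφ.ml.Fk (hf.ml.cat.Dr hg.ml)
  inv a w := by
    rw [Fk_map]
    · simp only [hφ.inv]
    · intro x a u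
      rw [Dr_map hg.eqv]
      have : (fun x a u => cat f (List.map α x) (α a) (List.map α u)) =
          fun x a u => α (cat f x a u) := by
        funext x a u
        simp only [cat, ← hf.eqv, List.map_append, List.map_cons]
      rw [this, Dr, Dr, map_zsmul, map_D]

lemma Nice₂.Lc (hg : Nice α α g) (hφ : Nice₂ α φ) : Nice₂ α (Lc g q φ) where
  ml := hφ.ml.Lc hg.ml
  inv a w := by
    rw [HochschildWords.Lc, D_map hg.eqv, Fk_map]
    · simp only [hφ.inv]; rfl
    · intro x a u
      simp only [cat, ← hg.eqv, List.map_append, List.map_cons]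

lemma Nice₂.Nn (hχ : IsML k χ) (hχ' : ∀ w, χ (w.map α) = χ w) : Nice₂ α (Nn χ) where
  ml := IsML₂.nu hχ.cat
  inv a w := by
    rw [HochschildWords.Nn, nu_map]
    simp only [cat, ← List.map_append, ← List.map_cons, hχ']
    rfl

lemma Nice₂.Pk (hf : Nice α α f) (hχ : IsML k χ) (hχ' : ∀ w, χ (w.map α) = χ w) :
    Nice₂ α (Pk f p χ) where
  ml := IsML₂.nu (hχ.cat.Dr hf.ml)
  inv a w := by
    rw [HochschildWords.Pk, nu_map]
    simp only [Dr_map hf.eqv]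
    simp only [cat, ← List.map_append, ← List.map_cons, hχ']
    rfl

lemma tau_map (w : List A) : tau φ (w.map α) = tau (fun a w => φ (α a) (w.map α)) w := by
  rcases List.eq_nil_or_concat w with rfl | ⟨y, l, rfl⟩
  · rfl
  · rw [List.concat_eq_append, List.map_append, List.map_singleton, tau_append_singleton,
      tau_append_singleton, par_map]

variable {e : A}

lemma Nice₂.Hc (he : α e = e) (hφ : Nice₂ α φ) : Nice₂ α (Hc e φ) := by
  refine Nice₂.Nn (IsML.tau ((hφ.ml.cons_right e).cons_right e)) fun w => ?_
  have h := fun a w => hφ.inv a (e :: e :: w)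
  simp only [List.map_cons, he] at h
  simp only [tau_map, h]

lemma Nice₂.right (he : α e = e) (hφ : Nice₂ α φ) (w : List A) : φ e (w.map α) = φ e w := by
  have := hφ.inv e w
  rwa [he] at this

lemma Nice₂.B₀ (he : α e = e) (hφ : Nice₂ α φ) : Nice₂ α (B₀ e φ) :=
  Nice₂.Nn (hφ.ml.right e) (hφ.right he)

lemma Nice₂.Bc (he : α e = e) (hφ : Nice₂ α φ) : Nice₂ α (Bc e φ) := by
  refine Nice₂.Nn ((hφ.ml.right e).sub ((IsML.tau hφ.ml).cons e)) fun w => ?_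
  have := tau_map (α := α) (φ := φ) (e :: w)
  simp only [List.map_cons, he, hφ.inv] at this
  rw [hφ.right he, this]

end cyclic

end equivariant

/-! ### Equivariant cochains up to coboundaries -/

section homologous

variable {k A M : Type*} [CommRing k] [AddCommGroup A] [Module k A] [AddCommGroup M] [Module k M]

/-- A unital associative algebra with a bimodule, and compatible endomorphisms of both. -/
structure IsEquivBimod (m : A →ₗ[k] A →ₗ[k] A) (e : A) (α : A →ₗ[k] A)
    (la : A →ₗ[k] M →ₗ[k] M) (ra : M →ₗ[k] A →ₗ[k] M) (β : M →ₗ[k] M) : Prop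
    extends IsBimod m la ra where
  one_mul : ∀ a, m e a = a
  mul_one : ∀ a, m a e = a
  map_mul : ∀ a b, m (α a) (α b) = α (m a b)
  map_one : α e = e
  map_la : ∀ a x, la (α a) (β x) = β (la a x)
  map_ra : ∀ x a, ra (β x) (α a) = β (ra x a)

/-- The cochains `φ` and `ψ` differ by the coboundary of an equivariant cochain. -/
def Homologous (m : A →ₗ[k] A →ₗ[k] A) (α : A →ₗ[k] A) (la : A →ₗ[k] M →ₗ[k] M)
    (ra : M →ₗ[k] A →ₗ[k] M) (β : M →ₗ[k] M) (φ ψ : List A → M) : Prop :=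
  ∃ η, Nice α β η ∧ φ = ψ + dl m la ra η

variable {m : A →ₗ[k] A →ₗ[k] A} {e : A} {α : A →ₗ[k] A} {la : A →ₗ[k] M →ₗ[k] M}
  {ra : M →ₗ[k] A →ₗ[k] M} {β : M →ₗ[k] M} {φ φ' ψ ψ' χ : List A → M}

lemma dl_zero : dl m la ra (0 : List A → M) = 0 := by
  simpa using dl_zsmul (m := m) (la := la) (ra := ra) 0 0

lemma Homologous.refl (φ : List A → M) : Homologous m α la ra β φ φ := ⟨0, .zero, by simp [dl_zero]⟩

lemma Homologous.of_eq (h : φ = ψ) : Homologous m α la ra β φ ψ := h ▸ .refl φ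

lemma Homologous.trans (h : Homologous m α la ra β φ ψ) (h' : Homologous m α la ra β ψ χ) :
    Homologous m α la ra β φ χ := by
  obtain ⟨η, hη, rfl⟩ := h
  obtain ⟨η', hη', rfl⟩ := h'
  exact ⟨η' + η, hη'.add hη, by rw [dl_add, add_assoc]⟩

lemma Homologous.add (h : Homologous m α la ra β φ ψ) (h' : Homologous m α la ra β φ' ψ') :
    Homologous m α la ra β (φ + φ') (ψ + ψ') := by
  obtain ⟨η, hη, rfl⟩ := h
  obtain ⟨η', hη', rfl⟩ := h'
  exact ⟨η + η', hη.add hη', by rw [dl_add]; abel⟩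

lemma Homologous.zsmul (h : Homologous m α la ra β φ ψ) (c : ℤ) :
    Homologous m α la ra β (c • φ) (c • ψ) := by
  obtain ⟨η, hη, rfl⟩ := h
  exact ⟨c • η, hη.zsmul c, by rw [dl_zsmul, smul_add]⟩

lemma Homologous.symm (h : Homologous m α la ra β φ ψ) : Homologous m α la ra β ψ φ := by
  obtain ⟨η, hη, rfl⟩ := h
  exact ⟨-η, hη.neg, by rw [← neg_one_smul ℤ η, dl_zsmul]; simp⟩

lemma dl_conv' (h : IsBimod m la ra) (f : List A → A) (φ : List A → M) :
    dl m la ra (conv la f φ) = conv la (dl m m m f) φ +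
      conv la (fun u => sg (par u) • f u) (dl m la ra φ) := funext (dl_conv h)

variable {f g : List A → A} {p q : ZMod 2}

lemma sg_par_smul (hf : HasPar f p) : (fun u => sg (par u) • f u) = -sg p • f := by
  funext u
  by_cases h : f u = 0
  · simp [h]
  · rw [← hf u h, sg_add]
    simp

lemma Homologous.conv (hE : IsEquivBimod m e α la ra β) (hf : HasPar f p) (hf' : Nice α α f)
    (hcf : dl m m m f = 0) (h : Homologous m α la ra β φ ψ) :
    Homologous m α la ra β (conv la f φ) (conv la f ψ) := by
  obtain ⟨η, hη, rfl⟩ := h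
  -- On the support of `f` the sign `sg (par u)` in the derivation rule equals `-sg p`; the same
  -- factor in the primitive compensates it.
  refine ⟨-sg p • HochschildWords.conv la f η, (hf'.conv hE.map_la hη).zsmul _, ?_⟩
  rw [dl_zsmul, dl_conv' hE.toIsBimod, hcf, sg_par_smul hf, conv_add_right, conv_zsmul_left, conv_zero_left,
    zero_add, smul_smul]
  simp [sg_mul_self]

lemma dl_conv_eq_zero (h : IsBimod m la ra) (hcf : dl m m m f = 0) (hφ : dl m la ra φ = 0) :
    dl m la ra (conv la f φ) = 0 := by
  rw [dl_conv' h, hcf, hφ, conv_zero_left, conv_zero_right, zero_add]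

lemma br_zero_left (hg : IsML k g) : br (0 : List A → A) p g q = 0 := by
  funext w
  rw [br]
  simp [D, spl_zero, hg.map_zero]

lemma dl_br_eq_zero (hf : HasPar f p) (hg : HasPar g q) (hf' : IsML k f) (hg' : IsML k g)
    (hcf : dl m m m f = 0) (hcg : dl m m m g = 0) : dl m m m (br f p g q) = 0 := by
  funext w
  rw [dl_br hf hg hf' hg' (congrFun hcg), hcf, br_zero_left hg', Pi.zero_apply, smul_zero]

end homologous

/-! ### Cartan calculus on cochains with values in the dual -/

section dual

variable {k A : Type*} [CommRing k] [AddCommGroup A] [Module k A]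

open Classical in
/-- The inverse of `cy`. -/
noncomputable def uncy (φ : A → List A → k) (w : List A) : Module.Dual k A :=
  if h : ∃ T : Module.Dual k A, ∀ a, φ a w = T a then h.choose else 0

lemma cy_uncy {φ : A → List A → k} (hφ : IsML₂ k φ) : cy (uncy φ) = φ := by
  funext a w
  have h := hφ.left w
  rw [cy, uncy, dif_pos h]
  exact (h.choose_spec a).symm

lemma cy_injective : Function.Injective (cy : (List A → Module.Dual k A) → A → List A → k) :=
  fun φ ψ h => funext fun w => LinearMap.ext fun a => congrFun (congrFun h a) w

variable {m : A →ₗ[k] A →ₗ[k] A} {e : A} {α : A →ₗ[k] A} {la : A →ₗ[k] Module.Dual k A →ₗ[k] Module.Dual k A}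
  {ra : Module.Dual k A →ₗ[k] A →ₗ[k] Module.Dual k A} {β : Module.Dual k A →ₗ[k] Module.Dual k A}
  {φ φ' ψ : List A → Module.Dual k A} {f g : List A → A} {p q : ZMod 2}

/-- A unital associative algebra with an endomorphism, together with the dual bimodule. -/
structure IsDualBimod (m : A →ₗ[k] A →ₗ[k] A) (e : A) (α : A →ₗ[k] A)
    (la : A →ₗ[k] Module.Dual k A →ₗ[k] Module.Dual k A)
    (ra : Module.Dual k A →ₗ[k] A →ₗ[k] Module.Dual k A)
    (β : Module.Dual k A →ₗ[k] Module.Dual k A) : Prop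
    extends IsEquivBimod m e α la ra β where
  la_apply : ∀ a θ b, la a θ b = θ (m b a)
  ra_apply : ∀ θ a b, ra θ a b = θ (m a b)
  β_apply : ∀ θ a, β θ (α a) = θ a
  surj : Function.Surjective α

lemma Nice.cy (h : IsDualBimod m e α la ra β) (hφ : Nice α β φ) : Nice₂ α (cy φ) :=
  ⟨IsML₂.cy hφ.ml, fun a w => by rw [HochschildWords.cy, hφ.eqv, h.β_apply]; rfl⟩

lemma Nice.uncy (h : IsDualBimod m e α la ra β) {φ : A → List A → k} (hφ : Nice₂ α φ) :
    Nice α β (uncy φ) where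
  ml u v := by
    have h := fun x a => congrFun (congrFun (cy_uncy hφ.ml) a) (u ++ x :: v)
    simp only [HochschildWords.cy] at h
    refine ⟨⟨⟨fun x => HochschildWords.uncy φ (u ++ x :: v), fun x y => ?_⟩, fun c x => ?_⟩, fun x => rfl⟩
    · ext a
      obtain ⟨T, hT⟩ := hφ.ml.right a u v
      simp [h, hT]
    · ext a
      obtain ⟨T, hT⟩ := hφ.ml.right a u v
      simp [h, hT]
  eqv w := by
    ext a
    -- `β_apply` evaluates `β θ` only on the image of `α`.
    obtain ⟨a, rfl⟩ := h.surj a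
    rw [h.β_apply]
    have h' := fun a w => congrFun (congrFun (cy_uncy hφ.ml) a) w
    simp only [HochschildWords.cy] at h'
    rw [h', h', hφ.inv]

/-- The transpose of the Connes operator, on cochains with values in the dual. -/
noncomputable def connes (e : A) (φ : List A → Module.Dual k A) : List A → Module.Dual k A :=
  uncy (Bc e (cy φ))

lemma cy_add (φ ψ : List A → Module.Dual k A) : cy (φ + ψ) = cy φ + cy ψ := rfl
lemma cy_zsmul (c : ℤ) (φ : List A → Module.Dual k A) : cy (c • φ) = c • cy φ := by
  funext a w; simp [cy]

/-- The homotopies live on cyclic words. They return through `uncy`, since `cy` is injective and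
turns `dl` into `Lc μ`. -/
lemma Homologous.of_cy (h : IsDualBimod m e α la ra β) {η : A → List A → k} (hη : Nice₂ α η)
    (hφ : cy φ = cy ψ + Lc (mu m) 1 η) : Homologous m α la ra β φ ψ := by
  refine ⟨HochschildWords.uncy η, .uncy h hη, cy_injective ?_⟩
  rw [cy_add, cy_dl h.la_apply h.ra_apply (Nice.uncy h hη).ml, cy_uncy hη.ml, hφ]

lemma Nice.connes (h : IsDualBimod m e α la ra β) (hφ : Nice α β φ) : Nice α β (connes e φ) :=
  .uncy h ((hφ.cy h).Bc h.map_one)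

lemma cy_connes (h : IsDualBimod m e α la ra β) (hφ : Nice α β φ) :
    cy (connes e φ) = Bc e (cy φ) := cy_uncy ((hφ.cy h).Bc h.map_one).ml

lemma dl_eq_zero_iff (h : IsDualBimod m e α la ra β) (hφ : Nice α β φ) :
    dl m la ra φ = 0 ↔ Lc (mu m) 1 (cy φ) = 0 := by
  rw [← cy_dl h.la_apply h.ra_apply hφ.ml]
  exact ⟨fun h => by rw [h]; rfl, fun h => cy_injective (by rw [h]; rfl)⟩

lemma Lc_Lc_mu (h : IsDualBimod m e α la ra β) {η : A → List A → k} (hη : Nice₂ α η) :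
    Lc (mu m) 1 (Lc (mu m) 1 η) = 0 := by
  have hη' := Nice.uncy h hη
  have h2 := hη'.dl h.map_mul h.map_la h.map_ra
  rw [← cy_uncy hη.ml, ← cy_dl h.la_apply h.ra_apply hη'.ml, ← dl_eq_zero_iff h h2]
  exact funext (dl_dl h.toIsBimod hη'.ml)

lemma Lc_add {φ ψ : A → List A → k} (hφ : IsML₂ k φ) (hψ : IsML₂ k ψ) :
    Lc f p (φ + ψ) = Lc f p φ + Lc f p ψ := by
  funext a w
  simp only [Lc, Pi.add_apply, Fk]
  have : D f p (φ a + ψ a) w = D f p (φ a) w + D f p (ψ a) w := D_add w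
  simp only [this, smul_add, spl_add]
  abel

lemma Lc_zsmul (c : ℤ) (φ : A → List A → k) : Lc f p (c • φ) = c • Lc f p φ := by
  funext a w
  have : D f p (c • φ a) w = c • D f p (φ a) w := D_smul c w
  simp only [Lc, Pi.smul_apply, Fk, smul_add, smul_spl]
  rw [this, smul_comm c]
  refine congrArg (_ + ·) (spl_congr fun u z _ => spl_congr fun y x _ => ?_)
  rw [smul_comm c]

lemma Hc_zero : Hc e (0 : A → List A → k) = 0 := by
  have : tau (fun (a : A) (w : List A) => (0 : A → List A → k) a (e :: e :: w)) = fun _ => 0 := by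
    funext w
    rcases List.eq_nil_or_concat w with rfl | ⟨y, l, rfl⟩
    · rfl
    · rw [List.concat_eq_append, tau_append_singleton]; simp
  rw [Hc, this]
  funext a w
  simp [Nn, nu, cat, spl_zero]

/-- No rotation needs to be computed: `Bc_eq` is used for both `η` and `Lc μ η`, and then `B₀_Lc`
and `Lc μ ∘ Lc μ = 0` finish. -/
lemma Bc_Lc (h : IsDualBimod m e α la ra β) {η : A → List A → k} (hη : Nice₂ α η) :
    Bc e (Lc (mu m) 1 η) = -Lc (mu m) 1 (Bc e η) := by
  have hL : Nice₂ α (Lc (mu m) 1 η) := hη.Lc (.mu h.map_mul)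
  have h1 := Bc_eq h.one_mul h.mul_one hη.ml
  have h2 := Bc_eq h.one_mul h.mul_one hL.ml
  have h3 : B₀ e η + Hc e (Lc (mu m) 1 η) = Bc e η + Lc (mu m) 1 (Hc e η) := by rw [h1]; abel
  have h4 := congrArg (Lc (mu m) 1) h3
  rw [Lc_add (hη.B₀ h.map_one).ml (hL.Hc h.map_one).ml, Lc_add (hη.Bc h.map_one).ml
    ((hη.Hc h.map_one).Lc (.mu h.map_mul)).ml, Lc_Lc_mu h (hη.Hc h.map_one), add_zero] at h4
  rw [h2, Lc_Lc_mu h hη, Hc_zero, B₀_Lc h.one_mul h.mul_one hη.ml, ← h4]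
  abel

lemma connes_dl (h : IsDualBimod m e α la ra β) (hφ : Nice α β φ) :
    connes e (dl m la ra φ) = -dl m la ra (connes e φ) := by
  apply cy_injective
  rw [cy_connes h (hφ.dl h.map_mul h.map_la h.map_ra), cy_dl h.la_apply h.ra_apply hφ.ml,
    Bc_Lc h (hφ.cy h), ← neg_one_smul ℤ (dl m la ra _), cy_zsmul,
    cy_dl h.la_apply h.ra_apply (hφ.connes h).ml, cy_connes h hφ, neg_one_smul]

lemma connes_zero (h : IsDualBimod m e α la ra β) : connes e (0 : List A → Module.Dual k A) = 0 := by
  apply cy_injective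
  rw [cy_connes h .zero]
  have h0 : tau (cy (0 : List A → Module.Dual k A)) = fun _ => 0 := by
    funext w
    rcases List.eq_nil_or_concat w with rfl | ⟨y, l, rfl⟩
    · rfl
    · rw [List.concat_eq_append, tau_append_singleton]; simp [cy]
  funext a w
  simp [Bc, h0, Nn, nu, cat, cy, spl_zero]

lemma dl_connes (h : IsDualBimod m e α la ra β) (hφ : Nice α β φ) (hc : dl m la ra φ = 0) :
    dl m la ra (connes e φ) = 0 := by
  have := connes_dl h hφ
  rw [hc, connes_zero h] at this
  exact neg_eq_zero.1 this.symm

/-- The transpose of `s N` on cochains with values in the dual. -/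
noncomputable def connes₀ (e : A) (φ : List A → Module.Dual k A) : List A → Module.Dual k A :=
  uncy (B₀ e (cy φ))

lemma connes₀_homologous (h : IsDualBimod m e α la ra β) (hφ : Nice α β φ)
    (hc : dl m la ra φ = 0) : Homologous m α la ra β (connes₀ e φ) (connes e φ) := by
  have h1 := hφ.cy h
  refine .of_cy h (h1.Hc h.map_one) ?_
  rw [cy_connes h hφ, connes₀, cy_uncy (h1.B₀ h.map_one).ml, Bc_eq h.one_mul h.mul_one h1.ml,
    (dl_eq_zero_iff h hφ).1 hc, Hc_zero]
  abel

/-- The transpose of the Lie derivative on cochains with values in the dual. -/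
noncomputable def lie (f : List A → A) (p : ZMod 2) (φ : List A → Module.Dual k A) :
    List A → Module.Dual k A := uncy (Lc f p (cy φ))

/-- The formula `L_f = [B, i_f]` in cohomology. In `Fk_B₀` the term containing the coboundary of `φ`
vanishes and `Pk f (φ e)` is the primitive up to sign; afterwards `connes₀` is exchanged for
`connes`. -/
lemma lie_homologous (h : IsDualBimod m e α la ra β) (hφ : Nice α β φ) (hc : dl m la ra φ = 0)
    (hf : HasPar f p) (hf' : Nice α α f) (hcf : dl m m m f = 0) :
    Homologous m α la ra β (lie f p φ)
      (sg p • conv la f (connes e φ) + connes e (conv la f φ)) := by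
  have h1 := hφ.cy h
  have hd := dl_conv_eq_zero h.toIsBimod hcf hc
  have hn : Nice α β (conv la f φ) := hf'.conv h.map_la hφ
  have hB := h1.B₀ h.map_one
  refine .trans ?_ (((connes₀_homologous h hφ hc).conv h.toIsEquivBimod hf hf' hcf).zsmul (sg p) |>.add
    (connes₀_homologous h hn hd))
  have hP := Nice₂.Pk (p := p) hf' (h1.ml.right e) (h1.right h.map_one)
  refine .of_cy h (hP.zsmul (sg p)) ?_
  have key := Fk_B₀ h.one_mul h.mul_one h1.ml hf hf'.ml (br_mu_eq_zero hf (congrFun hcf))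
  have hc0 : Fk (Dr f p (cat (mu m))) (B₀ e (cy φ)) = sg p • cy (conv la f (connes₀ e φ)) := by
    rw [connes₀, ← Fk_Dr_mu_cy h.la_apply (Nice.uncy h hB).ml, cy_uncy hB.ml]
  have hz : Pk f p (Lc (mu m) 1 (cy φ) e) = 0 := by
    rw [(dl_eq_zero_iff h hφ).1 hc]
    funext a w
    simp [Pk, nu, Dr, cat, D, spl_zero]
  have hs : B₀ e (Fk (Dr f p (cat (mu m))) (cy φ)) = sg p • cy (connes₀ e (conv la f φ)) := by
    rw [Fk_Dr_mu_cy h.la_apply hφ.ml, connes₀, cy_uncy ((hn.cy h).B₀ h.map_one).ml, B₀, B₀,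
      ← Nn_zsmul]
    rfl
  rw [hc0, hs, sg_sq_smul, hz, sub_zero] at key
  rw [lie, cy_uncy (h1.Lc hf').ml, cy_add, cy_zsmul, key, Lc_zsmul]
  abel

/-- The formula `i_{[f,g]} = ± [L_f, i_g]` in cohomology. By `Fk_Lc_cartan` the primitive is, up to
sign, the insertion of `f` around the zeroth letter with `g` applied inside it. -/
lemma conv_lie_homologous (h : IsDualBimod m e α la ra β) (hφ : Nice α β φ)
    (hc : dl m la ra φ = 0) (hf : HasPar f p) (hf' : Nice α α f) (hcf : dl m m m f = 0)
    (hg : HasPar g q) (hg' : Nice α α g) (hcg : dl m m m g = 0) :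
    Homologous m α la ra β (conv la g (lie f p φ))
      (conv la (br f p g q) φ + sg (p * (q + 1)) • lie f p (conv la g φ)) := by
  have h1 := hφ.cy h
  have hcb : dl m m m (br f p g q) = 0 :=
    dl_br_eq_zero hf hg hf'.ml hg'.ml hcf hcg
  have hn : Nice α β (conv la g φ) := hg'.conv h.map_la hφ
  have hb := hf.br hg hf'.ml hg'.ml
  have hb' := hf'.br (p := p) (q := q) hg'
  have hL := h1.Lc hf' (q := p)
  have hS := Nice₂.Fk_Dr_cat (q := q) hf' hg' h1
  refine .of_cy h (hS.zsmul (-1)) ?_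
  have key := Fk_Lc_cartan h1.ml (hasPar_mu m) (isML_mu m) hf hf'.ml hg hg'.ml
    (br_mu_eq_zero hf (congrFun hcf)) (br_mu_eq_zero hg (congrFun hcg))
    (br_mu_eq_zero hb (congrFun hcb))
  have e1 : Fk (Dr g q (cat (mu m))) (Lc f p (cy φ)) = sg q • cy (conv la g (lie f p φ)) := by
    rw [lie, ← Fk_Dr_mu_cy h.la_apply (Nice.uncy h hL).ml, cy_uncy hL.ml]
  have e2 : Lc f p (Fk (Dr g q (cat (mu m))) (cy φ)) = sg q • cy (lie f p (conv la g φ)) := by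
    rw [Fk_Dr_mu_cy h.la_apply hφ.ml, Lc_zsmul, lie, cy_uncy ((hn.cy h).Lc hf').ml]
  have e3 : Fk (Dr g q (cat f)) (Lc (mu m) 1 (cy φ)) = 0 := by
    rw [(dl_eq_zero_iff h hφ).1 hc]
    funext a w
    simp [Fk, spl_zero]
  rw [e1, e2, e3, Fk_Dr_mu_cy h.la_apply hφ.ml, smul_zero, add_zero] at key
  have key2 := congrArg (sg q • ·) key
  simp only [smul_add, smul_sub, sg_sq_smul] at key2
  rw [key2, cy_add, cy_zsmul, Lc_zsmul, smul_comm (sg q) (sg (p * (q + 1))), sg_sq_smul, smul_smul,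
    smul_smul, ← sg_add, ← sg_add]
  have : q + p + (p + q) = 0 := by grind
  rw [this, sg_zero, one_smul]
  module

/-- Substituting `L_f = [B, i_f]` into the previous formula, for `φ` and for `i_g φ`, removes the
Lie derivative and leaves the four terms of a double commutator. -/
lemma bracket_homologous (h : IsDualBimod m e α la ra β) (hφ : Nice α β φ)
    (hc : dl m la ra φ = 0) (hf : HasPar f p) (hf' : Nice α α f) (hcf : dl m m m f = 0)
    (hg : HasPar g q) (hg' : Nice α α g) (hcg : dl m m m g = 0) :
    Homologous m α la ra β (conv la (br f p g q) φ)
      (sg p • conv la g (conv la f (connes e φ)) + conv la g (connes e (conv la f φ)) +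
        (-sg (p * (q + 1))) • (sg p • conv la f (connes e (conv la g φ)) +
          connes e (conv la f (conv la g φ)))) := by
  have hn : Nice α β (conv la g φ) := hg'.conv h.map_la hφ
  have hd := dl_conv_eq_zero h.toIsBimod hcg hc
  have h1 := (conv_lie_homologous h hφ hc hf hf' hcf hg hg' hcg).symm.trans
    ((lie_homologous h hφ hc hf hf' hcf).conv h.toIsEquivBimod hg hg' hcg)
  have h2 := (lie_homologous h hn hd hf hf' hcf).zsmul (-sg (p * (q + 1)))
  have h3 := h1.add h2
  rw [conv_add_right, conv_zsmul_right] at h3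
  refine .trans (.of_eq ?_) h3
  module

end dual

/-! ### Untwisting: from hom-associative to associative -/

section translation

variable {k A : Type*} [CommRing k] [AddCommGroup A] [Module k A] {𝔸 : RegUnitalHomAlgebra k A}
variable {M : Type*} [AddCommGroup M] [Module k M] (𝓜 : RegHomBimodule 𝔸 M)

open RegUnitalHomAlgebra RegHomBimodule

lemma neg_one_pow_smul {X : Type*} [AddCommGroup X] [Module k X] (n : ℕ) (x : X) :
    (-1 : k) ^ n • x = sg (n : ZMod 2) • x := by
  induction n with
  | zero => simp
  | succ n ih => rw [pow_succ', mul_smul, ih, Nat.cast_succ, sg_add]; simp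

/-- The untwisted product `a ∘ b = α⁻¹ (a · b)`. -/
def tmul (𝔸 : RegUnitalHomAlgebra k A) : A →ₗ[k] A →ₗ[k] A := 𝔸.mul.compr₂ 𝔸.α.symm.toLinearMap

/-- The untwisted left action. -/
def tla : A →ₗ[k] M →ₗ[k] M := 𝓜.lact.compr₂ 𝓜.β.symm.toLinearMap

/-- The untwisted right action. -/
def tra : M →ₗ[k] A →ₗ[k] M := 𝓜.ract.compr₂ 𝓜.β.symm.toLinearMap

lemma tmul_apply (a b : A) : tmul 𝔸 a b = 𝔸.α.symm (𝔸.mul a b) := rfl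

lemma tla_apply (a : A) (x : M) : tla 𝓜 a x = 𝓜.β.symm (𝓜.lact a x) := rfl
lemma tra_apply (x : M) (a : A) : tra 𝓜 x a = 𝓜.β.symm (𝓜.ract x a) := rfl

lemma β_symm_lact (a : A) (x : M) :
    𝓜.β.symm (𝓜.lact a x) = 𝓜.lact (𝔸.α.symm a) (𝓜.β.symm x) := by
  rw [LinearEquiv.symm_apply_eq, 𝓜.β_lact]; simp

lemma β_symm_ract (a : A) (x : M) :
    𝓜.β.symm (𝓜.ract x a) = 𝓜.ract (𝓜.β.symm x) (𝔸.α.symm a) := by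
  rw [LinearEquiv.symm_apply_eq, 𝓜.β_ract]; simp

/-- Once `α⁻¹` and `β⁻¹` are moved onto the arguments, each associativity law is the corresponding
hom-law at shifted arguments. -/
lemma isEquivBimod : IsEquivBimod (tmul 𝔸) 𝔸.one 𝔸.α.toLinearMap (tla 𝓜) (tra 𝓜)
    𝓜.β.toLinearMap where
  assoc a b c := by
    refine congrArg 𝔸.α.symm ?_
    simpa [tmul_apply, α_mul_symm] using 𝔸.hom_assoc (𝔸.α.symm a) (𝔸.α.symm b) (𝔸.α.symm c)
  la_la a b x := by
    refine congrArg 𝓜.β.symm ?_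
    simpa [tmul_apply, tla_apply, α_mul_symm, β_symm_lact] using
      𝓜.lact_lact (𝔸.α.symm a) (𝔸.α.symm b) (𝓜.β.symm x)
  la_ra a x b := by
    refine congrArg 𝓜.β.symm ?_
    simpa [tla_apply, tra_apply, β_symm_ract, β_symm_lact] using
      𝓜.lact_ract (𝔸.α.symm a) (𝓜.β.symm x) (𝔸.α.symm b)
  ra_ra x a b := by
    refine congrArg 𝓜.β.symm ?_
    simpa [tmul_apply, tra_apply, α_mul_symm, β_symm_ract] using
      𝓜.ract_ract (𝓜.β.symm x) (𝔸.α.symm a) (𝔸.α.symm b)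
  one_mul a := by simp [tmul_apply, 𝔸.one_mul]
  mul_one a := by simp [tmul_apply, 𝔸.mul_one]
  map_mul a b := by simp [tmul_apply, α_mul_symm, 𝔸.map_mul]
  map_one := 𝔸.map_one
  map_la a x := by simp [tla_apply, β_symm_lact, 𝓜.β_lact]
  map_ra x a := by simp [tra_apply, β_symm_ract, 𝓜.β_ract]

lemma isDualBimod : IsDualBimod (tmul 𝔸) 𝔸.one 𝔸.α.toLinearMap (tla 𝔸.dualBimodule)
    (tra 𝔸.dualBimodule) 𝔸.dualBimodule.β.toLinearMap where
  toIsEquivBimod := isEquivBimod _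
  la_apply a θ b := by
    simp [tla_apply, tmul_apply, dualBimodule]
  ra_apply a θ b := by
    simp [tra_apply, tmul_apply, dualBimodule]
  β_apply θ a := by simp [dualBimodule]
  surj := 𝔸.α.surjective

lemma zpow_equivariant {X Y Z : Type*} [AddCommGroup X] [Module k X] [AddCommGroup Y] [Module k Y]
    [AddCommGroup Z] [Module k Z] {B : X → Y → Z} {a : X ≃ₗ[k] X} {b : Y ≃ₗ[k] Y} {c : Z ≃ₗ[k] Z}
    (h : ∀ x y, c (B x y) = B (a x) (b y)) (z : ℤ) (x : X) (y : Y) :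
    (c ^ z) (B x y) = B ((a ^ z) x) ((b ^ z) y) := by
  induction z generalizing x y with
  | zero => simp
  | succ n ih => 
    rw [zpow_add_one, zpow_add_one, zpow_add_one]
    exact (congrArg _ (h x y)).trans (ih _ _)
  | pred n ih =>
    rw [zpow_sub_one, zpow_sub_one, zpow_sub_one]
    refine (congrArg (c ^ (-n : ℤ)) ?_).trans (ih _ _)
    change c.symm _ = B (a.symm x) (b.symm y)
    rw [LinearEquiv.symm_apply_eq, h]
    simp

lemma βpow_lact (z : ℤ) (a : A) (x : M) :
    𝓜.βpow z (𝓜.lact a x) = 𝓜.lact (𝔸.αpow z a) (𝓜.βpow z x) :=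
  zpow_equivariant (B := fun a x => 𝓜.lact a x) 𝓜.β_lact z a x

lemma βpow_ract (z : ℤ) (a : A) (x : M) :
    𝓜.βpow z (𝓜.ract x a) = 𝓜.ract (𝓜.βpow z x) (𝔸.αpow z a) :=
  zpow_equivariant (B := fun x a => 𝓜.ract x a) 𝓜.β_ract z x a

lemma βpow_βpow (y z : ℤ) (x : M) : 𝓜.βpow y (𝓜.βpow z x) = 𝓜.βpow (y + z) x := by
  rw [βpow, βpow, βpow, zpow_add]; rfl

lemma αpow_αpow' (y z : ℤ) (a : A) : 𝔸.αpow y (𝔸.αpow z a) = 𝔸.αpow (y + z) a := 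
  βpow_βpow 𝔸.selfBimodule y z a

lemma βpow_zero (x : M) : 𝓜.βpow 0 x = x := by simp [βpow]

lemma β_symm_eq (x : M) : 𝓜.β.symm x = 𝓜.βpow (-1) x := by
  rw [βpow, zpow_neg_one]; rfl

lemma αpow_eq (z : ℤ) : 𝔸.αpow z = 𝔸.selfBimodule.βpow z := rfl

lemma cochains_βpow {n : ℕ} {x : MultiCochain k A M n} (hx : x ∈ 𝓜.cochains n) (z : ℤ)
    (a : Fin n → A) : 𝓜.βpow z (x a) = x fun i => 𝔸.αpow z (a i) := by
  have h : ∀ z : ℤ, ∀ a : Fin n → A, (𝓜.β ^ z) (x a) = x fun i => (𝔸.α ^ z) (a i) := by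
    intro z
    induction z with
    | zero => simp
    | succ n ih =>
      intro a
      rw [zpow_add_one, zpow_add_one]
      exact (congrArg _ (hx a)).trans (ih _)
    | pred n ih =>
      intro a
      rw [zpow_sub_one, zpow_sub_one]
      refine (congrArg (𝓜.β ^ (-n : ℤ)) ?_).trans (ih _)
      change 𝓜.β.symm _ = x fun i => 𝔸.α.symm (a i)
      rw [LinearEquiv.symm_apply_eq, hx]
      simp
  exact h z a

/-- The untwisted cochain corresponding to `x`, as a function of words. -/
def words {n : ℕ} (x : MultiCochain k A M n) (w : List A) : M :=
  if h : w.length = n then 𝓜.βpow (1 - n) (x fun i => w[i]) else 0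

variable {n : ℕ} {x y : MultiCochain k A M n}

lemma words_of_length (x : MultiCochain k A M n) {w : List A} (h : w.length = n) :
    words 𝓜 x w = 𝓜.βpow (1 - n) (x fun i => w[i]) := dif_pos h

lemma words_ofFn (x : MultiCochain k A M n) (a : Fin n → A) :
    words 𝓜 x (List.ofFn a) = 𝓜.βpow (1 - n) (x a) := by
  rw [words_of_length _ _ (by simp)]
  simp

lemma hasLen_words (x : MultiCochain k A M n) : HasLen (words 𝓜 x) n := fun w hw => by
  by_contra h; exact hw (dif_neg h)

lemma eq_ofFn {w : List A} (h : w.length = n) : ∃ a : Fin n → A, w = List.ofFn a := by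
  subst h; exact ⟨w.get, by simp⟩

lemma words_ext {φ ψ : List A → M} (hφ : HasLen φ n) (hψ : HasLen ψ n)
    (h : ∀ w, w.length = n → φ w = ψ w) : φ = ψ := by
  funext w
  by_cases hw : w.length = n
  · exact h w hw
  · by_cases h1 : φ w = 0
    · by_cases h2 : ψ w = 0
      · rw [h1, h2]
      · exact absurd (hψ w h2) hw
    · exact absurd (hφ w h1) hw

lemma βpow_injective (z : ℤ) : Function.Injective (𝓜.βpow z) := (𝓜.β ^ z).injective

lemma words_injective : Function.Injective (words 𝓜 : MultiCochain k A M n → List A → M) := by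
  intro x y h
  ext a
  have := congrFun h (List.ofFn a)
  rw [words_ofFn, words_ofFn] at this
  exact βpow_injective _ _ this

lemma words_add : words 𝓜 (x + y) = words 𝓜 x + words 𝓜 y := by
  funext w; by_cases h : w.length = n <;> simp [words, h]

lemma words_smul (c : k) : words 𝓜 (c • x) = c • words 𝓜 x := by
  funext w; by_cases h : w.length = n <;> simp [words, h]

/-- `words` as a linear map. -/
def wordsₗ (n : ℕ) : MultiCochain k A M n →ₗ[k] List A → M where
  toFun := words 𝓜
  map_add' _ _ := words_add 𝓜
  map_smul' c _ := words_smul 𝓜 c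

lemma isML_words (x : MultiCochain k A M n) : IsML k (words 𝓜 x) := fun u v => by
  by_cases h : (u ++ 0 :: v).length = n
  · have h' : ∀ b, (u ++ b :: v).length = n := fun b => by rw [← h]; simp
    have hu : u.length < n := by rw [← h]; simp
    refine ⟨𝓜.βpow (1 - n) ∘ₗ x.toLinearMap (fun i => (u ++ 0 :: v)[i]) ⟨u.length, hu⟩, fun b => ?_⟩
    rw [words_of_length _ _ (h' b)]
    simp only [LinearMap.comp_apply, MultilinearMap.toLinearMap_apply]
    congr 2
    funext i
    by_cases hi : i = ⟨u.length, hu⟩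
    · subst hi; simp
    · rw [Function.update_of_ne hi]
      have : (i : ℕ) ≠ u.length := fun e => hi (Fin.ext e)
      simp only [Fin.getElem_fin, List.getElem_append, List.getElem_cons]
      split_ifs <;> first | rfl | omega
  · refine ⟨0, fun b => dif_neg ?_⟩
    intro h'; apply h; rw [← h']; simp

lemma mem_cochains_iff : x ∈ 𝓜.cochains n ↔ Nice 𝔸.α.toLinearMap 𝓜.β.toLinearMap (words 𝓜 x) := by
  have hβ : ∀ y : M, 𝓜.β (𝓜.βpow (1 - n) y) = 𝓜.βpow (1 - n) (𝓜.β y) := by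
    intro y
    have h1 : 𝓜.β * 𝓜.β ^ (1 - n : ℤ) = 𝓜.β ^ (1 - n : ℤ) * 𝓜.β :=
      (Commute.refl 𝓜.β).zpow_right _
    exact congrArg (fun e : M ≃ₗ[k] M => e y) h1
  constructor
  · refine fun hx => ⟨isML_words _ _, fun w => ?_⟩
    by_cases h : w.length = n
    · obtain ⟨a, rfl⟩ := eq_ofFn h
      rw [List.map_ofFn, words_ofFn, words_ofFn]
      exact (congrArg _ (hx a).symm).trans (hβ _).symm
    · have : ¬ (w.map 𝔸.α.toLinearMap).length = n := by simpa using h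
      rw [words, words, dif_neg h, dif_neg this, map_zero]
  · intro hx a
    have := hx.eqv (List.ofFn a)
    rw [List.map_ofFn, words_ofFn, words_ofFn] at this
    exact (βpow_injective 𝓜 _ (this.trans (hβ _))).symm

lemma exists_words {φ : List A → M} (hφ : IsML k φ) : ∃ x : MultiCochain k A M n,
    ∀ w, w.length = n → words 𝓜 x w = φ w := by
  have key : ∀ (a : Fin n → A) (i : Fin n) (c : A), List.ofFn (Function.update a i c) =
      (List.ofFn a).take i ++ c :: (List.ofFn a).drop (i + 1) := by
    intro a i c
    have := List.set_eq_take_append_cons_drop (i := i) (a := c) (l := List.ofFn a)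
    rw [if_pos (by simp)] at this
    rw [← this]
    apply List.ext_getElem
    · simp
    · intro j h1 h2
      simp [List.getElem_set, Function.update_apply, Fin.ext_iff, eq_comm]
  -- The power `β^{n-1}` undoes the normalisation `β^{1-n}` of `words`.
  refine ⟨⟨fun a => 𝓜.βpow (n - 1) (φ (List.ofFn a)), ?_, ?_⟩, fun w h => ?_⟩
  · intro inst a i c d
    rw [Subsingleton.elim inst (instDecidableEqFin n)]
    obtain ⟨T, hT⟩ := hφ ((List.ofFn a).take i) ((List.ofFn a).drop (i + 1))
    simp [key, hT]
  · intro inst a i c d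
    rw [Subsingleton.elim inst (instDecidableEqFin n)]
    obtain ⟨T, hT⟩ := hφ ((List.ofFn a).take i) ((List.ofFn a).drop (i + 1))
    simp [key, hT]
  · obtain ⟨a, rfl⟩ := eq_ofFn h
    rw [words_ofFn]
    simp [βpow_βpow, βpow_zero]

end translation

/-! ### Circle products, action and coboundary after untwisting -/

section operations

variable {k A : Type*} [CommRing k] [AddCommGroup A] [Module k A] {𝔸 : RegUnitalHomAlgebra k A}
variable {M : Type*} [AddCommGroup M] [Module k M] (𝓜 : RegHomBimodule 𝔸 M)

open RegUnitalHomAlgebra RegHomBimodule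

lemma spl_eq_sum {X : Type*} [AddCommGroup X] (F : List A → List A → X) (w : List A) :
    spl F w = ∑ i ∈ Finset.range (w.length + 1), F (w.take i) (w.drop i) := by
  induction w generalizing F with
  | nil => simp [spl_nil]
  | cons a w ih => rw [spl_cons, List.length_cons, Finset.sum_range_succ', ih, add_comm]; simp

lemma spl_eq_of_length {X : Type*} [AddCommGroup X] {F : List A → List A → X} {w : List A} {p : ℕ}
    (hp : p ≤ w.length) (h : ∀ u v, u ++ v = w → u.length ≠ p → F u v = 0) :
    spl F w = F (w.take p) (w.drop p) := by
  rw [spl_eq_sum, Finset.sum_eq_single p]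
  · intro i hi hip
    refine h _ _ (List.take_append_drop i w) ?_
    simp only [Finset.mem_range] at hi
    simp; omega
  · intro hn; simp at hn; omega

variable {p q n : ℕ}

/-- The inner cochain is `α^{q-1}` of its untwisted version, so all arguments of `f` carry the same
power `α^{q-1}`. Equivariance of `f` moves it outside, where `(1 - n) + (q - 1) = 1 - p`. -/
lemma words_circ (h : n + 1 = p + q) (i : Fin p) {f : MultiCochain k A M p} (hf : f ∈ 𝓜.cochains p)
    (g : MultiCochain k A A q) {w : List A} (hw : w.length = n) :
    words 𝓜 (𝔸.circ h i f g) w = words 𝓜 f (w.take i ++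
      words 𝔸.selfBimodule g ((w.drop i).take q) :: w.drop (i + q)) := by
  have hi := i.2
  have h1 : ((w.drop i).take q).length = q := by simp; omega
  have h2 : (w.take i ++ words 𝔸.selfBimodule g ((w.drop i).take q) :: w.drop (i + q)).length = p := by
    simp; omega
  rw [words_of_length _ _ hw, words_of_length _ _ h2, circ_apply]
  have e : circArgs h (𝔸.αpow ((q : ℤ) - 1)) g i (fun i : Fin n => w[i]) = fun j => 𝔸.αpow ((q : ℤ) - 1)
      ((w.take i ++ words 𝔸.selfBimodule g ((w.drop i).take q) :: w.drop (i + q))[j]) := by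
    funext j
    simp only [circArgs, Fin.getElem_fin, List.getElem_append, List.getElem_cons, List.length_take]
    have hm : min (i : ℕ) w.length = i := by omega
    by_cases h3 : j < i
    · have h3' : (j : ℕ) < i := h3
      simp [h3, h3', hm]
    · have h3' : ¬ (j : ℕ) < i := h3
      by_cases h4 : j = i
      · subst h4
        simp only [lt_self_iff_false, dite_false, dite_true, hm, tsub_self]
        rw [words_of_length _ _ h1, αpow_eq, βpow_βpow]
        simp [βpow_zero, List.getElem_take, List.getElem_drop]
      · have h4' : (j : ℕ) ≠ i := fun e => h4 (Fin.ext e)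
        have h5 : (j : ℕ) - i ≠ 0 := by omega
        simp only [h3, h3', h4, h5, dite_false, hm, List.getElem_drop]
        congr 2
        omega
  rw [e, ← cochains_βpow 𝓜 hf, βpow_βpow]
  congr 2
  omega

lemma words_sum_circ (h : n + 1 = p + q) {f : MultiCochain k A M p} (hf : f ∈ 𝓜.cochains p)
    (g : MultiCochain k A A q) {w : List A} (hw : w.length = n) :
    words 𝓜 (∑ i : Fin p, (-1 : k) ^ ((q + 1) * (i : ℕ)) • 𝔸.circ h i f g) w =
      D (words 𝔸.selfBimodule g) (q + 1) (words 𝓜 f) w := by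
  have e1 : words 𝓜 (∑ i : Fin p, (-1 : k) ^ ((q + 1) * (i : ℕ)) • 𝔸.circ h i f g) =
      ∑ i : Fin p, (-1 : k) ^ ((q + 1) * (i : ℕ)) • words 𝓜 (𝔸.circ h i f g) :=
    (map_sum (wordsₗ 𝓜 n) _ _).trans (Finset.sum_congr rfl fun i _ => words_smul 𝓜 _)
  -- `D` also runs over cuts with at least `p` letters on the left. Then the word presented to `f`
  -- is too long, or `g` receives the wrong number of letters.
  have e2 : ∀ i : ℕ, p ≤ i → i < w.length + 1 →
      sg ((q + 1 : ZMod 2) * par (w.take i)) • spl (fun v x => words 𝓜 f (w.take i ++ words 𝔸.selfBimodule g v :: x))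
        (w.drop i) = 0 := by
    intro i hi hi'
    rw [spl_eq_zero, smul_zero]
    intro u v huv
    have hl := congrArg List.length huv
    simp at hl
    by_cases hg : u.length = q
    · by_contra hc
      have := hasLen_words 𝓜 f _ hc
      simp at this
      omega
    · have : words 𝔸.selfBimodule g u = 0 := dif_neg hg
      rw [this]
      exact (isML_words 𝓜 f).map_zero _ _
  rw [e1, D, spl_eq_sum, Finset.sum_apply, ← Finset.sum_subset (s₁ := Finset.range p)]
  · rw [Finset.sum_range]
    refine Finset.sum_congr rfl fun i _ => ?_
    have hi := i.2
    rw [Pi.smul_apply, words_circ 𝓜 h i hf g hw, neg_one_pow_smul,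
      spl_eq_of_length (p := q) (by simp; omega), List.drop_drop]
    · have : par (w.take i) = (i : ZMod 2) := by
        rw [par, List.length_take, min_eq_left (by omega)]
      rw [this]
      push_cast
      rfl
    · intro u v _ hu
      have : words 𝔸.selfBimodule g u = 0 := dif_neg hu
      rw [this]
      exact (isML_words 𝓜 f).map_zero _ _
  · intro i hi
    simp at hi ⊢
    omega
  · intro i hi hi'
    exact e2 i (by simpa using hi') (by simpa using hi)

lemma words_mulCochain : words 𝔸.selfBimodule 𝔸.mulCochain = mu (tmul 𝔸) := by
  refine words_ext (hasLen_words _ _) (hasLen_mu _) fun w hw => ?_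
  match w, hw with
  | [a, b], _ =>
    rw [words_of_length 𝔸.selfBimodule 𝔸.mulCochain (show [a, b].length = 2 from rfl)]
    simp [mu, tmul_apply, ← β_symm_eq, mulCochain, selfBimodule]

lemma words_sub {x y : MultiCochain k A M n} : words 𝓜 (x - y) = words 𝓜 x - words 𝓜 y :=
  map_sub (wordsₗ 𝓜 n) x y

lemma words_zero : words 𝓜 (0 : MultiCochain k A M n) = 0 := map_zero (wordsₗ 𝓜 n)

lemma words_bracket (h : n + 1 = p + q) {f : MultiCochain k A A p}
    (hf : f ∈ 𝔸.selfBimodule.cochains p) {g : MultiCochain k A A q}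
    (hg : g ∈ 𝔸.selfBimodule.cochains q) : words 𝔸.selfBimodule (𝔸.bracket h f g) =
      br (words 𝔸.selfBimodule f) (p + 1) (words 𝔸.selfBimodule g) (q + 1) := by
  have hl : HasLen (br (words 𝔸.selfBimodule f) (p + 1) (words 𝔸.selfBimodule g) (q + 1)) n := by
    intro w hw
    by_cases h1 : D (words 𝔸.selfBimodule g) (q + 1) (words 𝔸.selfBimodule f) w = 0
    · rw [br, h1, zero_sub, neg_ne_zero] at hw
      have := (hasLen_words _ g).D (hasLen_words _ f) (isML_words _ g) (right_ne_zero_of_smul hw)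
      omega
    · have := (hasLen_words _ f).D (hasLen_words _ g) (isML_words _ f) h1
      omega
  refine words_ext (hasLen_words _ _) hl fun w hw => ?_
  have e : 𝔸.bracket h f g = (∑ i : Fin p, (-1 : k) ^ ((q + 1) * (i : ℕ)) • 𝔸.circ h i f g) -
    (-1 : k) ^ ((p + 1) * (q + 1)) •
      ∑ i : Fin q, (-1 : k) ^ ((p + 1) * (i : ℕ)) • 𝔸.circ (h.trans (p.add_comm q)) i g f := by
    simp [bracket]
  rw [e, words_sub, words_smul, Pi.sub_apply, Pi.smul_apply, words_sum_circ _ h hf g hw,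
    words_sum_circ _ (h.trans (p.add_comm q)) hg f hw, neg_one_pow_smul, br]
  push_cast
  rfl

lemma words_act (f : MultiCochain k A A p) (x : MultiCochain k A M n) :
    words 𝓜 (𝓜.act p n f x) = sg (p * n) • conv (tla 𝓜) (words 𝔸.selfBimodule f) (words 𝓜 x) := by
  have hl : HasLen (sg (p * n) • conv (tla 𝓜) (words 𝔸.selfBimodule f) (words 𝓜 x)) (p + n) := by
    intro w hw
    refine ((hasLen_words 𝔸.selfBimodule f).conv (tla 𝓜) (hasLen_words 𝓜 x)) w fun h => hw ?_
    rw [Pi.smul_apply, h, smul_zero]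
  refine words_ext (hasLen_words _ _) hl fun w hw => ?_
  rw [words_of_length _ _ hw, act_apply, map_smul, neg_one_pow_smul, Pi.smul_apply, conv,
    spl_eq_of_length (p := p) (by omega)]
  · push_cast
    rw [words_of_length _ _ (by simp; omega), words_of_length _ _ (by simp; omega), tla_apply,
      β_symm_eq, βpow_lact, βpow_lact, βpow_βpow, βpow_βpow, αpow_αpow', αpow_eq, αpow_eq, βpow_βpow]
    have h1 : (1 - (p + n) + (n - 1) : ℤ) = -1 + (1 - p) := by ring
    have h2 : (1 - (p + n) + (p - 1) : ℤ) = -1 + (1 - n) := by ring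
    rw [h1, h2]
    simp [List.getElem_take, List.getElem_drop]
  · intro u v _ hu
    have : words 𝔸.selfBimodule f u = 0 := dif_neg hu
    rw [this, map_zero, LinearMap.zero_apply]

lemma words_δ {x : MultiCochain k A M n} (hx : x ∈ 𝓜.cochains n) :
    words 𝓜 (𝓜.δ n x) = dl (tmul 𝔸) (tla 𝓜) (tra 𝓜) (words 𝓜 x) := by
  have hl : HasLen (dl (tmul 𝔸) (tla 𝓜) (tra 𝓜) (words 𝓜 x)) (n + 1) := by
    intro w hw
    by_contra hc
    apply hw
    have h1 : conv (tla 𝓜) theta (words 𝓜 x) w = 0 := by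
      by_contra h
      exact hc (by rw [hasLen_theta.conv _ (hasLen_words 𝓜 x) w h, add_comm])
    have h2 : D (mu (tmul 𝔸)) 1 (words 𝓜 x) w = 0 := by
      by_contra h
      have := (hasLen_words 𝓜 x).D (hasLen_mu (tmul 𝔸)) (isML_words 𝓜 x) h
      omega
    have h3 : conv (tra 𝓜) (fun u => sg (par u) • words 𝓜 x u) theta w = 0 := by
      by_contra h
      refine hc (HasLen.conv (tra 𝓜) (fun u hu => ?_) hasLen_theta w h)
      exact hasLen_words 𝓜 x u (right_ne_zero_of_smul hu)
    rw [dl, h1, h2, h3]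
    simp
  refine words_ext (hasLen_words _ _) hl fun w hw => ?_
  -- The exponent `2 + 1` matches `words_sum_circ` for the 2-cochain `mulCochain`. As slots are
  -- counted from `0`, one global sign is left over.
  have e : 𝓜.δ n x = 𝓜.leftTerm n x + (-1 : k) • (∑ i : Fin n, (-1 : k) ^ ((2 + 1) * (i : ℕ)) •
      𝔸.circ (by omega) i x 𝔸.mulCochain) + (-1 : k) ^ (n + 1) • 𝓜.rightTerm n x := by
    simp only [δ, LinearMap.add_apply, LinearMap.sum_apply, LinearMap.smul_apply, Finset.smul_sum,
      smul_smul, LinearMap.flip_apply]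
    congr 2
    refine Finset.sum_congr rfl fun i _ => ?_
    rw [pow_mul, pow_succ']
    norm_num
  have e1 : words 𝓜 (𝓜.leftTerm n x) w = conv (tla 𝓜) theta (words 𝓜 x) w := by
    rw [words_of_length _ _ hw, conv, spl_eq_of_length (p := 1) (by omega)]
    · match w, hw with
      | a :: w, hw =>
        rw [leftTerm_apply, words_of_length 𝓜 x (by simpa using hw), tla_apply, β_symm_eq,
          βpow_lact, βpow_lact, βpow_βpow, αpow_αpow']
        simp
        rw [show (-n + (n - 1) : ℤ) = -1 by ring, show (-1 + (1 - n) : ℤ) = -n by ring]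
    · intro u v _ hu
      simp [theta_eq_zero hu]
  have e2 : words 𝓜 (𝓜.rightTerm n x) w = conv (tra 𝓜) (words 𝓜 x) theta w := by
    rw [words_of_length _ _ hw, conv, spl_eq_of_length (p := n) (by omega)]
    · obtain ⟨u, a, hua⟩ := (List.eq_nil_or_concat w).resolve_left (by rintro rfl; simp at hw)
      rw [List.concat_eq_append] at hua
      subst hua
      have hu : u.length = n := by simpa using hw
      rw [rightTerm_apply, List.take_left' hu, List.drop_left' hu, words_of_length 𝓜 x hu, tra_apply, β_symm_eq,
          βpow_ract, βpow_ract, βpow_βpow, αpow_αpow']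
      simp
      rw [show (-n + (n - 1) : ℤ) = -1 by ring, show (-1 + (1 - n) : ℤ) = -n by ring]
      congr 3
      · congr 1
        funext i
        rw [List.getElem_append_left]
      · simp [← hu]
    · intro u v _ hu
      have : words 𝓜 x u = 0 := dif_neg hu
      rw [this, map_zero, LinearMap.zero_apply]
  have e3 : conv (tra 𝓜) (fun u => sg (par u) • words 𝓜 x u) theta =
      sg n • conv (tra 𝓜) (words 𝓜 x) theta := by
    rw [← conv_zsmul_left]
    congr 1
    funext u
    by_cases h : words 𝓜 x u = 0
    · simp [h]
    · rw [par, hasLen_words 𝓜 x u h]; rfl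
  rw [e, words_add, words_add, words_smul, words_smul, Pi.add_apply, Pi.add_apply, Pi.smul_apply,
    Pi.smul_apply, e1, e2, words_sum_circ 𝓜 _ hx _ hw, words_mulCochain, neg_one_pow_smul, dl, e3]
  have : ((2 : ℕ) : ZMod 2) + 1 = 1 := by decide
  rw [this, Nat.cast_succ, sg_add, Pi.smul_apply]
  simp
  abel

end operations

/-! ### The Connes operator after untwisting -/

section connes

variable {k A : Type*} [CommRing k] [AddCommGroup A] [Module k A] {𝔸 : RegUnitalHomAlgebra k A}

open RegUnitalHomAlgebra RegHomBimodule

variable {n : ℕ}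

/-- A multilinear form as a function of words. -/
def formWords {n : ℕ} (Φ : MultilinearMap k (fun _ : Fin n => A) k) (w : List A) : k :=
  if h : w.length = n then Φ fun i => w[i] else 0

lemma formWords_of_length (Φ : MultilinearMap k (fun _ : Fin n => A) k) {w : List A}
    (h : w.length = n) : formWords Φ w = Φ fun i => w[i] := dif_pos h

lemma formWords_sub (Φ Ψ : MultilinearMap k (fun _ : Fin n => A) k) (w : List A) :
    formWords (Φ - Ψ) w = formWords Φ w - formWords Ψ w := by
  by_cases h : w.length = n <;> simp [formWords, h]

lemma formWords_smul (c : k) (Φ : MultilinearMap k (fun _ : Fin n => A) k) (w : List A) :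
    formWords (c • Φ) w = c • formWords Φ w := by
  by_cases h : w.length = n <;> simp [formWords, h]

lemma dual_βpow (z : ℤ) (θ : Module.Dual k A) (a : A) :
    𝔸.dualBimodule.βpow z θ a = θ (𝔸.αpow (-z) a) := by
  have h := zpow_equivariant (k := k) (B := fun (θ : Module.Dual k A) (a : A) => θ a)
    (a := 𝔸.dualBimodule.β) (b := 𝔸.α) (c := 1) (fun θ a => (isDualBimod.β_apply θ a).symm) z θ
    (𝔸.αpow (-z) a)
  have e : (𝔸.α ^ z) (𝔸.αpow (-z) a) = a := 𝔸.αpow_αpow z (-z) (by ring) a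
  rw [one_zpow, e] at h
  exact h.symm

lemma formWords_toForm (x : MultiCochain k A (Module.Dual k A) n) (a : A) (w : List A) :
    formWords (𝔸.toForm n x) (a :: w) = cy (words 𝔸.dualBimodule x) a w := by
  by_cases h : w.length = n
  · rw [formWords_of_length _ (by simp [h]), toForm_apply, cy, words_of_length _ _ h]
    rw [dual_βpow, neg_sub]
    rfl
  · rw [formWords, dif_neg (by simpa using h), cy, words, dif_neg h, LinearMap.zero_apply]

lemma formWords_cyclicDual (Φ : MultilinearMap k (fun _ : Fin (n + 1) => A) k) (y : List A) (l : A) :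
    formWords (cyclicDual k A n Φ) (y ++ [l]) = formWords Φ (l :: y) := by
  by_cases h : y.length = n
  · subst h
    rw [formWords_of_length _ (by simp), formWords_of_length _ (by simp), cyclicDual_apply]
    congr 1
    funext i
    refine Fin.cases ?_ (fun j => ?_) i
    · simp
    · simp
  · rw [formWords, formWords, dif_neg (by simpa using h), dif_neg (by simpa using h)]

lemma formWords_cyclicDual_pow (Φ : MultilinearMap k (fun _ : Fin (n + 1) => A) k) (u v : List A) :
    formWords ((cyclicDual k A n ^ v.length) Φ) (u ++ v) = formWords Φ (v ++ u) := by
  induction v generalizing u Φ with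
  | nil => simp
  | cons c v ih =>
    rw [List.length_cons, pow_succ, Module.End.mul_apply, ← List.singleton_append (x := c),
      ← List.append_assoc, ih, ← List.append_assoc, formWords_cyclicDual]
    rfl

lemma formWords_insertUnitDual (Φ : MultilinearMap k (fun _ : Fin (n + 2) => A) k) (w : List A) :
    formWords (𝔸.insertUnitDual n Φ) w = formWords Φ (w.map 𝔸.α.symm ++ [𝔸.one]) := by
  by_cases h : w.length = n + 1
  · rw [formWords_of_length _ h, formWords_of_length _ (by simpa using h), insertUnitDual_apply]
    congr 1
    funext i
    refine Fin.lastCases ?_ (fun j => ?_) i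
    · simp [← h]
    · have : 𝔸.αpow (-1) = 𝔸.α.symm.toLinearMap := by rw [αpow, zpow_neg_one]; rfl
      have hj : (j : ℕ) < (w.map 𝔸.α.symm).length := by simp; omega
      simp [this, List.getElem_append_left hj]
  · rw [formWords, formWords, dif_neg (by simpa using h), dif_neg (by simpa using h)]

lemma formWords_cyclicDual_toForm (x : MultiCochain k A (Module.Dual k A) n) (w : List A) :
    formWords (cyclicDual k A n (𝔸.toForm n x)) w =
      sg n • tau (cy (words 𝔸.dualBimodule x)) w := by
  rcases List.eq_nil_or_concat w with rfl | ⟨y, l, rfl⟩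
  · simp [formWords]
  · rw [List.concat_eq_append, formWords_cyclicDual, formWords_toForm, tau_append_singleton]
    by_cases h : y.length = n
    · rw [par, h, sg_sq_smul]
    · rw [cy, words, dif_neg h]
      simp

lemma words_connesStar {x : MultiCochain k A (Module.Dual k A) (n + 1)}
    (hx : x ∈ 𝔸.dualBimodule.cochains (n + 1)) : words 𝔸.dualBimodule (𝔸.connesStar n x) =
      sg (n + 1) • connes 𝔸.one (words 𝔸.dualBimodule x) := by
  have hN := (mem_cochains_iff 𝔸.dualBimodule).1 hx
  have hD := isDualBimod (𝔸 := 𝔸)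
  apply cy_injective
  rw [cy_zsmul, cy_connes hD hN]
  set φ := cy (words 𝔸.dualBimodule x) with hφ
  have hN2 : Nice₂ 𝔸.α.toLinearMap φ := hN.cy hD
  -- Invariance of `φ`, together with `α⁻¹ 1 = 1`, makes the `α⁻¹` in the operator `s` disappear.
  have hs : ∀ a w, φ (𝔸.α.symm a) (w.map 𝔸.α.symm) = φ a w := by
    intro a w
    rw [← hN2.inv]
    simp [Function.comp_def]
  have hone : 𝔸.α.symm 𝔸.one = 𝔸.one := by
    rw [LinearEquiv.symm_apply_eq, 𝔸.map_one]
  have hts : ∀ w, tau φ (w.map 𝔸.α.symm) = tau φ w := by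
    intro w
    have := tau_map (α := 𝔸.α.symm.toLinearMap) (φ := φ) w
    simp only [LinearEquiv.coe_coe, hs] at this
    exact this
  set χ : List A → k := fun w => φ 𝔸.one w - tau φ (𝔸.one :: w)
  let T : MultilinearMap k (fun _ : Fin (n + 2) => A) k →ₗ[k]
      MultilinearMap k (fun _ : Fin (n + 2) => A) k :=
    LinearMap.id - (-1 : k) ^ (n + 1) • cyclicDual k A (n + 1)
  have e1 : ∀ w, formWords (𝔸.insertUnitDual n (cyclicDual k A (n + 1) (T (𝔸.toForm (n + 1) x)))) w = χ w := by
    intro w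
    have h1 := hs 𝔸.one w
    have h2 := hts (𝔸.one :: w)
    rw [hone] at h1
    rw [List.map_cons, hone] at h2
    rw [formWords_insertUnitDual, formWords_cyclicDual, show T = LinearMap.id - (-1 : k) ^ (n + 1) • cyclicDual k A (n + 1) from rfl,
      LinearMap.sub_apply, LinearMap.id_apply,
      LinearMap.smul_apply, formWords_sub, formWords_smul, formWords_toForm,
      formWords_cyclicDual_toForm, neg_one_pow_smul, Nat.cast_succ, sg_sq_smul, ← hφ, h1, h2]
  funext a w
  rw [← formWords_toForm, connesStar, LinearMap.smul_apply, map_smul, formWords_smul,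
    LinearMap.comp_apply, LinearMap.comp_apply, toForm_ofForm, neg_one_pow_smul, Nat.cast_succ,
    Pi.smul_apply, Pi.smul_apply]
  congr 1
  by_cases h : w.length = n
  · have e2 : ∀ i ≤ n, formWords (((cyclicDual k A n ^ i) ∘ₗ 𝔸.insertUnitDual n ∘ₗ cyclicDual k A (n + 1) ∘ₗ T) (𝔸.toForm (n + 1) x)) (a :: w) =
        χ (w.drop (n - i) ++ a :: w.take (n - i)) := by
      intro i hi
      have := formWords_cyclicDual_pow (𝔸.insertUnitDual n (cyclicDual k A (n + 1)
        (T (𝔸.toForm (n + 1) x))))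
        (a :: w.take (n - i)) (w.drop (n - i))
      rw [e1, List.length_drop, h, Nat.sub_sub_self hi, List.cons_append, List.take_append_drop] at this
      exact this
    have e3 : formWords (𝔸.connesDual n (𝔸.toForm (n + 1) x)) (a :: w) =
        ∑ i ∈ Finset.range (n + 1), sg (i * n) • χ (w.drop (n - i) ++ a :: w.take (n - i)) := by
      rw [formWords_of_length _ (by simp [h]), connesDual, LinearMap.sum_apply, sum_apply]
      refine Finset.sum_congr rfl fun i hi => ?_
      rw [← e2 i (by simpa [Nat.lt_succ_iff] using hi), ← Nat.cast_mul, ← neg_one_pow_smul (k := k),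
        formWords_of_length _ (by simp [h])]
      rfl
    -- The power `i` of the rotation is the number of letters brought to the front, while `spl` is
    -- indexed by the `n - i` letters of the other piece; hence the reflection of the sum.
    rw [e3, Bc, Nn, nu, spl_eq_sum, h, ← Finset.sum_range_reflect]
    refine Finset.sum_congr rfl fun i hi => ?_
    have hi' : i ≤ n := by simpa [Nat.lt_succ_iff] using hi
    have : n + 1 - 1 - i = n - i := by omega
    rw [this, Nat.sub_sub_self hi', cat]
    -- The signs agree because `i * n` and `i * (n - i + 1)` have the same parity.
    refine sg_smul_congr ?_ rfl
    obtain ⟨j, rfl⟩ := Nat.exists_eq_add_of_le hi'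
    rw [par, par, List.length_drop, List.length_take, h, min_eq_left (by omega)]
    simp
    exact (zmod_two_cases _).symm
  · rw [formWords, dif_neg (by simpa using h)]
    symm
    refine spl_eq_zero fun u v huv => ?_
    have hl := congrArg List.length huv
    simp only [List.length_append] at hl
    have h1 : φ 𝔸.one (v ++ a :: u) = 0 := by
      rw [hφ, cy, words, dif_neg, LinearMap.zero_apply]
      simp; omega
    have h2 : tau φ (𝔸.one :: (v ++ a :: u)) = 0 := by
      obtain ⟨y, l, hy⟩ := (List.eq_nil_or_concat (𝔸.one :: (v ++ a :: u))).resolve_left (by simp)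
      have hl' := congrArg List.length hy
      rw [hy, List.concat_eq_append, tau_append_singleton, hφ, cy, words, dif_neg]
      · simp
      · simp at hl'; omega
    rw [cat, h1, h2]
    simp

variable {X : Type*} [AddCommGroup X] [Module k X] {φ : A → List A → X} {e : A}

/-- The transpose of `N (1 - t) = 0`, which is what makes the Connes operator square to zero. -/
lemma toT_Nn (χ : List A → X) (w : List A) : toT (Nn χ) w = tau (Nn χ) w := by
  rcases w with _ | ⟨a, w⟩
  · rfl
  rcases List.eq_nil_or_concat w with rfl | ⟨y, l, rfl⟩
  · exact (one_smul ℤ _).symm.trans (tau_append_singleton (φ := Nn χ) [] a).symm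
  rw [List.concat_eq_append, ← List.cons_append, tau_append_singleton]
  simp only [toT, List.cons_append, Nn, nu, cat]
  rw [spl_append_cons, spl_cons]
  simp only [spl_nil]
  rw [smul_add, add_comm, smul_spl]
  refine congrArg₂ (· + ·) ?_ (spl_congr fun u v huv => ?_)
  · rw [smul_smul, ← sg_add]
    simp only [par_nil, par_cons, zero_mul, zero_add, _root_.mul_one]
    have : par y + 1 + (par y + 1) = 0 := by grind
    rw [this, sg_zero, one_smul, one_smul]
    rfl
  · rw [smul_smul, ← sg_add, ← huv]
    simp only [par_append, par_cons, par_nil, List.append_assoc, List.cons_append, List.nil_append]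
    exact sg_smul_congr (by grind) rfl

lemma Bc_Bc (hφ : IsML₂ k φ) : Bc e (Bc e φ) = 0 := by
  funext a w
  refine spl_eq_zero fun u v _ => ?_
  have h : ∀ w, Bc e φ e w - tau (Bc e φ) (e :: w) = 0 := fun w =>
    sub_eq_zero.2 (toT_Nn _ (e :: w))
  rw [cat, h, smul_zero]

end connes

/-! ### Integer degrees -/

section degrees

variable {k A X Y Z : Type*} [CommRing k] [AddCommGroup A] [Module k A] [AddCommGroup X]
  [Module k X] [AddCommGroup Y] [Module k Y] [AddCommGroup Z] [Module k Z]

/-- The function `φ` vanishes on the words of length different from the integer `n`. -/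
def HasDeg (φ : List A → X) (n : ℤ) : Prop := ∀ w, φ w ≠ 0 → (w.length : ℤ) = n

variable {φ ψ : List A → X} {f g : List A → A} {m n : ℤ}

lemma HasLen.hasDeg {n : ℕ} (hφ : HasLen φ n) : HasDeg φ n := fun w hw => congrArg _ (hφ w hw)

lemma HasDeg.hasLen {n : ℕ} (hφ : HasDeg φ n) : HasLen φ n := fun w hw => by
  exact_mod_cast hφ w hw

/-- Integer degrees give a meaning to degree `-1`, where everything vanishes. This covers the
bracket of two classes of degree `0` and `B^*` in degree `0`. -/
lemma HasDeg.eq_zero {n : ℕ} (hφ : HasDeg φ (Int.negSucc n)) : φ = 0 := by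
  funext w
  by_contra h
  have := hφ w h
  omega

lemma HasDeg.hasPar (hφ : HasDeg φ n) : HasPar φ (n + 1) := fun w hw => by
  rw [par, ← hφ w hw]; simp

lemma HasDeg.zero (n : ℤ) : HasDeg (0 : List A → X) n := fun _ h => absurd rfl h

lemma HasDeg.add (hφ : HasDeg φ n) (hψ : HasDeg ψ n) : HasDeg (φ + ψ) n := fun w hw => by
  by_cases h : φ w = 0
  · exact hψ w fun h' => hw (by simp [h, h'])
  · exact hφ w h

lemma HasDeg.zsmul (hφ : HasDeg φ n) (c : ℤ) : HasDeg (c • φ) n := fun w hw =>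
  hφ w fun h => hw (by simp [h])

lemma HasDeg.conv (B : X →ₗ[k] Y →ₗ[k] Z) {ψ : List A → Y} (hφ : HasDeg φ m) (hψ : HasDeg ψ n) :
    HasDeg (conv B φ ψ) (m + n) := fun w hw => by
  by_contra hc
  refine hw (spl_eq_zero fun u v e => ?_)
  by_cases hu : φ u = 0
  · simp [hu]
  by_cases hv : ψ v = 0
  · simp [hv]
  rw [← hφ u hu, ← hψ v hv, ← e] at hc
  simp at hc

lemma HasDeg.D {q : ZMod 2} (hχ : HasDeg φ m) (hg : HasDeg g n) (hχ' : IsML k φ) :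
    HasDeg (D g q φ) (m + n - 1) := fun w hw => by
  by_contra hc
  refine hw (spl_eq_zero fun u y e => smul_eq_zero_of_right _ (spl_eq_zero fun v x e' => ?_))
  by_contra h
  have h1 := hχ _ h
  have h2 := hg v fun h0 => h (by rw [h0, hχ'.map_zero])
  have h3 := congrArg List.length e
  have h4 := congrArg List.length e'
  simp only [List.length_append, List.length_cons] at h1 h3 h4
  push_cast at h1
  omega

lemma HasDeg.br {p q : ZMod 2} (hf : HasDeg f m) (hg : HasDeg g n) (hf' : IsML k f)
    (hg' : IsML k g) : HasDeg (br f p g q) (m + n - 1) := fun w hw => by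
  by_cases h1 : HochschildWords.D g q f w = 0
  · rw [HochschildWords.br, h1, zero_sub, neg_ne_zero] at hw
    have := hg.D hf hg' w (right_ne_zero_of_smul hw)
    omega
  · exact hf.D hg hf' w h1

lemma HasDeg.connes {m : A →ₗ[k] A →ₗ[k] A} {e : A} {α : A →ₗ[k] A}
    {la : A →ₗ[k] Module.Dual k A →ₗ[k] Module.Dual k A}
    {ra : Module.Dual k A →ₗ[k] A →ₗ[k] Module.Dual k A}
    {β : Module.Dual k A →ₗ[k] Module.Dual k A} (h : IsDualBimod m e α la ra β)
    {φ : List A → Module.Dual k A} (hφ : Nice α β φ) (hn : HasDeg φ n) :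
    HasDeg (connes e φ) (n - 1) := fun w hw => by
  by_contra hc
  apply hw
  ext a
  have h0 : ∀ u : List A, (u.length : ℤ) ≠ n → ∀ a, cy φ a u = 0 := by
    intro u hu a
    have : φ u = 0 := by
      by_contra h1
      exact hu (hn u h1)
    rw [cy, this, LinearMap.zero_apply]
  refine (congrFun (congrFun (cy_connes h hφ) a) w).trans (spl_eq_zero fun u v huv => ?_)
  have hl := congrArg List.length huv
  simp only [List.length_append] at hl
  rw [cat, h0 _ (by simp; omega)]
  obtain ⟨y, l, hy⟩ := (List.eq_nil_or_concat (e :: (v ++ a :: u))).resolve_left (by simp)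
  have hl' := congrArg List.length hy
  rw [hy, List.concat_eq_append, tau_append_singleton, h0]
  · simp
  · simp at hl'; omega

variable {M : Type*} [AddCommGroup M] [Module k M] {m : A →ₗ[k] A →ₗ[k] A}
  {la : A →ₗ[k] M →ₗ[k] M} {ra : M →ₗ[k] A →ₗ[k] M}

/-- The coboundary on words of one length depends on a single length of the cochain, so a primitive
may be truncated to that length. -/
lemma dl_congr {φ ψ : List A → M} (hφ : IsML k φ) (hψ : IsML k ψ) {w : List A}
    (h : ∀ u, u.length + 1 = w.length → φ u = ψ u) : dl m la ra φ w = dl m la ra ψ w := by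
  unfold dl HochschildWords.conv
  congr 1
  · congr 1
    · refine spl_congr fun u v e => ?_
      by_cases hu : u.length = 1
      · rw [h v (by rw [← e]; simp; omega)]
      · simp [theta_eq_zero hu]
    · refine D_congr fun u v x e => ?_
      by_cases hv : v.length = 2
      · exact h _ (by rw [← e]; simp; omega)
      · rw [mu_eq_zero m hv, hφ.map_zero, hψ.map_zero]
  · refine spl_congr fun u v e => ?_
    by_cases hv : v.length = 1
    · beta_reduce
      rw [h u (by rw [← e]; simp; omega)]
    · simp [theta_eq_zero hv]

end degrees

/-! ### Cocycles and coboundaries as functions of words -/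

section cohomology

variable {k A : Type*} [CommRing k] [AddCommGroup A] [Module k A] {𝔸 : RegUnitalHomAlgebra k A}
variable {M : Type*} [AddCommGroup M] [Module k M] (𝓜 : RegHomBimodule 𝔸 M)

open RegUnitalHomAlgebra RegHomBimodule

/-- Equivariant cocycles of degree `n`, as functions of words. -/
structure Coc (n : ℤ) (φ : List A → M) : Prop where
  nice : Nice 𝔸.α.toLinearMap 𝓜.β.toLinearMap φ
  deg : HasDeg φ n
  closed : dl (tmul 𝔸) (tla 𝓜) (tra 𝓜) φ = 0

/-- Homologous functions of words. -/
abbrev Hml (φ ψ : List A → M) : Prop :=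
  Homologous (tmul 𝔸) 𝔸.α.toLinearMap (tla 𝓜) (tra 𝓜) 𝓜.β.toLinearMap φ ψ

variable {𝓜} {φ ψ : List A → M} {m n : ℤ}

lemma Coc.add (hφ : Coc 𝓜 n φ) (hψ : Coc 𝓜 n ψ) : Coc 𝓜 n (φ + ψ) :=
  ⟨hφ.nice.add hψ.nice, hφ.deg.add hψ.deg, by rw [dl_add, hφ.closed, hψ.closed, add_zero]⟩

lemma Coc.zsmul (hφ : Coc 𝓜 n φ) (c : ℤ) : Coc 𝓜 n (c • φ) :=
  ⟨hφ.nice.zsmul c, hφ.deg.zsmul c, by rw [dl_zsmul, hφ.closed, smul_zero]⟩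

lemma Coc.zero (n : ℤ) : Coc 𝓜 n (0 : List A → M) := ⟨.zero, .zero n, dl_zero⟩

lemma Coc.conv {f : List A → A} (hf : Coc 𝔸.selfBimodule m f) (hφ : Coc 𝓜 n φ) :
    Coc 𝓜 (m + n) (conv (tla 𝓜) f φ) :=
  ⟨hf.nice.conv (isEquivBimod 𝓜).map_la hφ.nice, hf.deg.conv _ hφ.deg,
    dl_conv_eq_zero (isEquivBimod 𝓜).toIsBimod hf.closed hφ.closed⟩

lemma Coc.br {f g : List A → A} (hf : Coc 𝔸.selfBimodule m f) (hg : Coc 𝔸.selfBimodule n g) :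
    Coc 𝔸.selfBimodule (m + n - 1) (br f (m + 1) g (n + 1)) :=
  ⟨hf.nice.br hg.nice, hf.deg.br hg.deg hf.nice.ml hg.nice.ml,
    dl_br_eq_zero hf.deg.hasPar hg.deg.hasPar hf.nice.ml hg.nice.ml hf.closed hg.closed⟩

lemma Coc.connes {φ : List A → Module.Dual k A} (hφ : Coc 𝔸.dualBimodule n φ) :
    Coc 𝔸.dualBimodule (n - 1) (connes 𝔸.one φ) :=
  ⟨hφ.nice.connes isDualBimod, hφ.deg.connes isDualBimod hφ.nice, dl_connes isDualBimod hφ.nice hφ.closed⟩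

lemma mem_cocycles_iff {n : ℕ} {x : MultiCochain k A M n} :
    x ∈ 𝓜.cocycles n ↔ Coc 𝓜 n (words 𝓜 x) := by
  constructor
  · intro hx
    refine ⟨(mem_cochains_iff 𝓜).1 hx.1, (hasLen_words 𝓜 x).hasDeg, ?_⟩
    rw [← words_δ 𝓜 hx.1, LinearMap.mem_ker.1 hx.2, words_zero]
  · intro hx
    have h := (mem_cochains_iff 𝓜).2 hx.nice
    refine ⟨h, LinearMap.mem_ker.2 (words_injective 𝓜 ?_)⟩
    rw [words_δ 𝓜 h, hx.closed, words_zero]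

lemma exists_mem_cochains {φ : List A → M} (hφ : Nice 𝔸.α.toLinearMap 𝓜.β.toLinearMap φ) (n : ℕ) :
    ∃ x ∈ 𝓜.cochains n, ∀ w, w.length = n → words 𝓜 x w = φ w := by
  obtain ⟨x, hx⟩ := exists_words 𝓜 (n := n) hφ.ml
  refine ⟨x, (mem_cochains_iff 𝓜).2 ⟨isML_words 𝓜 x, fun w => ?_⟩, hx⟩
  by_cases hw : w.length = n
  · rw [hx w hw, hx _ (by simpa using hw), hφ.eqv]
  · have : ¬ (w.map 𝔸.α.toLinearMap).length = n := by simpa using hw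
    rw [words, words, dif_neg hw, dif_neg this, map_zero]

lemma exists_mem_cocycles {n : ℕ} (hφ : Coc 𝓜 n φ) : ∃ x ∈ 𝓜.cocycles n, words 𝓜 x = φ := by
  obtain ⟨x, hx, h⟩ := exists_mem_cochains hφ.nice n
  have := words_ext (hasLen_words 𝓜 x) hφ.deg.hasLen h
  exact ⟨x, mem_cocycles_iff.2 (this ▸ hφ), this⟩

lemma mem_coboundaries_iff {n : ℕ} {x : MultiCochain k A M n} :
    x ∈ 𝓜.coboundaries n ↔ Hml 𝓜 (words 𝓜 x) 0 := by
  constructor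
  · intro hx
    cases n with
    | zero =>
      have : x = 0 := hx
      rw [this, words_zero]
      exact .refl 0
    | succ n =>
      obtain ⟨y, hy, rfl⟩ := hx
      exact ⟨words 𝓜 y, (mem_cochains_iff 𝓜).1 hy, by rw [words_δ 𝓜 hy, zero_add]⟩
  · rintro ⟨η, hη, h⟩
    rw [zero_add] at h
    cases n with
    | zero =>
      refine words_injective 𝓜 ?_
      rw [words_zero]
      refine words_ext (hasLen_words 𝓜 x) (fun w h => absurd rfl h) fun w hw => ?_
      -- Every coboundary vanishes on the empty word, in agreement with `coboundaries 0 = ⊥`.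
      rw [List.length_eq_zero_iff.1 hw, h, dl, D_nil_eq_zero hη.ml, conv, conv, spl_nil, spl_nil]
      simp
    | succ n =>
      -- The primitive `η` need not be homogeneous; its part in length `n` has the same coboundary
      -- in length `n + 1`.
      obtain ⟨y, hy, h'⟩ := exists_mem_cochains hη n
      refine ⟨y, hy, words_injective 𝓜 ?_⟩
      refine words_ext (hasLen_words 𝓜 _) (hasLen_words 𝓜 _) fun w hw => ?_
      rw [words_δ 𝓜 hy, h]
      exact dl_congr (isML_words 𝓜 y) hη.ml fun u hu => h' u (by omega)

lemma coboundaries_le_cocycles (n : ℕ) : 𝓜.coboundaries n ≤ 𝓜.cocycles n := by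
  intro x hx
  obtain ⟨η, hη, h⟩ := mem_coboundaries_iff.1 hx
  rw [zero_add] at h
  have hE := isEquivBimod 𝓜
  refine mem_cocycles_iff.2 ⟨?_, (hasLen_words 𝓜 x).hasDeg, ?_⟩
  · rw [h]
    exact hη.dl hE.map_mul hE.map_la hE.map_ra
  · rw [h]
    exact funext (dl_dl hE.toIsBimod hη.ml)

lemma mulCochain_mem : 𝔸.mulCochain ∈ 𝔸.selfBimodule.cochains 2 := by
  rw [mem_cochains_iff, words_mulCochain]
  exact Nice.mu (isEquivBimod 𝔸.selfBimodule).map_mul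

/-- In `(μ ∘₂ f) ∘₁ g` the cochain `g` takes the first letters, so the order of the factors is
reversed. -/
lemma words_cup {p q : ℕ} {f : MultiCochain k A A p} (hf : f ∈ 𝔸.selfBimodule.cochains p)
    (g : MultiCochain k A A q) : words 𝔸.selfBimodule (𝔸.cup p q f g) =
      conv (tmul 𝔸) (words 𝔸.selfBimodule g) (words 𝔸.selfBimodule f) := by
  have hmu : ∀ a b : A, words 𝔸.selfBimodule 𝔸.mulCochain [a, b] = tmul 𝔸 a b := by
    intro a b; rw [words_mulCochain]; simp [mu]
  have h1 : words 𝔸.selfBimodule (𝔸.circ (p := 2) (n := p + 1) (by omega) 1 𝔸.mulCochain f) =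
      conv (tmul 𝔸) theta (words 𝔸.selfBimodule f) := by
    have hl := hasLen_theta.conv (tmul 𝔸) (hasLen_words 𝔸.selfBimodule f)
    rw [add_comm] at hl
    refine words_ext (hasLen_words _ _) hl fun w hw => ?_
    rw [words_circ _ _ _ mulCochain_mem _ hw, conv, spl_eq_of_length (p := 1) (by omega)]
    · match w, hw with
      | a :: w, hw =>
        have hw' : w.length = p := by simpa using hw
        simpa [← hw', add_comm 1] using hmu a (words 𝔸.selfBimodule f w)
    · intro u v _ hu
      simp [theta_eq_zero hu]
  have h2 : 𝔸.circ (p := 2) (n := p + 1) (by omega) 1 𝔸.mulCochain f ∈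
      𝔸.selfBimodule.cochains (p + 1) := by
    rw [mem_cochains_iff, h1]
    exact Nice.conv (isEquivBimod 𝔸.selfBimodule).map_mul .theta ((mem_cochains_iff _).1 hf)
  have hl := (hasLen_words 𝔸.selfBimodule g).conv (tmul 𝔸) (hasLen_words 𝔸.selfBimodule f)
  rw [add_comm] at hl
  refine words_ext (hasLen_words _ _) hl fun w hw => ?_
  have e := words_circ 𝔸.selfBimodule (p := p + 1) (q := q) (n := p + q) (by omega) 0 h2 g hw
  refine e.trans ?_
  rw [h1, conv, conv, spl_eq_of_length (p := 1) (by simp), spl_eq_of_length (p := q) (by omega)]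
  · simp
  · intro u v _ hu
    have : words 𝔸.selfBimodule g u = 0 := dif_neg hu
    rw [this, map_zero, LinearMap.zero_apply]
  · intro u v _ hu
    simp [theta_eq_zero hu]

end cohomology

/-! ### Operations on cohomology classes -/

section descent

variable {k A : Type*} [CommRing k] [AddCommGroup A] [Module k A] {𝔸 : RegUnitalHomAlgebra k A}
variable {M : Type*} [AddCommGroup M] [Module k M] {𝓜 : RegHomBimodule 𝔸 M}

open RegUnitalHomAlgebra RegHomBimodule

variable {φ ψ : List A → M} {f g : List A → A} {m n : ℤ}

lemma Coc.conv_homologous (hf : Coc 𝔸.selfBimodule m f) (h : Hml 𝓜 φ ψ) :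
    Hml 𝓜 (HochschildWords.conv (tla 𝓜) f φ) (HochschildWords.conv (tla 𝓜) f ψ) :=
  h.conv (isEquivBimod 𝓜) hf.deg.hasPar hf.nice hf.closed

lemma Coc.conv_homologous_zero (hφ : Coc 𝓜 n φ) (h : Hml 𝔸.selfBimodule f 0) :
    Hml 𝓜 (HochschildWords.conv (tla 𝓜) f φ) 0 := by
  obtain ⟨η, hη, rfl⟩ := h
  refine ⟨HochschildWords.conv (tla 𝓜) η φ, hη.conv (isEquivBimod 𝓜).map_la hφ.nice, ?_⟩
  rw [dl_conv' (isEquivBimod 𝓜).toIsBimod, hφ.closed, conv_zero_right, zero_add, zero_add, add_zero]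
  rfl

lemma Coc.eq_zero_or (hφ : Coc 𝓜 n φ) :
    φ = 0 ∨ ∃ (N : ℕ) (x : 𝓜.cocycles N), n = N ∧ φ = words 𝓜 (x : MultiCochain k A M N) := by
  obtain N | N := n
  · obtain ⟨x, hx, h⟩ := exists_mem_cocycles (n := N) hφ
    exact Or.inr ⟨N, ⟨x, hx⟩, rfl, h.symm⟩
  · exact Or.inl hφ.deg.eq_zero

/-- `Homologous` allows inhomogeneous primitives, but the signs in the bracket require one with a
definite degree. -/
lemma Coc.exists_primitive (hφ : Coc 𝓜 n φ) (h : Hml 𝓜 φ 0) :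
    ∃ η, Nice 𝔸.α.toLinearMap 𝓜.β.toLinearMap η ∧ HasDeg η (n - 1) ∧
      φ = dl (tmul 𝔸) (tla 𝓜) (tra 𝓜) η := by
  obtain rfl | ⟨N, ⟨x, hx⟩, rfl, rfl⟩ := hφ.eq_zero_or
  · exact ⟨0, .zero, .zero _, dl_zero.symm⟩
  have h' := mem_coboundaries_iff.2 h
  cases N with
  | zero =>
    have : x = 0 := h'
    subst this
    exact ⟨0, .zero, .zero _, by rw [dl_zero, words_zero]⟩
  | succ N =>
    obtain ⟨y, hy, rfl⟩ := h'
    refine ⟨words 𝓜 y, (mem_cochains_iff 𝓜).1 hy, ?_, words_δ 𝓜 hy⟩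
    have := (hasLen_words 𝓜 y).hasDeg
    simpa using this

lemma Coc.br_homologous_zero_left (hg : Coc 𝔸.selfBimodule n g) (hf : Coc 𝔸.selfBimodule m f)
    (h : Hml 𝔸.selfBimodule f 0) :
    Hml 𝔸.selfBimodule (HochschildWords.br f (m + 1) g (n + 1)) 0 := by
  obtain ⟨η, hη, hd, rfl⟩ := hf.exists_primitive h
  refine ⟨sg (n + 1) • HochschildWords.br η m g (n + 1), (hη.br hg.nice).zsmul _, ?_⟩
  have hp := hd.hasPar
  push_cast at hp
  rw [sub_add_cancel] at hp
  rw [zero_add, dl_zsmul]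
  funext w
  have := dl_br hp hg.deg.hasPar hη.ml hg.nice.ml (congrFun hg.closed) w
  rw [Pi.smul_apply]
  refine Eq.trans ?_ (congrArg (sg ((n : ZMod 2) + 1) • ·) this.symm)
  exact (sg_sq_smul _ _).symm

lemma Coc.br_homologous_zero_right (hg : Coc 𝔸.selfBimodule n g) (hf : Coc 𝔸.selfBimodule m f)
    (h : Hml 𝔸.selfBimodule f 0) :
    Hml 𝔸.selfBimodule (HochschildWords.br g (n + 1) f (m + 1)) 0 := by
  have := (hg.br_homologous_zero_left hf h).zsmul (-sg ((m + 1) * (n + 1)))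
  rw [smul_zero] at this
  refine .trans (.of_eq ?_) this
  funext w
  exact br_symm w

/-- The cohomology class of a cocycle given as a function of words. -/
noncomputable def Cl (𝓜 : RegHomBimodule 𝔸 M) (φ : List A → M) : 𝓜.HTot :=
  open Classical in
  if h : ∃ n, ∃ x : 𝓜.cocycles n, words 𝓜 (x : MultiCochain k A M n) = φ then
    DirectSum.lof k ℕ 𝓜.H h.choose (Submodule.Quotient.mk h.choose_spec.choose)
  else 0

/-- The choice in `Cl` is harmless: a nonzero function of words determines its degree and its
cochain, and the zero function has class zero in every degree. -/
lemma Cl_words {n : ℕ} (x : 𝓜.cocycles n) :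
    Cl 𝓜 (words 𝓜 (x : MultiCochain k A M n)) = DirectSum.lof k ℕ 𝓜.H n (Submodule.Quotient.mk x) := by
  have h : ∃ n', ∃ x' : 𝓜.cocycles n', words 𝓜 (x' : MultiCochain k A M n') =
    words 𝓜 (x : MultiCochain k A M n) := ⟨n, x, rfl⟩
  rw [Cl, dif_pos h]
  have h1 := h.choose_spec.choose_spec
  generalize h.choose_spec.choose = x' at h1 ⊢
  generalize h.choose = n' at x' h1 ⊢
  by_cases hn : n' = n
  · subst hn
    rw [Subtype.ext (words_injective 𝓜 h1)]
  · have key : words 𝓜 (x : MultiCochain k A M n) = 0 := by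
      funext w
      by_contra hw
      have h2 := hasLen_words 𝓜 _ w hw
      rw [← h1] at hw
      exact hn ((hasLen_words 𝓜 _ w hw).symm.trans h2)
    have hx : x = 0 := Subtype.ext (words_injective 𝓜 (key.trans (words_zero 𝓜).symm))
    have hx' : x' = 0 := Subtype.ext (words_injective 𝓜 ((h1.trans key).trans (words_zero 𝓜).symm))
    rw [hx, hx', Submodule.Quotient.mk_zero, Submodule.Quotient.mk_zero, map_zero, map_zero]

lemma directSum_smul_zero {X : ℕ → Type*} [∀ n, AddCommMonoid (X n)] [∀ n, Module k (X n)] (c : k) :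
    c • (0 : ⨁ n, X n) = 0 := smul_zero c

lemma Cl_zero : Cl 𝓜 (0 : List A → M) = 0 := by
  have := Cl_words (0 : 𝓜.cocycles 0)
  rwa [Submodule.coe_zero, words_zero, Submodule.Quotient.mk_zero, map_zero] at this

lemma Cl_smul (hφ : Coc 𝓜 n φ) (c : k) : Cl 𝓜 (c • φ) = c • Cl 𝓜 φ := by
  obtain rfl | ⟨N, x, rfl, rfl⟩ := hφ.eq_zero_or
  · rw [smul_zero, Cl_zero]
    exact (directSum_smul_zero c).symm
  · rw [← words_smul, ← Submodule.coe_smul, Cl_words, Cl_words, ← map_smul]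
    rfl

/-- The sign of a parity as a scalar. -/
def sk (k : Type*) [CommRing k] (e : ZMod 2) : k := (sg e : ℤ)

lemma sk_smul {X : Type*} [AddCommGroup X] [Module k X] (e : ZMod 2) (x : X) :
    sk k e • x = sg e • x := Int.cast_smul_eq_zsmul k _ x

lemma Cl_sg_smul (hφ : Coc 𝓜 n φ) (e : ZMod 2) : Cl 𝓜 (sg e • φ) = sk k e • Cl 𝓜 φ := by
  rw [← Cl_smul hφ]
  exact congrArg (Cl 𝓜) (sk_smul (k := k) e φ).symm

lemma Cl_add (hφ : Coc 𝓜 n φ) (hψ : Coc 𝓜 n ψ) : Cl 𝓜 (φ + ψ) = Cl 𝓜 φ + Cl 𝓜 ψ := by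
  obtain rfl | ⟨N, x, rfl, rfl⟩ := hφ.eq_zero_or
  · rw [zero_add, Cl_zero, zero_add]
  obtain rfl | ⟨N', y, h, rfl⟩ := hψ.eq_zero_or
  · rw [add_zero, Cl_zero, add_zero]
  obtain rfl : N = N' := by exact_mod_cast h
  rw [← words_add, ← Submodule.coe_add, Cl_words, Cl_words, Cl_words, ← map_add]
  rfl

lemma Cl_eq_zero (hφ : Coc 𝓜 n φ) (h : Hml 𝓜 φ 0) : Cl 𝓜 φ = 0 := by
  obtain rfl | ⟨N, x, rfl, rfl⟩ := hφ.eq_zero_or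
  · exact Cl_zero
  · rw [Cl_words, (Submodule.Quotient.mk_eq_zero _).2, map_zero]
    exact mem_coboundaries_iff.2 h

lemma Cl_congr (hφ : Coc 𝓜 n φ) (hψ : Coc 𝓜 n ψ) (h : Hml 𝓜 φ ψ) : Cl 𝓜 φ = Cl 𝓜 ψ := by
  have h1 := h.add ((Homologous.refl ψ).zsmul (-1))
  rw [neg_one_smul, add_neg_cancel, ← neg_one_smul ℤ] at h1
  have hd := hφ.add (hψ.zsmul (-1))
  have h2 := Cl_add hψ hd
  rw [Cl_eq_zero hd h1, add_zero] at h2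
  rw [← h2, neg_one_smul, add_add_neg_cancel'_right]

lemma Cl_mem (hφ : Coc 𝓜 n φ) : Cl 𝓜 φ ∈ intGrading k 𝓜.H n := by
  obtain rfl | ⟨N, x, rfl, rfl⟩ := hφ.eq_zero_or
  · rw [Cl_zero]; exact Submodule.zero_mem _
  · rw [Cl_words]
    exact ⟨_, rfl⟩

lemma exists_Cl_of_mem {x : 𝓜.HTot} (hx : x ∈ intGrading k 𝓜.H n) :
    ∃ φ, Coc 𝓜 n φ ∧ x = Cl 𝓜 φ := by
  obtain N | N := n
  · obtain ⟨y, rfl⟩ := hx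
    obtain ⟨y, rfl⟩ := Submodule.Quotient.mk_surjective _ y
    exact ⟨words 𝓜 (y : MultiCochain k A M N), mem_cocycles_iff.1 y.2, (Cl_words y).symm⟩
  · exact ⟨0, .zero _, hx.trans Cl_zero.symm⟩

lemma HTot_induction {P : 𝓜.HTot → Prop} (h : ∀ (n : ℕ) φ, Coc 𝓜 n φ → P (Cl 𝓜 φ))
    (h' : ∀ x y, P x → P y → P (x + y)) (x : 𝓜.HTot) : P x := by
  induction x using DirectSum.induction_on with
  | zero => rw [← Cl_zero]; exact h 0 0 (.zero _)
  | of n y =>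
    obtain ⟨φ, hφ, e⟩ := exists_Cl_of_mem (𝓜 := 𝓜) (n := n) (x := DirectSum.of 𝓜.H n y) ⟨y, rfl⟩
    rw [e]
    exact h n φ hφ
  | add x y hx hy => exact h' x y hx hy

lemma Coc.cast (hφ : Coc 𝓜 n φ) (h : n = m) : Coc 𝓜 m φ := h ▸ hφ

lemma descends₂_act (p n : ℕ) : Descends₂ (𝓜.act p n)
    (𝔸.selfBimodule.cocycles p) (𝔸.selfBimodule.coboundaries p)
    (𝓜.cocycles n) (𝓜.coboundaries n) (𝓜.cocycles (p + n)) (𝓜.coboundaries (p + n)) := by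
  refine ⟨fun x hx y hy => ?_, fun x hx y hy h => ?_, fun x hx y hy h => ?_⟩
  all_goals have hx' := mem_cocycles_iff.1 hx
  all_goals have hy' := mem_cocycles_iff.1 hy
  · rw [mem_cocycles_iff, words_act]
    exact ((hx'.conv hy').zsmul _).cast (by simp)
  · rw [mem_coboundaries_iff, words_act]
    simpa using (hy'.conv_homologous_zero (mem_coboundaries_iff.1 h)).zsmul (sg (p * n))
  · rw [mem_coboundaries_iff, words_act]
    have := (hx'.conv_homologous (mem_coboundaries_iff.1 h)).zsmul (sg (p * n))
    rwa [conv_zero_right, smul_zero] at this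

lemma descends₂_cup (p q : ℕ) : Descends₂ (𝔸.cup p q)
    (𝔸.selfBimodule.cocycles p) (𝔸.selfBimodule.coboundaries p)
    (𝔸.selfBimodule.cocycles q) (𝔸.selfBimodule.coboundaries q)
    (𝔸.selfBimodule.cocycles (p + q)) (𝔸.selfBimodule.coboundaries (p + q)) := by
  refine ⟨fun x hx y hy => ?_, fun x hx y hy h => ?_, fun x hx y hy h => ?_⟩
  all_goals have hx' := mem_cocycles_iff.1 hx
  all_goals have hy' := mem_cocycles_iff.1 hy
  · rw [mem_cocycles_iff, words_cup hx.1]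
    exact (hy'.conv hx').cast (by push_cast; ring)
  · rw [mem_coboundaries_iff, words_cup hx.1]
    have := hy'.conv_homologous (mem_coboundaries_iff.1 h)
    rwa [conv_zero_right] at this
  · rw [mem_coboundaries_iff, words_cup hx.1]
    exact hx'.conv_homologous_zero (mem_coboundaries_iff.1 h)

lemma descends₂_bracket (p q n : ℕ) (h : n + 1 = p + q) : Descends₂ (𝔸.bracket h)
    (𝔸.selfBimodule.cocycles p) (𝔸.selfBimodule.coboundaries p)
    (𝔸.selfBimodule.cocycles q) (𝔸.selfBimodule.coboundaries q)
    (𝔸.selfBimodule.cocycles n) (𝔸.selfBimodule.coboundaries n) := by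
  refine ⟨fun x hx y hy => ?_, fun x hx y hy h => ?_, fun x hx y hy h => ?_⟩
  all_goals have hx' := mem_cocycles_iff.1 hx
  all_goals have hy' := mem_cocycles_iff.1 hy
  · rw [mem_cocycles_iff, words_bracket h hx.1 hy.1]
    have := (hx'.br hy').cast (m := n) (by omega)
    simpa using this
  · rw [mem_coboundaries_iff, words_bracket _ hx.1 hy.1]
    simpa using hy'.br_homologous_zero_left hx' (mem_coboundaries_iff.1 h)
  · rw [mem_coboundaries_iff, words_bracket _ hx.1 hy.1]
    simpa using hx'.br_homologous_zero_right hy' (mem_coboundaries_iff.1 h)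

lemma descends_connesStar (n : ℕ) : Descends (X := MultiCochain k A (Module.Dual k A) (n + 1))
    (Y := MultiCochain k A (Module.Dual k A) n) (𝔸.connesStar n)
    (𝔸.dualBimodule.cocycles (n + 1)) (𝔸.dualBimodule.coboundaries (n + 1))
    (𝔸.dualBimodule.cocycles n) (𝔸.dualBimodule.coboundaries n) := by
  refine ⟨fun x hx => ?_, fun x hx h => ?_⟩
  all_goals have hx' := mem_cocycles_iff.1 hx
  · rw [mem_cocycles_iff, words_connesStar hx.1]
    exact (hx'.connes.zsmul _).cast (by simp)
  · rw [mem_coboundaries_iff, words_connesStar hx.1]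
    obtain ⟨η, hη, e⟩ := mem_coboundaries_iff.1 h
    rw [zero_add] at e
    refine ⟨-sg (n + 1) • connes 𝔸.one η, (hη.connes isDualBimod).zsmul _, ?_⟩
    rw [e, connes_dl isDualBimod hη, zero_add, dl_zsmul, smul_neg, neg_smul]

theorem operationsWellDefined (𝔸 : RegUnitalHomAlgebra k A) : 𝔸.OperationsWellDefined where
  self_le := coboundaries_le_cocycles
  dual_le := coboundaries_le_cocycles
  cup := descends₂_cup
  bracket := descends₂_bracket
  act := descends₂_act
  connesStar := descends_connesStar

lemma actTot_Cl (hf : Coc 𝔸.selfBimodule m f) (hφ : Coc 𝓜 n φ) :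
    𝓜.actTot (Cl _ f) (Cl 𝓜 φ) = sk k (m * n) • Cl 𝓜 (conv (tla 𝓜) f φ) := by
  obtain rfl | ⟨N, x, rfl, rfl⟩ := hf.eq_zero_or
  · rw [conv_zero_left, Cl_zero, Cl_zero, map_zero, LinearMap.zero_apply]
    exact (directSum_smul_zero _).symm
  obtain rfl | ⟨N', y, rfl, rfl⟩ := hφ.eq_zero_or
  · rw [conv_zero_right, Cl_zero, map_zero]
    exact (directSum_smul_zero _).symm
  rw [← Cl_sg_smul (hf.conv hφ), Cl_words, Cl_words, actTot, totalBilin_lof, actH,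
    inducedMap₂_mk _ (descends₂_act _ _), ← Cl_words]
  simp only [words_act]
  simp

lemma cupTot_Cl (hf : Coc 𝔸.selfBimodule m f) (hg : Coc 𝔸.selfBimodule n g) :
    𝔸.cupTot (Cl _ f) (Cl _ g) = Cl 𝔸.selfBimodule (conv (tmul 𝔸) g f) := by
  obtain rfl | ⟨N, x, rfl, rfl⟩ := hf.eq_zero_or
  · rw [conv_zero_right, Cl_zero, map_zero, LinearMap.zero_apply]
  obtain rfl | ⟨N', y, rfl, rfl⟩ := hg.eq_zero_or
  · rw [conv_zero_left, Cl_zero, map_zero]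
  rw [Cl_words, Cl_words, cupTot, totalBilin_lof, cupH,
    inducedMap₂_mk _ (descends₂_cup _ _), ← Cl_words]
  simp only [words_cup x.2.1]

lemma bracketTot_Cl (hf : Coc 𝔸.selfBimodule m f) (hg : Coc 𝔸.selfBimodule n g) :
    𝔸.bracketTot (Cl _ f) (Cl _ g) = Cl 𝔸.selfBimodule (br f (m + 1) g (n + 1)) := by
  have hb := hf.br hg
  obtain rfl | ⟨N, x, rfl, rfl⟩ := hf.eq_zero_or
  · rw [br_zero_left hg.nice.ml, Cl_zero, map_zero, LinearMap.zero_apply]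
  obtain rfl | ⟨N', y, rfl, rfl⟩ := hg.eq_zero_or
  · have : br (words 𝔸.selfBimodule (x : MultiCochain k A A N)) ((N : ℤ) + 1 : ZMod 2) 0 ((n : ZMod 2) + 1) = 0 := by
      funext w
      rw [br_symm, br_zero_left hf.nice.ml, Pi.zero_apply, smul_zero]
    rw [this, Cl_zero, map_zero]
  -- For two classes of degree `0` the bracket of words has degree `-1`, hence is zero, in agreement
  -- with the convention in `bracketH`.
  by_cases h : N + N' = 0
  · have h0 := (hb.cast (m := Int.negSucc 0) (by omega)).deg.eq_zero
    rw [h0, Cl_words, Cl_words, bracketTot, totalBilin_lof, bracketH, dif_pos h, Cl_zero]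
    simp
  · rw [Cl_words, Cl_words, bracketTot, totalBilin_lof, bracketH, dif_neg h,
      inducedMap₂_mk _ (descends₂_bracket _ _ _ _), ← Cl_words]
    simp only [words_bracket _ x.2.1 y.2.1]
    simp

lemma toModule_Cl (G : ∀ n, 𝓜.H n →ₗ[k] 𝓜.HTot) {N : ℕ} (x : 𝓜.cocycles N) :
    DirectSum.toModule k ℕ 𝓜.HTot G (Cl 𝓜 (words 𝓜 (x : MultiCochain k A M N))) =
      G N (Submodule.Quotient.mk x) := by
  rw [Cl_words, DirectSum.toModule_lof]

lemma lof_inducedMap {N : ℕ} (F : MultiCochain k A M (N + 1) →ₗ[k] MultiCochain k A M N)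
    (h : Descends F (𝓜.cocycles (N + 1)) (𝓜.coboundaries (N + 1)) (𝓜.cocycles N)
      (𝓜.coboundaries N)) (x : 𝓜.cocycles (N + 1)) :
    (DirectSum.lof k ℕ 𝓜.H N ∘ₗ inducedMap F (𝓜.cocycles (N + 1)) (𝓜.coboundaries (N + 1))
      (𝓜.cocycles N) (𝓜.coboundaries N)) (Submodule.Quotient.mk x) = Cl 𝓜 (words 𝓜 (F x)) := by
  rw [LinearMap.comp_apply, inducedMap_mk F h, ← Cl_words]

lemma connesStarTot_Cl {φ : List A → Module.Dual k A} (hφ : Coc 𝔸.dualBimodule n φ) :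
    𝔸.connesStarTot (Cl _ φ) = sk k n • Cl 𝔸.dualBimodule (connes 𝔸.one φ) := by
  rw [← Cl_sg_smul hφ.connes]
  obtain rfl | ⟨N, x, rfl, rfl⟩ := hφ.eq_zero_or
  · rw [connes_zero isDualBimod, smul_zero, Cl_zero, map_zero]
  refine (toModule_Cl 𝔸.connesStarH x).trans ?_
  cases N with
  | zero =>
    rw [(hφ.connes.cast (m := Int.negSucc 0) (by simp)).deg.eq_zero, smul_zero, Cl_zero]
    rfl
  | succ N =>
    refine (lof_inducedMap (𝔸.connesStar N) (descends_connesStar N) x).trans ?_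
    rw [words_connesStar x.2.1]
    simp

end descent

/-! ### The calculus in cohomology -/

section calculus

variable {k A : Type*} [CommRing k] [AddCommGroup A] [Module k A] {𝔸 : RegUnitalHomAlgebra k A}
variable {M : Type*} [AddCommGroup M] [Module k M] {𝓜 : RegHomBimodule 𝔸 M}

lemma conv_conv {m : A →ₗ[k] A →ₗ[k] A} {la : A →ₗ[k] M →ₗ[k] M} {ra : M →ₗ[k] A →ₗ[k] M}
    (h : IsBimod m la ra) (f g : List A → A) (φ : List A → M) :
    conv la f (conv la g φ) = conv la (conv m f g) φ := by
  funext w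
  simp only [conv, map_spl]
  refine (spl_assoc (fun _ a b c => la (f a) (la (g b) (φ c))) w).symm.trans
    (spl_congr fun u v _ => ?_)
  refine Eq.trans ?_ (map_spl (LinearMap.applyₗ (R := k) (φ v)) _ _).symm
  simp only [LinearMap.applyₗ_apply_apply, h.la_la]

open RegUnitalHomAlgebra RegHomBimodule

variable {φ : List A → M} {f g : List A → A} {m n r : ℤ}

lemma Coc.conv_comm (hf : Coc 𝔸.selfBimodule m f) (hg : Coc 𝔸.selfBimodule n g) :
    Hml 𝔸.selfBimodule (HochschildWords.conv (tmul 𝔸) g f)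
      (sg (m * n) • HochschildWords.conv (tmul 𝔸) f g) := by
  refine ⟨-sg (n + 1) • D g (n + 1) f, (hg.nice.D hf.nice).zsmul _, ?_⟩
  funext w
  have h := dl_D hg.deg.hasPar hf.deg.hasPar hf.nice.ml hg.nice.ml (congrFun hf.closed)
    (congrFun hg.closed) w
  rw [dl_zsmul]
  refine Eq.trans ?_ (congrArg (fun x => (sg ((m : ZMod 2) * n) • HochschildWords.conv (tmul 𝔸) f g) w
    + -sg ((n : ZMod 2) + 1) • x) h.symm)
  have e : (n : ZMod 2) + 1 + (n + 1 + 1) * (m + 1 + 1) = n + 1 + m * n := by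
    generalize (n : ZMod 2) = a
    generalize (m : ZMod 2) = b
    revert a b
    decide
  rw [e, Pi.smul_apply, smul_sub, neg_smul, neg_smul, sg_sq_smul, sg_add _ ((m : ZMod 2) * n),
    mul_smul, sg_sq_smul]
  abel

lemma directSum_mul_smul {X : ℕ → Type*} [∀ n, AddCommMonoid (X n)] [∀ n, Module k (X n)] (c d : k)
    (x : ⨁ n, X n) : (c * d) • x = c • d • x := mul_smul c d x

lemma sk_smul_sk_smul (a b : ZMod 2) (x : 𝓜.HTot) : sk k a • sk k b • x = sk k (a + b) • x := by
  rw [sk, sk, sk, sg_add, Int.cast_mul]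
  exact (directSum_mul_smul _ _ _).symm

lemma actTot_sk_smul (f : 𝔸.selfBimodule.HTot) (x : 𝓜.HTot) (e : ZMod 2) :
    𝓜.actTot f (sk k e • x) = sk k e • 𝓜.actTot f x :=
  map_smul (𝓜.actTot f) (sk k e) x

lemma sk_smul_actTot (f : 𝔸.selfBimodule.HTot) (x : 𝓜.HTot) (e : ZMod 2) :
    𝓜.actTot (sk k e • f) x = sk k e • 𝓜.actTot f x :=
  LinearMap.map_smul₂ 𝓜.actTot (sk k e) f x

lemma connesStarTot_sk_smul (x : 𝔸.dualBimodule.HTot) (e : ZMod 2) :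
    𝔸.connesStarTot (sk k e • x) = sk k e • 𝔸.connesStarTot x :=
  map_smul 𝔸.connesStarTot (sk k e) x

lemma cupTot_comm {x y : 𝔸.selfBimodule.HTot} (hx : x ∈ intGrading k 𝔸.selfBimodule.H m)
    (hy : y ∈ intGrading k 𝔸.selfBimodule.H n) :
    𝔸.cupTot x y = sk k (m * n) • 𝔸.cupTot y x := by
  obtain ⟨f, hf, rfl⟩ := exists_Cl_of_mem hx
  obtain ⟨g, hg, rfl⟩ := exists_Cl_of_mem hy
  have hfg : Coc 𝔸.selfBimodule (m + n) (conv (tmul 𝔸) f g) := hf.conv hg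
  rw [cupTot_Cl hf hg, cupTot_Cl hg hf, ← Cl_sg_smul hfg]
  exact Cl_congr (n := m + n) ((hg.conv hf).cast (add_comm _ _)) (hfg.zsmul _) (hf.conv_comm hg)

lemma cupTot_mem {x y : 𝔸.selfBimodule.HTot} (hx : x ∈ intGrading k 𝔸.selfBimodule.H m)
    (hy : y ∈ intGrading k 𝔸.selfBimodule.H n) :
    𝔸.cupTot x y ∈ intGrading k 𝔸.selfBimodule.H (m + n) := by
  obtain ⟨f, hf, rfl⟩ := exists_Cl_of_mem hx
  obtain ⟨g, hg, rfl⟩ := exists_Cl_of_mem hy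
  rw [cupTot_Cl hf hg]
  exact Cl_mem ((hg.conv hf).cast (add_comm _ _))

lemma bracketTot_mem {x y : 𝔸.selfBimodule.HTot} (hx : x ∈ intGrading k 𝔸.selfBimodule.H m)
    (hy : y ∈ intGrading k 𝔸.selfBimodule.H n) :
    𝔸.bracketTot x y ∈ intGrading k 𝔸.selfBimodule.H (m + n - 1) := by
  obtain ⟨f, hf, rfl⟩ := exists_Cl_of_mem hx
  obtain ⟨g, hg, rfl⟩ := exists_Cl_of_mem hy
  rw [bracketTot_Cl hf hg]
  exact Cl_mem (hf.br hg)

lemma actTot_mem {x : 𝔸.selfBimodule.HTot} {w : 𝓜.HTot} (hx : x ∈ intGrading k 𝔸.selfBimodule.H m)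
    (hw : w ∈ intGrading k 𝓜.H n) : 𝓜.actTot x w ∈ intGrading k 𝓜.H (m + n) := by
  obtain ⟨f, hf, rfl⟩ := exists_Cl_of_mem hx
  obtain ⟨φ, hφ, rfl⟩ := exists_Cl_of_mem hw
  rw [actTot_Cl hf hφ]
  exact Submodule.smul_mem _ _ (Cl_mem (hf.conv hφ))

lemma connesStarTot_mem {w : 𝔸.dualBimodule.HTot} (hw : w ∈ intGrading k 𝔸.dualBimodule.H n) :
    𝔸.connesStarTot w ∈ intGrading k 𝔸.dualBimodule.H (n - 1) := by
  obtain ⟨φ, hφ, rfl⟩ := exists_Cl_of_mem hw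
  rw [connesStarTot_Cl hφ, ← Cl_sg_smul hφ.connes]
  exact Cl_mem (hφ.connes.zsmul _)

/-- The cup product is represented by the convolution in reversed order, so graded commutativity is
needed. Its sign `m n` is exactly the discrepancy between the Koszul signs of the two sides. -/
lemma actTot_cupTot (x y : 𝔸.selfBimodule.HTot) (w : 𝓜.HTot) :
    𝓜.actTot (𝔸.cupTot x y) w = 𝓜.actTot x (𝓜.actTot y w) := by
  induction x using HTot_induction with
  | h' x x' hx hx' =>
    rw [LinearMap.map_add₂, LinearMap.map_add₂, LinearMap.map_add₂, hx, hx']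
  | h m f hf =>
  induction y using HTot_induction with
  | h' y y' hy hy' => rw [map_add, LinearMap.map_add₂, LinearMap.map_add₂, map_add, hy, hy']
  | h n g hg =>
  induction w using HTot_induction with
  | h' w w' hw hw' => rw [map_add, map_add, map_add, hw, hw']
  | h r φ hφ =>
  have hfg : Coc 𝔸.selfBimodule (m + n) (conv (tmul 𝔸) f g) := hf.conv hg
  have h := Cl_congr (n := m + n) ((hg.conv hf).cast (add_comm _ _)) (hfg.zsmul _) (hf.conv_comm hg)
  rw [cupTot_Cl hf hg]
  refine (congrArg (fun z => 𝓜.actTot z (Cl 𝓜 φ)) h).trans ?_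
  rw [Cl_sg_smul hfg, sk_smul_actTot, actTot_Cl hfg hφ, actTot_Cl hg hφ, actTot_sk_smul,
    actTot_Cl hf (hg.conv hφ), conv_conv (isEquivBimod 𝓜).toIsBimod, sk_smul_sk_smul,
    sk_smul_sk_smul]
  congr 2
  push_cast
  ring

lemma connesStarTot_connesStarTot (w : 𝔸.dualBimodule.HTot) :
    𝔸.connesStarTot (𝔸.connesStarTot w) = 0 := by
  induction w using HTot_induction with
  | h' w w' hw hw' => rw [map_add, map_add, hw, hw', add_zero]
  | h n φ hφ =>
  have : connes 𝔸.one (connes 𝔸.one φ) = 0 := by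
    apply cy_injective
    rw [cy_connes isDualBimod hφ.connes.nice, cy_connes isDualBimod hφ.nice,
      Bc_Bc (hφ.nice.cy isDualBimod).ml]
    rfl
  rw [connesStarTot_Cl hφ, connesStarTot_sk_smul, connesStarTot_Cl hφ.connes, this, Cl_zero,
    sk_smul_sk_smul]
  exact directSum_smul_zero _

lemma smul_four_terms_add {X : ℕ → Type*} [∀ n, AddCommMonoid (X n)] [∀ n, Module k (X n)] (r s t : k)
    (a b c d a' b' c' d' : ⨁ n, X n) :
    r • (a + a') + s • (b + b') + ((c + c') + t • (d + d')) =
      (r • a + s • b + (c + t • d)) + (r • a' + s • b' + (c' + t • d')) := by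
  simp only [smul_add]
  abel

lemma sk_smul_four_terms {X : ℕ → Type*} [∀ n, AddCommMonoid (X n)] [∀ n, Module k (X n)] {p s t e₁ e₂ e₄ a₁ a₂ a₃ a₄ : ZMod 2}
    (c₁ c₂ c₃ c₄ : ⨁ n, X n) (h₁ : s + p = e₁ + a₁) (h₂ : s = e₂ + a₂) (h₃ : s + t + p = a₃)
    (h₄ : s + t = e₄ + a₄) :
    sk k s • (sk k p • c₁ + c₂ + sk k t • (sk k p • c₃ + c₄)) =
      sk k e₁ • sk k a₁ • c₁ + sk k e₂ • sk k a₂ • c₂ +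
        (sk k a₃ • c₃ + sk k e₄ • sk k a₄ • c₄) := by
  have h (a b : ZMod 2) (x : ⨁ n, X n) : sk k a • sk k b • x = sk k (a + b) • x := by
    rw [smul_smul, sk, sk, sk, sg_add, Int.cast_mul]
  simp only [smul_add, h]
  rw [h₁, ← h₂, ← add_assoc s, h₃, h₄]

-- This is `bracket_homologous` read on classes. `h1` to `h4` put the four terms in the common
-- degree `m + n - 1 + r`, `t1` to `t4` collect the signs built into the action and `B^*`, and the
-- comparison is an identity between parities.
set_option maxHeartbeats 1000000 in
lemma actTot_bracketTot_Cl {φ : List A → Module.Dual k A} (hf : Coc 𝔸.selfBimodule m f)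
    (hg : Coc 𝔸.selfBimodule n g) (hφ : Coc 𝔸.dualBimodule r φ) :
    𝔸.dualBimodule.actTot (𝔸.bracketTot (Cl _ f) (Cl _ g)) (Cl _ φ) =
      sk k (1 + n * m + n) • 𝔸.dualBimodule.actTot (Cl _ g) (𝔸.dualBimodule.actTot (Cl _ f) (𝔸.connesStarTot (Cl _ φ))) +
      sk k (m + n + m * n) • 𝔸.dualBimodule.actTot (Cl _ g) (𝔸.connesStarTot (𝔸.dualBimodule.actTot (Cl _ f) (Cl _ φ))) +
      (𝔸.dualBimodule.actTot (Cl _ f) (𝔸.connesStarTot (𝔸.dualBimodule.actTot (Cl _ g) (Cl _ φ))) +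
      sk k (1 + m) • 𝔸.connesStarTot (𝔸.dualBimodule.actTot (Cl _ f) (𝔸.dualBimodule.actTot (Cl _ g) (Cl _ φ)))) := by
  have h := bracket_homologous isDualBimod hφ.nice hφ.closed hf.deg.hasPar hf.nice hf.closed
    hg.deg.hasPar hg.nice hg.closed
  have hB := hφ.connes
  have hfB := hf.conv hB
  have hgB := hg.conv hB
  have hfφ := hf.conv hφ
  have hgφ := hg.conv hφ
  have h1 := (hg.conv hfB).cast (m := m + n - 1 + r) (by ring)
  have h2 := (hg.conv hfφ.connes).cast (m := m + n - 1 + r) (by ring)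
  have h3 := (hf.conv hgφ.connes).cast (m := m + n - 1 + r) (by ring)
  have h4 := (hf.conv hgφ).connes.cast (m := m + n - 1 + r) (by ring)
  have hb := (hf.br hg).conv hφ
  have t1 : 𝔸.dualBimodule.actTot (Cl _ g) (𝔸.dualBimodule.actTot (Cl _ f)
      (𝔸.connesStarTot (Cl _ φ))) = sk k (r + m * (r - 1 : ℤ) + n * (m + (r - 1) : ℤ)) •
        Cl _ (conv (tla 𝔸.dualBimodule) g (conv (tla 𝔸.dualBimodule) f (connes 𝔸.one φ))) := by
    rw [connesStarTot_Cl hφ, actTot_sk_smul, actTot_Cl hf hB, actTot_sk_smul, actTot_sk_smul,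
      actTot_Cl hg hfB, sk_smul_sk_smul, sk_smul_sk_smul]
  have t2 : 𝔸.dualBimodule.actTot (Cl _ g) (𝔸.connesStarTot (𝔸.dualBimodule.actTot (Cl _ f)
      (Cl _ φ))) = sk k (m * r + (m + r : ℤ) + n * (m + r - 1 : ℤ)) •
        Cl _ (conv (tla 𝔸.dualBimodule) g (connes 𝔸.one (conv (tla 𝔸.dualBimodule) f φ))) := by
    rw [actTot_Cl hf hφ, connesStarTot_sk_smul, connesStarTot_Cl hfφ, actTot_sk_smul,
      actTot_sk_smul, actTot_Cl hg hfφ.connes, sk_smul_sk_smul, sk_smul_sk_smul]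
  have t3 : 𝔸.dualBimodule.actTot (Cl _ f) (𝔸.connesStarTot (𝔸.dualBimodule.actTot (Cl _ g)
      (Cl _ φ))) = sk k (n * r + (n + r : ℤ) + m * (n + r - 1 : ℤ)) •
        Cl _ (conv (tla 𝔸.dualBimodule) f (connes 𝔸.one (conv (tla 𝔸.dualBimodule) g φ))) := by
    rw [actTot_Cl hg hφ, connesStarTot_sk_smul, connesStarTot_Cl hgφ, actTot_sk_smul,
      actTot_sk_smul, actTot_Cl hf hgφ.connes, sk_smul_sk_smul, sk_smul_sk_smul]
  have t4 : 𝔸.connesStarTot (𝔸.dualBimodule.actTot (Cl _ f) (𝔸.dualBimodule.actTot (Cl _ g)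
      (Cl _ φ))) = sk k (n * r + m * (n + r : ℤ) + (m + (n + r) : ℤ)) •
        Cl _ (connes 𝔸.one (conv (tla 𝔸.dualBimodule) f (conv (tla 𝔸.dualBimodule) g φ))) := by
    rw [actTot_Cl hg hφ, actTot_sk_smul, connesStarTot_sk_smul, actTot_Cl hf hgφ,
      connesStarTot_sk_smul, connesStarTot_Cl (hf.conv hgφ), sk_smul_sk_smul, sk_smul_sk_smul]
  rw [t1, t2, t3, t4, bracketTot_Cl hf hg, actTot_Cl (hf.br hg) hφ, Cl_congr hb (((h1.zsmul _).add h2).add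
    (((h3.zsmul _).add h4).zsmul _)) h, Cl_add ((h1.zsmul _).add h2) (((h3.zsmul _).add h4).zsmul _),
    Cl_add (h1.zsmul _) h2, ← mul_neg_one (sg _), ← sg_one, ← sg_add, Cl_sg_smul ((h3.zsmul _).add h4),
    Cl_add (h3.zsmul _) h4, Cl_sg_smul h1, Cl_sg_smul h3]
  push_cast
  clear * -
  generalize (m : ZMod 2) = m
  generalize (n : ZMod 2) = n
  generalize (r : ZMod 2) = r
  refine sk_smul_four_terms _ _ _ _ ?_ ?_ ?_ ?_ <;> (revert m n r; decide)

lemma actTot_bracketTot {x y : 𝔸.selfBimodule.HTot} (hx : x ∈ intGrading k 𝔸.selfBimodule.H m)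
    (hy : y ∈ intGrading k 𝔸.selfBimodule.H n) (w : 𝔸.dualBimodule.HTot) :
    𝔸.dualBimodule.actTot (𝔸.bracketTot x y) w =
      sk k (1 + n * m + n) • 𝔸.dualBimodule.actTot y (𝔸.dualBimodule.actTot x (𝔸.connesStarTot w)) +
      sk k (m + n + m * n) • 𝔸.dualBimodule.actTot y (𝔸.connesStarTot (𝔸.dualBimodule.actTot x w)) +
      (𝔸.dualBimodule.actTot x (𝔸.connesStarTot (𝔸.dualBimodule.actTot y w)) +
      sk k (1 + m) • 𝔸.connesStarTot (𝔸.dualBimodule.actTot x (𝔸.dualBimodule.actTot y w))) := by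
  obtain ⟨f, hf, rfl⟩ := exists_Cl_of_mem hx
  obtain ⟨g, hg, rfl⟩ := exists_Cl_of_mem hy
  induction w using HTot_induction with
  | h' w w' hw hw' =>
    simp only [map_add, hw, hw']
    exact (smul_four_terms_add _ _ _ _ _ _ _ _ _ _ _).symm
  | h r φ hφ => exact actTot_bracketTot_Cl hf hg hφ

end calculus

/-! ### Graded commutators in an associative ring -/

section gradedCommutator

variable {E : Type*} [Ring E]

/-- The graded commutator of elements of parities `u` and `v`. -/
def gc (u v : ZMod 2) (U V : E) : E := U * V - sg (u * v) • (V * U)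

lemma gc_jacobi (u v w : ZMod 2) (U V W : E) :
    gc u (v + w) U (gc v w V W) =
      gc (u + v) w (gc u v U V) W + sg (u * v) • gc v (u + w) V (gc u w U W) := by
  simp only [gc]
  obtain rfl | rfl : u = 0 ∨ u = 1 := by revert u; decide
  all_goals obtain rfl | rfl : v = 0 ∨ v = 1 := by revert v; decide
  all_goals obtain rfl | rfl : w = 0 ∨ w = 1 := by revert w; decide
  all_goals
    simp only [mul_zero, mul_one, add_zero, zero_add, CharTwo.add_self_eq_zero, sg_zero,
      sg_one]
    noncomm_ring

lemma gc_mul (u v : ZMod 2) (U V W : E) (w : ZMod 2) :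
    gc u (v + w) U (V * W) = gc u v U V * W + sg (u * v) • (V * gc u w U W) := by
  simp only [gc, mul_add, mul_sub, sub_mul, sg_add, mul_smul, smul_sub, mul_smul_comm,
    smul_mul_assoc, mul_assoc]
  abel

lemma gc_symm (u v : ZMod 2) (U V : E) : gc u v U V = -sg (u * v) • gc v u V U := by
  simp only [gc, mul_comm v u]
  obtain h | h : sg (u * v) = 1 ∨ sg (u * v) = -1 := by
    generalize u * v = e; revert e; decide
  all_goals
    rw [h]
    noncomm_ring

lemma gc_zsmul (u v : ZMod 2) (U V : E) (c : ℤ) : gc u v U (c • V) = c • gc u v U V := by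
  simp only [gc, mul_smul_comm, smul_mul_assoc, smul_sub, smul_comm c]

end gradedCommutator

lemma negOnePow_smul {X : Type*} [AddCommGroup X] (n : ℤ) (x : X) :
    n.negOnePow • x = sg (n : ZMod 2) • x := by
  rw [Units.smul_def]
  congr 1
  obtain h | h := Int.even_or_odd n
  · rw [Int.negOnePow_even n h, (ZMod.intCast_zmod_eq_zero_iff_dvd n 2).2 (even_iff_two_dvd.1 h)]
    rfl
  · obtain ⟨r, rfl⟩ := h
    rw [Int.negOnePow_odd _ ⟨r, rfl⟩]
    have : (2 : ZMod 2) = 0 := rfl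
    push_cast
    rw [this]
    simp

lemma isInternal_intGrading (k : Type*) [CommRing k] (X : ℕ → Type*) [∀ n, AddCommGroup (X n)]
    [∀ n, Module k (X n)] : DirectSum.IsInternal (intGrading k X) := by
  rw [DirectSum.isInternal_submodule_iff_iSupIndep_and_iSup_eq_top]
  constructor
  · rintro (i | i)
    · rw [Submodule.disjoint_def]
      rintro _ ⟨x, rfl⟩ hx
      have h : (⨆ j, ⨆ (_ : j ≠ Int.ofNat i), intGrading k X j) ≤
          LinearMap.ker (DirectSum.component k ℕ X i) := by
        refine iSup₂_le fun j hj => ?_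
        obtain j | j := j
        · rintro _ ⟨y, rfl⟩
          exact DirectSum.component.of .. |>.trans (dif_neg fun h => hj (congrArg _ h))
        · exact bot_le
      have h' := h hx
      rw [LinearMap.mem_ker, DirectSum.component.lof_self] at h'
      rw [h', map_zero]
    · exact disjoint_bot_left
  · refine eq_top_iff.2 fun x _ => ?_
    induction x using DirectSum.induction_on with
    | zero => exact Submodule.zero_mem _
    | of n y => exact Submodule.mem_iSup_of_mem (Int.ofNat n) ⟨y, rfl⟩
    | add x y hx hy => exact Submodule.add_mem _ (hx trivial) (hy trivial)

/-! ### A BV algebra from a faithful action with Cartan formulas -/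

section abstractBV

variable {k V W : Type*} [CommRing k] [AddCommGroup V] [Module k V] [AddCommGroup W] [Module k W]

/-- A product and a bracket acting on a module with a square-zero operator `B` by Cartan's
formulas, such that the action on a vector annihilated by `B` is bijective. -/
structure BVData (𝒜 : ℤ → Submodule k V) (ℬ : ℤ → Submodule k W) (cup br : V →ₗ[k] V →ₗ[k] V)
    (act : V →ₗ[k] W →ₗ[k] W) (B : W →ₗ[k] W) (d : ℤ) (w₀ : W) : Prop where
  isInternal : DirectSum.IsInternal 𝒜
  isInternal' : DirectSum.IsInternal ℬ
  cup_mem : ∀ {p q : ℤ} {x y}, x ∈ 𝒜 p → y ∈ 𝒜 q → cup x y ∈ 𝒜 (p + q)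
  br_mem : ∀ {p q : ℤ} {x y}, x ∈ 𝒜 p → y ∈ 𝒜 q → br x y ∈ 𝒜 (p + q - 1)
  act_mem : ∀ {p q : ℤ} {x w}, x ∈ 𝒜 p → w ∈ ℬ q → act x w ∈ ℬ (p + q)
  B_mem : ∀ {q : ℤ} {w}, w ∈ ℬ q → B w ∈ ℬ (q - 1)
  cup_comm : ∀ {p q : ℤ} {x y}, x ∈ 𝒜 p → y ∈ 𝒜 q → cup x y = sk k (p * q) • cup y x
  act_cup : ∀ x y w, act (cup x y) w = act x (act y w)
  act_br : ∀ {p q : ℤ} {x y}, x ∈ 𝒜 p → y ∈ 𝒜 q → ∀ w, act (br x y) w =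
    sk k (1 + q * p + q) • act y (act x (B w)) + sk k (p + q + p * q) • act y (B (act x w)) +
      (act x (B (act y w)) + sk k (1 + p) • B (act x (act y w)))
  B_sq : ∀ w, B (B w) = 0
  mem : w₀ ∈ ℬ d
  B_eq_zero : B w₀ = 0
  bijective : Function.Bijective fun x => act x w₀

namespace BVData

variable {𝒜 : ℤ → Submodule k V} {ℬ : ℤ → Submodule k W} {cup br : V →ₗ[k] V →ₗ[k] V}
  {act : V →ₗ[k] W →ₗ[k] W} {B : W →ₗ[k] W} {d : ℤ} {w₀ : W}
  {p q r : ℤ} {x y z : V}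

lemma induction (h : BVData 𝒜 ℬ cup br act B d w₀) {P : V → Prop}
    (hP : ∀ q, ∀ x ∈ 𝒜 q, P x) (hadd : ∀ x y, P x → P y → P (x + y)) (x : V) : P x := by
  have hx : x ∈ ⨆ i, 𝒜 i := h.isInternal.submodule_iSup_eq_top ▸ Submodule.mem_top
  exact Submodule.iSup_induction 𝒜 (motive := P) hx hP (hP 0 0 (Submodule.zero_mem _)) hadd

/-- Evaluation at `w₀` already separates the elements of `V`; so every identity in `V` may be
checked between operators on `W`. -/
lemma act_injective (h : BVData 𝒜 ℬ cup br act B d w₀) (hxy : act x = act y) : x = y :=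
  h.bijective.1 (congrArg (fun F : W →ₗ[k] W => F w₀) hxy)

/-- The four terms of `act_br` are the expansion of the double graded commutator of `B` with the
actions of `x` and `y`. -/
lemma act_br_eq (h : BVData 𝒜 ℬ cup br act B d w₀) (hx : x ∈ 𝒜 p) (hy : y ∈ 𝒜 q) :
    act (br x y) = sg (1 + p) • gc (E := Module.End k W) (1 + p) q (gc (E := Module.End k W) 1 p B (act x)) (act y) := by
  ext w
  rw [h.act_br hx hy]
  simp only [gc, sk_smul, LinearMap.smul_apply, LinearMap.sub_apply, Module.End.mul_apply, map_sub,
    map_zsmul]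
  generalize (p : ZMod 2) = p
  generalize (q : ZMod 2) = q
  obtain rfl | rfl : p = 0 ∨ p = 1 := by revert p; decide
  all_goals obtain rfl | rfl : q = 0 ∨ q = 1 := by revert q; decide
  all_goals
    simp only [mul_zero, mul_one, add_zero, zero_add, CharTwo.add_self_eq_zero, sg_zero, sg_one,
      one_smul, neg_smul]
    abel

lemma gc_act (h : BVData 𝒜 ℬ cup br act B d w₀) (hx : x ∈ 𝒜 p) (hy : y ∈ 𝒜 q) :
    gc (E := Module.End k W) p q (act x) (act y) = 0 := by
  ext w
  simp only [gc, LinearMap.smul_apply, LinearMap.sub_apply, Module.End.mul_apply, ← h.act_cup]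
  rw [h.cup_comm hx hy, LinearMap.map_smul₂, sk_smul, sub_self]
  rfl

lemma gc_B_gc_B (h : BVData 𝒜 ℬ cup br act B d w₀) (p : ZMod 2) (U : Module.End k W) :
    gc 1 (1 + p) (B : Module.End k W) (gc 1 p B U) = 0 := by
  have hB : (B : Module.End k W) * B = 0 := LinearMap.ext h.B_sq
  simp only [gc, mul_sub, sub_mul, ← mul_assoc, hB, mul_smul_comm, smul_mul_assoc, one_mul]
  simp only [mul_assoc, hB, mul_zero, zero_mul, smul_zero, sub_zero, sg_add, sg_one, mul_smul]
  simp

lemma cup_assoc (h : BVData 𝒜 ℬ cup br act B d w₀) (x y z : V) :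
    cup (cup x y) z = cup x (cup y z) := by
  apply h.act_injective
  ext w
  simp only [h.act_cup]

/-- The actions of `x` and `y` commute in the graded sense, so the graded Jacobi identity for `B`,
`x`, `y` relates the two double commutators. -/
lemma br_skew (h : BVData 𝒜 ℬ cup br act B d w₀) (hx : x ∈ 𝒜 p) (hy : y ∈ 𝒜 q) :
    br x y = -(((p - 1) * (q - 1)).negOnePow • br y x) := by
  apply h.act_injective
  rw [negOnePow_smul, map_neg, map_zsmul, h.act_br_eq hx hy, h.act_br_eq hy hx]
  have h1 := gc_jacobi (E := Module.End k W) 1 p q B (act x) (act y)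
  rw [h.gc_act hx hy, gc_symm _ _ (act x)] at h1
  have h2 : gc (1 : ZMod 2) (p + q) (B : Module.End k W) 0 = 0 := by simp [gc]
  rw [h2, eq_comm, add_eq_zero_iff_eq_neg] at h1
  rw [h1]
  push_cast
  generalize (p : ZMod 2) = p
  generalize (q : ZMod 2) = q
  simp only [← neg_smul, smul_smul]
  congr 1
  revert p q
  decide

/-- The analogue of `L_{[x,y]} = [L_x, L_y]` with `L_x = [B, x]`: since `B² = 0`, `B` commutes in
the graded sense with `[B, x]`, and only one term of the Jacobi identity survives. -/
lemma gc_B_act_br (h : BVData 𝒜 ℬ cup br act B d w₀) (hx : x ∈ 𝒜 p) (hy : y ∈ 𝒜 q) :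
    gc (E := Module.End k W) 1 ((1 + p) + q) B (act (br x y)) =
      gc (E := Module.End k W) (1 + p) (1 + q) (gc (E := Module.End k W) 1 p B (act x)) (gc (E := Module.End k W) 1 q B (act y)) := by
  rw [h.act_br_eq hx hy, gc_zsmul, gc_jacobi, h.gc_B_gc_B]
  have h2 : gc (1 + (1 + p) : ZMod 2) q (0 : Module.End k W) (act y) = 0 := by simp [gc]
  rw [h2, zero_add, one_mul, sg_sq_smul]

/-- For homogeneous `z` this is the Jacobi identity in the endomorphism ring for `[B, x]`, `[B, y]`
and the action of `z`, with `gc_B_act_br` identifying the bracket of the first two. -/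
lemma br_jacobi (h : BVData 𝒜 ℬ cup br act B d w₀) (hx : x ∈ 𝒜 p) (hy : y ∈ 𝒜 q) (z : V) :
    br x (br y z) = br (br x y) z + ((p - 1) * (q - 1)).negOnePow • br y (br x z) := by
  revert z
  refine h.induction (fun r z hz => ?_) fun z z' hz hz' => ?_
  · apply h.act_injective
    have e {i j : ℤ} : ((i + j - 1 : ℤ) : ZMod 2) = (1 + i) + j := by
      push_cast; generalize (i : ZMod 2) = a; generalize (j : ZMod 2) = b; revert a b; decide
    rw [negOnePow_smul, map_add, map_zsmul, h.act_br_eq hx (h.br_mem hy hz), h.act_br_eq hy hz,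
      h.act_br_eq hy (h.br_mem hx hz), h.act_br_eq hx hz, h.act_br_eq (h.br_mem hx hy) hz, e, e, e,
      h.gc_B_act_br hx hy, gc_zsmul, gc_zsmul, gc_jacobi]
    have e' : (1 + (1 + p + q) : ZMod 2) = 1 + p + (1 + q) := by ring
    rw [e']
    push_cast
    generalize (p : ZMod 2) = p
    generalize (q : ZMod 2) = q
    simp only [smul_add, smul_smul]
    congr 2
    · revert p q; decide
    · revert p q; decide
  · simp only [map_add, hz, hz', negOnePow_smul, smul_add]
    abel

/-- The cup product acts as composition, and a graded commutator is a derivation of composition. -/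
lemma leibniz (h : BVData 𝒜 ℬ cup br act B d w₀) (hx : x ∈ 𝒜 p) (hy : y ∈ 𝒜 q) (z : V) :
    br x (cup y z) = cup (br x y) z + ((p - 1) * q).negOnePow • cup y (br x z) := by
  have hc (y z : V) : act (cup y z) = (act y * act z : Module.End k W) :=
    LinearMap.ext (h.act_cup y z)
  revert z
  refine h.induction (fun r z hz => ?_) fun z z' hz hz' => ?_
  · apply h.act_injective
    rw [negOnePow_smul, map_add, map_zsmul, h.act_br_eq hx (h.cup_mem hy hz), hc, hc, hc,
      h.act_br_eq hx hy, h.act_br_eq hx hz, Int.cast_add, gc_mul, smul_add, smul_mul_assoc,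
      mul_smul_comm, smul_comm (sg (1 + (p : ZMod 2)))]
    congr 3
    push_cast
    generalize (p : ZMod 2) = p
    generalize (q : ZMod 2) = q
    revert p q
    decide
  · simp only [map_add, hz, hz', negOnePow_smul, smul_add]
    abel

/-- The operator on `V` corresponding to `B` under the bijection given by the action on `w₀`. -/
noncomputable def Δ (h : BVData 𝒜 ℬ cup br act B d w₀) : V →ₗ[k] V :=
  let e := LinearEquiv.ofBijective (act.flip w₀) h.bijective
  e.symm.toLinearMap ∘ₗ B ∘ₗ e.toLinearMap

lemma act_Δ (h : BVData 𝒜 ℬ cup br act B d w₀) (x : V) : act (h.Δ x) w₀ = B (act x w₀) :=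
  (LinearEquiv.ofBijective (act.flip w₀) h.bijective).apply_symm_apply _

lemma eq_Δ (h : BVData 𝒜 ℬ cup br act B d w₀) {D : V → V}
    (hD : ∀ x, act (D x) w₀ = B (act x w₀)) : D = h.Δ :=
  funext fun x => h.bijective.1 ((hD x).trans (h.act_Δ x).symm)

lemma Δ_sq (h : BVData 𝒜 ℬ cup br act B d w₀) (x : V) : h.Δ (h.Δ x) = 0 := by
  apply h.bijective.1
  beta_reduce
  rw [h.act_Δ, h.act_Δ, h.B_sq, map_zero, LinearMap.zero_apply]

/-- Acting on `w₀` shifts degrees by exactly `d`, so it matches the component of `x` in degree `i`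
with that of the image in degree `i + d`; injectivity then forces `x` to equal its component in
degree `p`. -/
lemma mem_of_act_mem (h : BVData 𝒜 ℬ cup br act B d w₀) (hx : act x w₀ ∈ ℬ (p + d)) : x ∈ 𝒜 p := by
  classical
  let _ := h.isInternal.chooseDecomposition
  let _ := h.isInternal'.chooseDecomposition
  have key : ∀ (i : ℤ) (x : V), (DirectSum.decompose ℬ (act x w₀) (i + d) : W) =
      act (DirectSum.decompose 𝒜 x i : V) w₀ := by
    intro i
    refine h.induction (fun q x hx => ?_) fun x x' hx hx' => ?_
    · by_cases hq : q = i
      · subst hq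
        rw [DirectSum.decompose_of_mem_same ℬ (h.act_mem hx h.mem),
          DirectSum.decompose_of_mem_same 𝒜 hx]
      · rw [DirectSum.decompose_of_mem_ne ℬ (h.act_mem hx h.mem) (by omega),
          DirectSum.decompose_of_mem_ne 𝒜 hx hq, map_zero, LinearMap.zero_apply]
    · simp only [map_add, LinearMap.add_apply, DirectSum.decompose_add, DirectSum.add_apply,
        Submodule.coe_add, hx, hx']
  have : x = (DirectSum.decompose 𝒜 x p : V) := by
    apply h.bijective.1
    beta_reduce
    rw [← key, DirectSum.decompose_of_mem_same ℬ hx]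
  rw [this]
  exact SetLike.coe_mem _

lemma Δ_mem (h : BVData 𝒜 ℬ cup br act B d w₀) (hx : x ∈ 𝒜 p) : h.Δ x ∈ 𝒜 (p - 1) := by
  apply h.mem_of_act_mem
  rw [h.act_Δ, show p - 1 + d = p + d - 1 by ring]
  exact h.B_mem (h.act_mem hx h.mem)

/-- Evaluate `act_br` at `w₀`. The term with `B w₀` drops out, and the other three are the terms of
the BV identity, after `Δ x` has been commuted past `y`. -/
lemma br_eq (h : BVData 𝒜 ℬ cup br act B d w₀) (hx : x ∈ 𝒜 p) (y : V) :
    br x y = -(p.negOnePow • (h.Δ (cup x y) - cup (h.Δ x) y - p.negOnePow • cup x (h.Δ y))) := by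
  revert y
  refine h.induction (fun q y hy => ?_) fun y y' hy hy' => ?_
  · apply h.bijective.1
    beta_reduce
    rw [h.cup_comm (h.Δ_mem hx) hy, negOnePow_smul, negOnePow_smul, sk_smul]
    simp only [map_neg, map_zsmul, map_sub, LinearMap.neg_apply, LinearMap.smul_apply,
      LinearMap.sub_apply, h.act_Δ, h.act_cup]
    rw [h.act_br hx hy, h.B_eq_zero, map_zero, map_zero, smul_zero, zero_add, sk_smul, sk_smul]
    push_cast
    generalize (p : ZMod 2) = p
    generalize (q : ZMod 2) = q
    obtain rfl | rfl : p = 0 ∨ p = 1 := by revert p; decide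
    all_goals obtain rfl | rfl : q = 0 ∨ q = 1 := by revert q; decide
    all_goals
      simp [CharTwo.add_self_eq_zero]
      try abel
  · simp only [map_add, hy, hy', negOnePow_smul, smul_add, smul_sub]
    abel

theorem isBVAlgebra (h : BVData 𝒜 ℬ cup br act B d w₀) : IsBVAlgebra 𝒜 cup br h.Δ where
  isInternal := h.isInternal
  cup_mem _ _ _ hx _ hy := h.cup_mem hx hy
  cup_assoc := h.cup_assoc
  cup_comm p q x hx y hy := by
    rw [h.cup_comm hx hy, sk_smul, negOnePow_smul, Int.cast_mul]
  br_mem _ _ _ hx _ hy := h.br_mem hx hy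
  br_skew _ _ _ hx _ hy := h.br_skew hx hy
  br_jacobi _ _ _ hx _ hy := h.br_jacobi hx hy
  leibniz _ _ _ hx _ hy := h.leibniz hx hy
  Δ_mem _ _ hx := h.Δ_mem hx
  Δ_sq := h.Δ_sq
  br_eq _ _ hx := h.br_eq hx

end BVData

end abstractBV

/-! ### The hom-associative case as an instance -/

section hochschild

variable {k A : Type*} [CommRing k] [AddCommGroup A] [Module k A] (𝔸 : RegUnitalHomAlgebra k A)

open RegUnitalHomAlgebra RegHomBimodule

lemma connesStarTot_lof (d : ℕ) (m : 𝔸.dualBimodule.H d) :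
    𝔸.connesStarTot (DirectSum.lof k ℕ 𝔸.dualBimodule.H d m) = 𝔸.connesStarH d m :=
  DirectSum.toModule_lof k d m

theorem bvData {d : ℕ} {m : 𝔸.dualBimodule.H d} (hB : 𝔸.connesStarH d m = 0)
    (hm : Function.Bijective fun f : 𝔸.selfBimodule.HTot =>
      𝔸.dualBimodule.actTot f (DirectSum.lof k ℕ 𝔸.dualBimodule.H d m)) :
    BVData (intGrading k 𝔸.selfBimodule.H) (intGrading k 𝔸.dualBimodule.H) 𝔸.cupTot 𝔸.bracketTot
      𝔸.dualBimodule.actTot 𝔸.connesStarTot d (DirectSum.lof k ℕ 𝔸.dualBimodule.H d m) where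
  isInternal := isInternal_intGrading k _
  isInternal' := isInternal_intGrading k _
  cup_mem := cupTot_mem
  br_mem := bracketTot_mem
  act_mem := actTot_mem
  B_mem := connesStarTot_mem
  cup_comm := cupTot_comm
  act_cup := actTot_cupTot
  act_br := actTot_bracketTot
  B_sq := connesStarTot_connesStarTot
  mem := ⟨m, rfl⟩
  B_eq_zero := (connesStarTot_lof 𝔸 d m).trans hB
  bijective := hm

end hochschild

end HochschildWords

theorem mainTheorem6 {k A : Type*} [CommRing k] [CharZero k] [AddCommGroup A] [Module k A]
    (𝔸 : RegUnitalHomAlgebra k A) (d : ℕ) (m : 𝔸.dualBimodule.H d)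
    (hB : 𝔸.connesStarH d m = 0)
    (hm : Function.Bijective fun f : 𝔸.selfBimodule.HTot =>
      𝔸.dualBimodule.actTot f (DirectSum.lof k ℕ 𝔸.dualBimodule.H d m)) :
    𝔸.OperationsWellDefined ∧
    (∀ f g : 𝔸.selfBimodule.HTot, ∀ x : 𝔸.dualBimodule.HTot,
      𝔸.dualBimodule.actTot (𝔸.cupTot f g) x =
        𝔸.dualBimodule.actTot f (𝔸.dualBimodule.actTot g x)) ∧
    ∃ Δ : 𝔸.selfBimodule.HTot →ₗ[k] 𝔸.selfBimodule.HTot,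
      (∀ f, 𝔸.dualBimodule.actTot (Δ f) (DirectSum.lof k ℕ 𝔸.dualBimodule.H d m) =
        𝔸.connesStarTot (𝔸.dualBimodule.actTot f (DirectSum.lof k ℕ 𝔸.dualBimodule.H d m))) ∧
      (∀ Δ' : 𝔸.selfBimodule.HTot → 𝔸.selfBimodule.HTot,
        (∀ f, 𝔸.dualBimodule.actTot (Δ' f) (DirectSum.lof k ℕ 𝔸.dualBimodule.H d m) =
          𝔸.connesStarTot
            (𝔸.dualBimodule.actTot f (DirectSum.lof k ℕ 𝔸.dualBimodule.H d m))) → Δ' = Δ) ∧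
      IsBVAlgebra (intGrading k 𝔸.selfBimodule.H) 𝔸.cupTot 𝔸.bracketTot Δ := by
  have h := HochschildWords.bvData 𝔸 hB hm
  exact ⟨HochschildWords.operationsWellDefined 𝔸, HochschildWords.actTot_cupTot, h.Δ, h.act_Δ,
    fun _ => h.eq_Δ, h.isBVAlgebra⟩
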